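/- Let $M$ be a smooth four-dimensional manifold with a smooth pseudo-Riemannian metric $g$ (of any signature, in particular Lorentzian), let $U:M\to\mathbb R$ be smooth, and let $\hat g=e^{2U}g$. A semicolon denotes the covariant derivative of the Levi-Civita connection; quantities with a hat are computed from $\hat g$ (its Levi-Civita connection, its inverse, its Weyl tensor, its volume form). **(1)** Let $C_{abcd}$ be the Weyl tensor of $g$ and $C^*_{abcd}=\tfrac12\,\varepsilon_{abef}\,C^{ef}{}_{cd}$ its Hodge dual, where $\varepsilon$ is the volume form of $g$ for a local orientation. Put $$I_2=C^*_{abcd}C^{abcd},\quad I_4=C^*_{abcd;e}C^{abcd;e},\quad I_{4a}=C^*_{abcd;e}C^{ebcd;a},\quad I_6=I_{2;e}I_2{}^{;e},$$ $$K_4=6I_2I_4-16I_2I_{4a}+I_6 .$$ (The choice of orientation does not affect $K_4$.) Then, everywhere on $M$, $$\hat K_4=e^{-10U}K_4 .$$ **(2)** Let $W_{abcd}$ be a smooth Weyl-like tensor field on $(M,g)$, that is, $W_{abcd}=-W_{bacd}=-W_{abdc}=W_{cdab}$, $W_{a[bcd]}=0$ and $W^a{}_{bad}=0$. Put $$I_1=W_{abcd}W^{abcd},\quad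 I_3=W_{abcd;e}W^{abcd;e},\quad I_{3a}=W_{abcd;e}W^{ebcd;a},\quad I_5=I_{1;e}I_1{}^{;e},$$ $$J_4=6I_1I_3-16I_1I_{3a}+I_5 .$$ * (a) If $\hat W_{abcd}=e^{2U}W_{abcd}$ (the conformal weight of the Weyl tensor and of its Hodge dual), then $\hat J_4=e^{-10U}J_4$, where $\hat J_4$ is computed from $\hat g$ and $\hat W$. * (b) More generally, let $w\in\mathbb R$ and $\hat W_{abcd}=e^{wU}W_{abcd}$. Then the $J_4$-type invariant $$J_4^{(w)}=4(w-4)(w-5)\,I_1I_3+32(w-4)\,I_1I_{3a}+(w-1)(6-w)\,I_5,$$ whose coefficients never vanish simultaneously and which equals $4J_4$ for $w=2$, satisfies $\hat J_4^{(w)}=e^{(4w-18)U}J_4^{(w)}$. * (c) With $M^a{}_{bc}=W_{bdef;c}W^{adef}$ and $N^a{}_{bc}=W_{bdce;f}W^{fdae}$, the vector $$A_a=-4I_{1,a}-16M^e{}_{ae}+16M_a{}^e{}_e+64N^e{}_{ea}$$ vanishes identically. -/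

import Mathlib

open scoped Manifold ContDiff

noncomputable section

namespace ConfCov

/-! ## Coordinate tensor calculus in dimension four -/

/-- The coordinate space of a four-dimensional manifold. -/
abbrev E4 : Type := EuclideanSpace ℝ (Fin 4)

/-- Components `g_{ab}` of a metric, as functions of the coordinates. -/
abbrev MetricComp : Type := E4 → Matrix (Fin 4) (Fin 4) ℝ

/-- Components `T_{abcd}` of a `(0,4)`-tensor field, as functions of the coordinates. -/
abbrev TensorComp : Type := E4 → Fin 4 → Fin 4 → Fin 4 → Fin 4 → ℝ

/-- The partial derivative `∂_i f`. -/
def pd (i : Fin 4) (f : E4 → ℝ) (y : E4) : ℝ :=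
  fderiv ℝ f y (EuclideanSpace.single i 1)

/-- The inverse metric `g^{ab}`. -/
def ginv (g : MetricComp) (y : E4) (a b : Fin 4) : ℝ := (g y)⁻¹ a b

/-- The Christoffel symbols `Γ^a_{bc}` of the Levi-Civita connection. -/
def christoffel (g : MetricComp) (a b c : Fin 4) (y : E4) : ℝ :=
  (1 / 2) * ∑ d, ginv g y a d *
    (pd b (fun z => g z d c) y + pd c (fun z => g z d b) y - pd d (fun z => g z b c) y)

/-- The Riemann tensor `R^a_{bcd}`. -/
def riemannUp (g : MetricComp) (y : E4) (a b c d : Fin 4) : ℝ :=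
  pd c (christoffel g a d b) y - pd d (christoffel g a c b) y
    + ∑ e, (christoffel g a c e y * christoffel g e d b y
      - christoffel g a d e y * christoffel g e c b y)

/-- The Riemann tensor `R_{abcd}`. -/
def riemann (g : MetricComp) (y : E4) (a b c d : Fin 4) : ℝ :=
  ∑ e, g y a e * riemannUp g y e b c d

/-- The Ricci tensor `R_{bd} = R^a_{bad}`. -/
def ricci (g : MetricComp) (y : E4) (b d : Fin 4) : ℝ := ∑ a, riemannUp g y a b a d

/-- The scalar curvature. -/
def scalarCurv (g : MetricComp) (y : E4) : ℝ := ∑ a, ∑ b, ginv g y a b * ricci g y a b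

/-- The Weyl tensor `C_{abcd}` in dimension four. -/
def weyl (g : MetricComp) : TensorComp := fun y a b c d =>
  riemann g y a b c d
    - (1 / 2) * (g y a c * ricci g y b d - g y a d * ricci g y b c
      - g y b c * ricci g y a d + g y b d * ricci g y a c)
    + (scalarCurv g y / 6) * (g y a c * g y b d - g y a d * g y b c)

/-- The permutation symbol `[abcd]`: the sign of `(a,b,c,d)` as a permutation of `(0,1,2,3)`,
and zero if two indices agree. -/
def permSymbol (a b c d : Fin 4) : ℝ :=
  Matrix.det ((1 : Matrix (Fin 4) (Fin 4) ℝ).submatrix ![a, b, c, d] id)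

/-- The volume form `ε_{abcd}` of the metric, for the orientation given by the coordinates. -/
def volForm (g : MetricComp) (y : E4) (a b c d : Fin 4) : ℝ :=
  Real.sqrt |(g y).det| * permSymbol a b c d

/-- The Hodge dual `(1/2) ε_{abef} T^{ef}_{cd}`. -/
def hodgeDual (g : MetricComp) (T : TensorComp) : TensorComp := fun y a b c d =>
  (1 / 2) * ∑ e, ∑ f, ∑ p, ∑ q,
    volForm g y a b e f * ginv g y e p * ginv g y f q * T y p q c d

/-- The covariant derivative `T_{abcd;e}`, with arguments in the order `a b c d e`. -/
def covDeriv (g : MetricComp) (T : TensorComp) (y : E4) (a b c d e : Fin 4) : ℝ :=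
  pd e (fun z => T z a b c d) y
    - ∑ f, (christoffel g f e a y * T y f b c d + christoffel g f e b y * T y a f c d
      + christoffel g f e c y * T y a b f d + christoffel g f e d y * T y a b c f)

/-- `T^{abcd}`. -/
def raise4 (g : MetricComp) (T : TensorComp) (y : E4) (a b c d : Fin 4) : ℝ :=
  ∑ p, ∑ q, ∑ r, ∑ s,
    ginv g y a p * ginv g y b q * ginv g y c r * ginv g y d s * T y p q r s

/-- `T^{abcd;e}`. -/
def raiseCovDeriv (g : MetricComp) (T : TensorComp) (y : E4) (a b c d e : Fin 4) : ℝ :=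
  ∑ p, ∑ q, ∑ r, ∑ s, ∑ t,
    ginv g y a p * ginv g y b q * ginv g y c r * ginv g y d s * ginv g y e t *
      covDeriv g T y p q r s t

/-- `S_{abcd} T^{abcd}`. -/
def contr (g : MetricComp) (S T : TensorComp) (y : E4) : ℝ :=
  ∑ a, ∑ b, ∑ c, ∑ d, S y a b c d * raise4 g T y a b c d

/-- `S_{abcd;e} T^{abcd;e}`. -/
def gradContr (g : MetricComp) (S T : TensorComp) (y : E4) : ℝ :=
  ∑ a, ∑ b, ∑ c, ∑ d, ∑ e, covDeriv g S y a b c d e * raiseCovDeriv g T y a b c d e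

/-- `S_{abcd;e} T^{ebcd;a}`. -/
def gradContrTwist (g : MetricComp) (S T : TensorComp) (y : E4) : ℝ :=
  ∑ a, ∑ b, ∑ c, ∑ d, ∑ e, covDeriv g S y a b c d e * raiseCovDeriv g T y e b c d a

/-- `f_{;e} f^{;e}` for a scalar `f`. -/
def gradSq (g : MetricComp) (f : E4 → ℝ) (y : E4) : ℝ :=
  ∑ e, ∑ p, ginv g y e p * pd e f y * pd p f y

/-! ### The invariants built from the Weyl tensor and its Hodge dual -/

/-- `C*_{abcd}`, the Hodge dual of the Weyl tensor. -/
def weylDual (g : MetricComp) : TensorComp := hodgeDual g (weyl g)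

/-- `I_2 = C*_{abcd} C^{abcd}`. -/
def I2 (g : MetricComp) : E4 → ℝ := contr g (weylDual g) (weyl g)

/-- `I_4 = C*_{abcd;e} C^{abcd;e}`. -/
def I4 (g : MetricComp) : E4 → ℝ := gradContr g (weylDual g) (weyl g)

/-- `I_{4a} = C*_{abcd;e} C^{ebcd;a}`. -/
def I4a (g : MetricComp) : E4 → ℝ := gradContrTwist g (weylDual g) (weyl g)

/-- `I_6 = I_{2;e} I_2^{;e}`. -/
def I6 (g : MetricComp) : E4 → ℝ := gradSq g (I2 g)

/-- `K_4 = 6 I_2 I_4 - 16 I_2 I_{4a} + I_6`. -/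
def K4 (g : MetricComp) (y : E4) : ℝ :=
  6 * I2 g y * I4 g y - 16 * I2 g y * I4a g y + I6 g y

/-! ### The invariants built from an arbitrary tensor `W_{abcd}` -/

/-- `I_1 = W_{abcd} W^{abcd}`. -/
def I1 (g : MetricComp) (W : TensorComp) : E4 → ℝ := contr g W W

/-- `I_3 = W_{abcd;e} W^{abcd;e}`. -/
def I3 (g : MetricComp) (W : TensorComp) : E4 → ℝ := gradContr g W W

/-- `I_{3a} = W_{abcd;e} W^{ebcd;a}`. -/
def I3a (g : MetricComp) (W : TensorComp) : E4 → ℝ := gradContrTwist g W W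

/-- `I_5 = I_{1;e} I_1^{;e}`. -/
def I5 (g : MetricComp) (W : TensorComp) : E4 → ℝ := gradSq g (I1 g W)

/-- `J_4 = 6 I_1 I_3 - 16 I_1 I_{3a} + I_5`. -/
def J4 (g : MetricComp) (W : TensorComp) (y : E4) : ℝ :=
  6 * I1 g W y * I3 g W y - 16 * I1 g W y * I3a g W y + I5 g W y

/-- The combination of `I_1 I_3`, `I_1 I_{3a}` and `I_5` adapted to tensors of conformal weight
`w`, that is `Ŵ = e^{wU} W` (all indices down). For `w = 2` it is `4 J_4`, and the three
coefficients never vanish simultaneously. -/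
def J4Weight (w : ℝ) (g : MetricComp) (W : TensorComp) (y : E4) : ℝ :=
  4 * (w - 4) * (w - 5) * (I1 g W y * I3 g W y) + 32 * (w - 4) * (I1 g W y * I3a g W y)
    + (w - 1) * (6 - w) * I5 g W y

/-- `M^a_{bc} = W_{bdef;c} W^{adef}`. -/
def auxM (g : MetricComp) (W : TensorComp) (y : E4) (a b c : Fin 4) : ℝ :=
  ∑ d, ∑ e, ∑ f, covDeriv g W y b d e f c * raise4 g W y a d e f

/-- `N^a_{bc} = W_{bdce;f} W^{fdae}`. -/
def auxN (g : MetricComp) (W : TensorComp) (y : E4) (a b c : Fin 4) : ℝ :=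
  ∑ d, ∑ e, ∑ f, covDeriv g W y b d c e f * raise4 g W y f d a e

/-- `A_a = -4 I_{1,a} - 16 M^e_{ae} + 16 M_a^e_e + 64 N^e_{ea}`. -/
def vecA (g : MetricComp) (W : TensorComp) (y : E4) (a : Fin 4) : ℝ :=
  -4 * pd a (I1 g W) y - 16 * ∑ e, auxM g W y e a e
    + 16 * ∑ p, ∑ q, ∑ e, g y a p * ginv g y e q * auxM g W y p q e
    + 64 * ∑ e, auxN g W y e e a

/-! ## Metrics and tensor fields on a four-dimensional manifold -/

section Manifold

variable {M : Type*} [TopologicalSpace M] [ChartedSpace E4 M]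

/-- A field of bilinear forms on the tangent spaces. -/
abbrev BilinField (M : Type*) [TopologicalSpace M] [ChartedSpace E4 M] : Type _ :=
  ∀ x : M, LinearMap.BilinForm ℝ (TangentSpace (𝓡 4) x)

/-- A field of covariant tensors of rank four. -/
abbrev TensorField (M : Type*) [TopologicalSpace M] [ChartedSpace E4 M] : Type _ :=
  ∀ x : M, MultilinearMap ℝ (fun _ : Fin 4 => TangentSpace (𝓡 4) x) ℝ

/-- The coordinate vector `∂_i` of the chart `e` at the point with coordinates `y`. -/
def coordVec (e : OpenPartialHomeomorph M E4) (y : E4) (i : Fin 4) :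
    TangentSpace (𝓡 4) (e.symm y) :=
  mfderiv (𝓡 4) (𝓡 4) e.symm y (EuclideanSpace.single i (1 : ℝ) : E4)

/-- The components `g_{ab}` in the chart `e`. -/
def metricComp (e : OpenPartialHomeomorph M E4) (g : BilinField M) : MetricComp := fun y =>
  Matrix.of fun a b => g (e.symm y) (coordVec e y a) (coordVec e y b)

/-- The components `T_{abcd}` in the chart `e`. -/
def tensorComp (e : OpenPartialHomeomorph M E4) (T : TensorField M) : TensorComp :=
  fun y a b c d => T (e.symm y) ![coordVec e y a, coordVec e y b, coordVec e y c, coordVec e y d]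

/-- A smooth pseudo-Riemannian metric, of any signature. -/
structure IsPseudoRiemannianMetric (g : BilinField M) : Prop where
  symm : ∀ (x : M) (u v : TangentSpace (𝓡 4) x), g x u v = g x v u
  nondegenerate : ∀ (x : M) (u : TangentSpace (𝓡 4) x), (∀ v, g x u v = 0) → u = 0
  smooth : ∀ e ∈ IsManifold.maximalAtlas (𝓡 4) ∞ M, ∀ a b : Fin 4,
    ContDiffOn ℝ ∞ (fun y => metricComp e g y a b) e.target

/-- A tensor field of rank four is smooth if its components in all charts are. -/
def IsSmoothTensor (T : TensorField M) : Prop :=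
  ∀ e ∈ IsManifold.maximalAtlas (𝓡 4) ∞ M, ∀ a b c d : Fin 4,
    ContDiffOn ℝ ∞ (fun y => tensorComp e T y a b c d) e.target

/-- A tensor field is Weyl-like for `g` if it has the index symmetries of the Weyl tensor and is
trace-free. -/
structure IsWeylLike (g : BilinField M) (W : TensorField M) : Prop where
  antisymm_left : ∀ (x : M) (u v s t : TangentSpace (𝓡 4) x),
    W x ![v, u, s, t] = -W x ![u, v, s, t]
  antisymm_right : ∀ (x : M) (u v s t : TangentSpace (𝓡 4) x),
    W x ![u, v, t, s] = -W x ![u, v, s, t]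
  pair_symm : ∀ (x : M) (u v s t : TangentSpace (𝓡 4) x),
    W x ![s, t, u, v] = W x ![u, v, s, t]
  bianchi : ∀ (x : M) (u v s t : TangentSpace (𝓡 4) x),
    W x ![u, v, s, t] + W x ![u, s, t, v] + W x ![u, t, v, s] = 0
  trace_free : ∀ (x : M) (b : Module.Basis (Fin 4) ℝ (TangentSpace (𝓡 4) x))
    (u v : TangentSpace (𝓡 4) x),
    ∑ i, ∑ j, (Matrix.of fun k l => g x (b k) (b l))⁻¹ i j * W x ![b i, u, b j, v] = 0

end Manifold

end ConfCov

end

/-! Under the conformal change, the covariant derivative of a tensor `W` of weight `w` becomes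
`e^{wU}(∇W + P)`, where `P` (`confTerm`) is linear in `W` and in `u = dU` (`covDeriv_conf`). Up to a
common exponential, each product in the invariant is therefore a polynomial of degree at most two in
`u`, and covariance means that its linear and quadratic parts cancel. This is proved once, for two
Weyl-like tensors `S`, `T` of the same weight (`pairInvariant_conf`): `S = C*`, `T = C`, `w = 2`
gives `K_4`, and `S = T = W` gives `J_4` and its weighted form.

The cancellation rests on a fact special to dimension four: `T_{abcd} T_e^{bcd}` is a quarter of
`|T|² g_{ae}` (`sq_identity`, polarised in `polar_identity`). Applied to a slice of `∇S` and to `T`,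
it writes the divergence pairing as half the gradient pairing minus the twisted pairing
(`divPair_eq`), so only the last two survive in the linear terms. The twisted pairing enters the
change of `∇S·∇T` with coefficient `-8` and that of the twisted contraction with `w - 5`
(`contraction_confTerm`, `contraction_confTerm_twist`). Hence it drops out of `w - 5` times the
first plus `8` times the second. With `I = S·T`, what remains is `(w-1)(w-6) u·∇I +
(w-1)(w-4)(w-6)|u|² I`. Multiplied by `4(w-4) I`, this is exactly what `(w-1)(6-w)|∇I|²`
compensates, because `I` has weight `2w - 8`.

The algebra is independent of signature: over the complex numbers every inverse metric has the form
`B Bᵀ` (`exists_orthonormal_frame`), so all contractions are computed with the unit matrix and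
transported back. The input for the algebra is that a tensor and its derivative are Weyl-like in
such frames (`WeylJet`). For `W` this holds because the metric is parallel. For the dual it holds
because Hodge duality preserves the symmetries and commutes with `∇` (`covDeriv_hodgeDual`). For
part (1) the Weyl tensor must also be shown to be Weyl-like and of weight two (`weylSymm_weyl`,
`weyl_conf`), starting from an expression of the curvature in second derivatives of the metric.

The vector of part (c), paired with an arbitrary vector, is a combination of the same pairings. It
vanishes by `divPair_eq` and one use of the cyclic identity (`pair_identity`). -/

noncomputable section

namespace ConfCov

/-! ### Weyl-like tensors for the unit metric and the four-dimensional identity. -/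

section

/-- The index symmetries of the Weyl tensor, with traces taken by the matrix `h`. -/
structure WeylSymm {K : Type*} [CommRing K] (h : Matrix (Fin 4) (Fin 4) K)
    (T : Fin 4 → Fin 4 → Fin 4 → Fin 4 → K) : Prop where
  antisymm_left : ∀ a b c d, T b a c d = -T a b c d
  antisymm_right : ∀ a b c d, T a b d c = -T a b c d
  pair_symm : ∀ a b c d, T c d a b = T a b c d
  bianchi : ∀ a b c d, T a b c d + T a c d b + T a d b c = 0
  trace_free : ∀ b d, ∑ a, ∑ c, h a c * T a b c d = 0

namespace WeylSymm

variable {T S : Fin 4 → Fin 4 → Fin 4 → Fin 4 → ℂ}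

lemma trace_one (hT : WeylSymm 1 T) (b d : Fin 4) : ∑ a, T a b a d = 0 := by
  simpa [Matrix.one_apply] using hT.trace_free b d

lemma add (hS : WeylSymm 1 S) (hT : WeylSymm 1 T) :
    WeylSymm 1 (fun a b c d => S a b c d + T a b c d) where
  antisymm_left a b c d := by rw [hS.antisymm_left, hT.antisymm_left]; ring
  antisymm_right a b c d := by rw [hS.antisymm_right, hT.antisymm_right]; ring
  pair_symm a b c d := by rw [hS.pair_symm, hT.pair_symm]
  bianchi a b c d := by linear_combination hS.bianchi a b c d + hT.bianchi a b c d
  trace_free b d := by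
    have h1 := hS.trace_free b d
    have h2 := hT.trace_free b d
    simp only [mul_add, Finset.sum_add_distrib, h1, h2, add_zero]

lemma diag_left (hT : WeylSymm 1 T) (a c d : Fin 4) : T a a c d = 0 :=
  self_eq_neg.mp (hT.antisymm_left a a c d)

lemma diag_right (hT : WeylSymm 1 T) (a b c : Fin 4) : T a b c c = 0 :=
  self_eq_neg.mp (hT.antisymm_right a b c c)

/-- The components of a Weyl-like tensor expressed by ten of them. -/
lemma component_relations (hT : WeylSymm 1 T) :
    T 0 3 0 3 = -T 0 1 0 1 - T 0 2 0 2 ∧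
    T 2 3 2 3 = T 0 1 0 1 ∧
    T 1 3 1 3 = T 0 2 0 2 ∧
    T 1 2 1 2 = -T 0 1 0 1 - T 0 2 0 2 ∧
    T 0 2 1 3 = T 0 1 2 3 + T 0 3 1 2 ∧
    T 0 3 1 3 = -T 0 2 1 2 ∧
    T 0 3 2 3 = T 0 1 1 2 ∧
    T 0 2 2 3 = -T 0 1 1 3 ∧
    T 1 3 2 3 = -T 0 1 0 2 ∧
    T 1 2 2 3 = T 0 1 0 3 ∧
    T 1 2 1 3 = -T 0 2 0 3 := by
  have dl := hT.diag_left
  have dr := hT.diag_right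
  have l10 := hT.antisymm_left 0 1
  have l20 := hT.antisymm_left 0 2
  have l30 := hT.antisymm_left 0 3
  have l21 := hT.antisymm_left 1 2
  have l31 := hT.antisymm_left 1 3
  have l32 := hT.antisymm_left 2 3
  have r10 := fun a b => hT.antisymm_right a b 0 1
  have r20 := fun a b => hT.antisymm_right a b 0 2
  have r30 := fun a b => hT.antisymm_right a b 0 3
  have r21 := fun a b => hT.antisymm_right a b 1 2
  have r31 := fun a b => hT.antisymm_right a b 1 3
  have r32 := fun a b => hT.antisymm_right a b 2 3
  have b0 := hT.bianchi 0 1 2 3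
  have t00 := hT.trace_one 0 0
  have t11 := hT.trace_one 1 1
  have t22 := hT.trace_one 2 2
  have t33 := hT.trace_one 3 3
  have t01 := hT.trace_one 0 1
  have t02 := hT.trace_one 0 2
  have t03 := hT.trace_one 0 3
  have t12 := hT.trace_one 1 2
  have t13 := hT.trace_one 1 3
  have t23 := hT.trace_one 2 3
  simp only [Fin.sum_univ_four, dl, dr, l10, l20, l30, l21, l31, l32, r10, r20, r30, r21, r31,
    r32, neg_neg, zero_add,
    add_zero] at b0 t00 t11 t22 t33 t01 t02 t03 t12 t13 t23
  refine ⟨?_, ?_, ?_, ?_, ?_, ?_, ?_, ?_, ?_, ?_, ?_⟩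
  · linear_combination t00
  -- Each diagonal trace adds the components of the three coordinate planes through one axis. These
  -- combinations isolate two complementary planes, whose components must agree: this is where
  -- dimension four enters.
  · linear_combination (t22 + t33 - t00 - t11) / 2
  · linear_combination (t11 + t33 - t00 - t22) / 2
  · linear_combination (t11 + t22 - t33 + t00) / 2
  · linear_combination -b0
  · linear_combination t01
  · linear_combination t02
  · linear_combination -t03
  · linear_combination t12
  · linear_combination -t13
  · linear_combination t23

/-- In dimension four `T_{abcd} T_{ebcd} = (1/4) δ_{ae} T_{pqrs} T_{pqrs}`. -/
lemma sq_identity (hT : WeylSymm 1 T) (a e : Fin 4) :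
    4 * ∑ b, ∑ c, ∑ d, T a b c d * T e b c d =
      if a = e then ∑ p, ∑ q, ∑ r, ∑ s, T p q r s * T p q r s else 0 := by
  have dl := hT.diag_left
  have dr := hT.diag_right
  have l10 := hT.antisymm_left 0 1
  have l20 := hT.antisymm_left 0 2
  have l30 := hT.antisymm_left 0 3
  have l21 := hT.antisymm_left 1 2
  have l31 := hT.antisymm_left 1 3
  have l32 := hT.antisymm_left 2 3
  have r10 := fun a b => hT.antisymm_right a b 0 1
  have r20 := fun a b => hT.antisymm_right a b 0 2
  have r30 := fun a b => hT.antisymm_right a b 0 3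
  have r21 := fun a b => hT.antisymm_right a b 1 2
  have r31 := fun a b => hT.antisymm_right a b 1 3
  have r32 := fun a b => hT.antisymm_right a b 2 3
  have p1 := hT.pair_symm 0 1 0 2
  have p2 := hT.pair_symm 0 1 0 3
  have p3 := hT.pair_symm 0 1 1 2
  have p4 := hT.pair_symm 0 1 1 3
  have p5 := hT.pair_symm 0 1 2 3
  have p6 := hT.pair_symm 0 2 0 3
  have p7 := hT.pair_symm 0 2 1 2
  have p8 := hT.pair_symm 0 2 1 3
  have p9 := hT.pair_symm 0 2 2 3
  have p10 := hT.pair_symm 0 3 1 2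
  have p11 := hT.pair_symm 0 3 1 3
  have p12 := hT.pair_symm 0 3 2 3
  have p13 := hT.pair_symm 1 2 1 3
  have p14 := hT.pair_symm 1 2 2 3
  have p15 := hT.pair_symm 1 3 2 3
  -- Once everything is written in ten independent components, each of the sixteen cases is an
  -- identity between quadratic polynomials.
  obtain ⟨e1, e2, e3, e4, e5, e6, e7, e8, e9, e10, e11⟩ := hT.component_relations
  fin_cases a <;> fin_cases e <;>
  simp only [Fin.zero_eta, Fin.mk_one, Fin.reduceFinMk, Fin.isValue, Fin.reduceEq, if_true,
    if_false, Fin.sum_univ_four, dl, dr, l10, l20, l30, l21, l31, l32, r10, r20, r30, r21,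
    r31, r32, p1, p2, p3, p4, p5, p6, p7, p8, p9, p10, p11, p12, p13, p14, p15,
    e1, e2, e3, e4, e5, e6, e7, e8, e9, e10, e11] <;> ring

end WeylSymm

end

/-! ### Polarisation, and the untwisted contraction with the conformal change. -/

section

namespace WeylSymm

variable {T S : Fin 4 → Fin 4 → Fin 4 → Fin 4 → ℂ}

/-- The polarisation of `sq_identity`. -/
lemma polar_identity (hS : WeylSymm 1 S) (hT : WeylSymm 1 T) (a e : Fin 4) :
    2 * ∑ b, ∑ c, ∑ d, (S a b c d * T e b c d + T a b c d * S e b c d) =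
      if a = e then ∑ p, ∑ q, ∑ r, ∑ s, S p q r s * T p q r s else 0 := by
  have h := (hS.add hT).sq_identity a e
  have h1 := hS.sq_identity a e
  have h2 := hT.sq_identity a e
  simp only [mul_add, add_mul, Finset.sum_add_distrib] at h ⊢
  have hc : ∑ p, ∑ q, ∑ r, ∑ s, T p q r s * S p q r s
      = ∑ p, ∑ q, ∑ r, ∑ s, S p q r s * T p q r s := by simp only [mul_comm]
  rw [hc] at h
  split_ifs at h h1 h2 ⊢ <;> linear_combination (h - h1 - h2) / 2

end WeylSymm

section Contractions

/-- `∑ u_e F_{abcde} T_{abcd}` -/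
def gradPair (u : Fin 4 → ℂ) (F : Fin 4 → Fin 4 → Fin 4 → Fin 4 → Fin 4 → ℂ)
    (T : Fin 4 → Fin 4 → Fin 4 → Fin 4 → ℂ) : ℂ :=
  ∑ a, ∑ b, ∑ c, ∑ d, ∑ e, F a b c d e * (u e * T a b c d)

/-- `∑ u_a F_{abcde} T_{ebcd}` -/
def twistPair (u : Fin 4 → ℂ) (F : Fin 4 → Fin 4 → Fin 4 → Fin 4 → Fin 4 → ℂ)
    (T : Fin 4 → Fin 4 → Fin 4 → Fin 4 → ℂ) : ℂ :=
  ∑ a, ∑ b, ∑ c, ∑ d, ∑ e, F a b c d e * (u a * T e b c d)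

/-- `∑ u_f F_{abcda} T_{fbcd}` -/
def divPair (u : Fin 4 → ℂ) (F : Fin 4 → Fin 4 → Fin 4 → Fin 4 → Fin 4 → ℂ)
    (T : Fin 4 → Fin 4 → Fin 4 → Fin 4 → ℂ) : ℂ :=
  ∑ a, ∑ b, ∑ c, ∑ d, F a b c d a * ∑ f, u f * T f b c d

/-- The terms by which the covariant derivative of a tensor of conformal weight `w` changes under
a conformal change of the metric `G`, where `u` is the gradient of the conformal factor and `v` is
the same vector with its index raised. -/
def confTerm {K : Type*} [CommRing K] (w : K) (G : Matrix (Fin 4) (Fin 4) K) (u v : Fin 4 → K)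
    (T : Fin 4 → Fin 4 → Fin 4 → Fin 4 → K) (a b c d e : Fin 4) : K :=
  (w - 4) * (u e * T a b c d)
    - u a * T e b c d - u b * T a e c d - u c * T a b e d - u d * T a b c e
    + G e a * ∑ f, v f * T f b c d + G e b * ∑ f, v f * T a f c d
    + G e c * ∑ f, v f * T a b f d + G e d * ∑ f, v f * T a b c f

/-- The part of `confTerm` that belongs to the first index. -/
def confSlot (u : Fin 4 → ℂ) (T : Fin 4 → Fin 4 → Fin 4 → Fin 4 → ℂ)
    (a b c d e : Fin 4) : ℂ :=
  -(u a * T e b c d) + (1 : Matrix (Fin 4) (Fin 4) ℂ) e a * ∑ f, u f * T f b c d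

variable {T S : Fin 4 → Fin 4 → Fin 4 → Fin 4 → ℂ}
  {F : Fin 4 → Fin 4 → Fin 4 → Fin 4 → Fin 4 → ℂ}

/-- Antisymmetry and pair symmetry move any index of `T` to the front, so the four index terms are
one expression with permuted arguments and a sign. Only `confSlot` then has to be contracted. -/
lemma confTerm_eq_slots (hT : WeylSymm 1 T) (w : ℂ) (u : Fin 4 → ℂ) (a b c d e : Fin 4) :
    confTerm w 1 u u T a b c d e = (w - 4) * (u e * T a b c d) + confSlot u T a b c d e
      - confSlot u T b a c d e + confSlot u T c d a b e - confSlot u T d c a b e := by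
  have h1 : ∀ f, T a f c d = -T f a c d := fun f => hT.antisymm_left _ _ _ _
  have h2 : ∀ f, T a b f d = T f d a b := fun f => hT.pair_symm _ _ _ _
  have h3 : ∀ f, T a b c f = -T f c a b := fun f => by
    rw [hT.antisymm_right, hT.pair_symm]
  simp only [confTerm, confSlot, h1, h2, h3, mul_neg, Finset.sum_neg_distrib]
  ring

/-- Sums over five indices may be reordered. -/
lemma sum_swap_ab {M : Type*} [AddCommMonoid M]
    (f : Fin 4 → Fin 4 → Fin 4 → Fin 4 → Fin 4 → M) :
    ∑ a, ∑ b, ∑ c, ∑ d, ∑ e, f a b c d e = ∑ a, ∑ b, ∑ c, ∑ d, ∑ e, f b a c d e :=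
  Finset.sum_comm

lemma sum_swap_cd {M : Type*} [AddCommMonoid M]
    (f : Fin 4 → Fin 4 → Fin 4 → Fin 4 → Fin 4 → M) :
    ∑ a, ∑ b, ∑ c, ∑ d, ∑ e, f a b c d e = ∑ a, ∑ b, ∑ c, ∑ d, ∑ e, f a b d c e :=
  Finset.sum_congr rfl fun _ _ => Finset.sum_congr rfl fun _ _ => Finset.sum_comm

lemma sum_swap_bc {M : Type*} [AddCommMonoid M]
    (f : Fin 4 → Fin 4 → Fin 4 → Fin 4 → Fin 4 → M) :
    ∑ a, ∑ b, ∑ c, ∑ d, ∑ e, f a b c d e = ∑ a, ∑ b, ∑ c, ∑ d, ∑ e, f a c b d e :=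
  Finset.sum_congr rfl fun _ _ => Finset.sum_comm

lemma sum_swap_de {M : Type*} [AddCommMonoid M]
    (f : Fin 4 → Fin 4 → Fin 4 → Fin 4 → Fin 4 → M) :
    ∑ a, ∑ b, ∑ c, ∑ d, ∑ e, f a b c d e = ∑ a, ∑ b, ∑ c, ∑ d, ∑ e, f a b c e d :=
  Finset.sum_congr rfl fun _ _ => Finset.sum_congr rfl fun _ _ =>
    Finset.sum_congr rfl fun _ _ => Finset.sum_comm

lemma sum_swap_pairs {M : Type*} [AddCommMonoid M]
    (f : Fin 4 → Fin 4 → Fin 4 → Fin 4 → Fin 4 → M) :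
    ∑ a, ∑ b, ∑ c, ∑ d, ∑ e, f a b c d e = ∑ a, ∑ b, ∑ c, ∑ d, ∑ e, f c d a b e := by
  rw [sum_swap_bc, sum_swap_ab, sum_swap_cd, sum_swap_bc]

lemma sum_swap_ae {M : Type*} [AddCommMonoid M]
    (f : Fin 4 → Fin 4 → Fin 4 → Fin 4 → Fin 4 → M) :
    ∑ a, ∑ b, ∑ c, ∑ d, ∑ e, f a b c d e = ∑ a, ∑ b, ∑ c, ∑ d, ∑ e, f e b c d a := by
  rw [sum_swap_ab, sum_swap_bc, sum_swap_cd, sum_swap_de, sum_swap_cd, sum_swap_bc, sum_swap_ab]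

lemma sum_swap_be {M : Type*} [AddCommMonoid M]
    (f : Fin 4 → Fin 4 → Fin 4 → Fin 4 → Fin 4 → M) :
    ∑ a, ∑ b, ∑ c, ∑ d, ∑ e, f a b c d e = ∑ a, ∑ b, ∑ c, ∑ d, ∑ e, f a e c d b := by
  rw [sum_swap_bc, sum_swap_cd, sum_swap_de, sum_swap_cd, sum_swap_bc]

lemma sum_congr_five {M : Type*} [AddCommMonoid M]
    {f g : Fin 4 → Fin 4 → Fin 4 → Fin 4 → Fin 4 → M}
    (h : ∀ a b c d e, f a b c d e = g a b c d e) :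
    ∑ a, ∑ b, ∑ c, ∑ d, ∑ e, f a b c d e = ∑ a, ∑ b, ∑ c, ∑ d, ∑ e, g a b c d e := by
  simp only [h]

lemma sum_neg_five {f : Fin 4 → Fin 4 → Fin 4 → Fin 4 → Fin 4 → ℂ} :
    -∑ a, ∑ b, ∑ c, ∑ d, ∑ e, f a b c d e = ∑ a, ∑ b, ∑ c, ∑ d, ∑ e, -f a b c d e := by
  simp only [Finset.sum_neg_distrib]

lemma sum_mul_confSlot (u : Fin 4 → ℂ) (F) :
    ∑ a, ∑ b, ∑ c, ∑ d, ∑ e, F a b c d e * confSlot u T a b c d e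
      = divPair u F T - twistPair u F T := by
  simp only [confSlot, mul_add, Finset.sum_add_distrib, mul_neg, Finset.sum_neg_distrib,
    divPair, twistPair, Matrix.one_apply, ite_mul, one_mul, zero_mul, mul_ite, mul_zero,
    Finset.sum_ite_eq', Finset.mem_univ, if_true]
  ring

/-- The four-dimensional identity turns a divergence into a gradient. -/
lemma divPair_eq (hF : ∀ e, WeylSymm 1 (fun a b c d => F a b c d e)) (hT : WeylSymm 1 T)
    (u : Fin 4 → ℂ) : divPair u F T = gradPair u F T / 2 - twistPair u F T := by
  -- The polarised identity is used for the slice `F_{····e}` with free indices `a` and `e`, and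
  -- then `e` is summed. The Kronecker delta yields the gradient pairing; the two products on the
  -- other side yield the twisted and the divergence pairing.
  have h : ∑ a, ∑ e, u a * (2 * ∑ b, ∑ c, ∑ d,
      (F a b c d e * T e b c d + T a b c d * F e b c d e)) = gradPair u F T := by
    have h1 : ∀ a e, u a * (2 * ∑ b, ∑ c, ∑ d,
        (F a b c d e * T e b c d + T a b c d * F e b c d e)) =
        if a = e then u a * ∑ p, ∑ q, ∑ r, ∑ s, F p q r s e * T p q r s else 0 := by
      intro a e
      rw [(hF e).polar_identity hT a e]
      split_ifs <;> simp
    simp only [h1, Finset.sum_ite_eq, Finset.mem_univ, if_true]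
    simp only [gradPair, Finset.mul_sum]
    rw [sum_swap_ab, sum_swap_bc, sum_swap_cd, sum_swap_de]
    simp only [mul_left_comm]
  have h2 : ∑ a, ∑ e, u a * (2 * ∑ b, ∑ c, ∑ d,
      (F a b c d e * T e b c d + T a b c d * F e b c d e)) =
      2 * (twistPair u F T + divPair u F T) := by
    have e1 : twistPair u F T =
        ∑ a, ∑ e, ∑ b, ∑ c, ∑ d, F a b c d e * (u a * T e b c d) := by
      rw [twistPair, sum_swap_de, sum_swap_cd, sum_swap_bc]
    have e2 : divPair u F T =
        ∑ a, ∑ e, ∑ b, ∑ c, ∑ d, F e b c d e * (u a * T a b c d) := by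
      simp only [divPair, Finset.mul_sum]
      rw [sum_swap_de, sum_swap_cd, sum_swap_bc, sum_swap_ab]
    rw [e1, e2, ← Finset.sum_add_distrib, Finset.mul_sum]
    refine Finset.sum_congr rfl fun a _ => ?_
    rw [← Finset.sum_add_distrib, Finset.mul_sum]
    refine Finset.sum_congr rfl fun e _ => ?_
    simp only [← Finset.sum_add_distrib, Finset.mul_sum]
    refine Finset.sum_congr rfl fun b _ => Finset.sum_congr rfl fun c _ =>
      Finset.sum_congr rfl fun d _ => ?_
    ring
  linear_combination (h2 - h) / (-2)

/-- By the symmetries of `F` all four slots contribute the same amount, divergence minus twist.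
Eliminating the divergence adds `4 · 1/2` to `w - 4` and leaves `-4 · 2` twisted pairings. -/
lemma sum_mul_confTerm (hF : ∀ e, WeylSymm 1 (fun a b c d => F a b c d e))
    (hT : WeylSymm 1 T) (w : ℂ) (u : Fin 4 → ℂ) :
    ∑ a, ∑ b, ∑ c, ∑ d, ∑ e, F a b c d e * confTerm w 1 u u T a b c d e
      = (w - 2) * gradPair u F T - 8 * twistPair u F T := by
  have e0 := sum_mul_confSlot (T := T) u F
  have e1 : ∑ a, ∑ b, ∑ c, ∑ d, ∑ e, F a b c d e * confSlot u T b a c d e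
      = -(divPair u F T - twistPair u F T) := by
    rw [sum_swap_ab, ← e0, sum_neg_five]
    exact sum_congr_five fun a b c d e => by rw [(hF e).antisymm_left]; ring
  have e2 : ∑ a, ∑ b, ∑ c, ∑ d, ∑ e, F a b c d e * confSlot u T c d a b e
      = divPair u F T - twistPair u F T := by
    rw [sum_swap_pairs, ← e0]
    exact sum_congr_five fun a b c d e => by rw [(hF e).pair_symm]
  have e3 : ∑ a, ∑ b, ∑ c, ∑ d, ∑ e, F a b c d e * confSlot u T d c a b e
      = -(divPair u F T - twistPair u F T) := by
    rw [sum_swap_cd, ← e2, sum_neg_five]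
    exact sum_congr_five fun a b c d e => by rw [(hF e).antisymm_right]; ring
  have e4 : ∑ a, ∑ b, ∑ c, ∑ d, ∑ e, F a b c d e * ((w - 4) * (u e * T a b c d))
      = (w - 4) * gradPair u F T := by
    simp only [gradPair, Finset.mul_sum, mul_left_comm]
  simp only [confTerm_eq_slots hT, mul_add, mul_sub (F _ _ _ _ _), Finset.sum_add_distrib,
    Finset.sum_sub_distrib, e0, e1, e2, e3, e4]
  rw [divPair_eq hF hT]
  ring

end Contractions

end

/-! ### The twisted contraction and the terms quadratic in the gradient. -/

section

section Contractions

variable {T S : Fin 4 → Fin 4 → Fin 4 → Fin 4 → ℂ}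
  {F F' : Fin 4 → Fin 4 → Fin 4 → Fin 4 → Fin 4 → ℂ}

lemma mul_one_apply_mul (e f : Fin 4) (x y : ℂ) :
    x * ((1 : Matrix (Fin 4) (Fin 4) ℂ) e f * y) = if e = f then x * y else 0 := by
  rw [Matrix.one_apply]; split_ifs <;> simp

lemma sum_ite_diag_eq_zero (hF : ∀ e, WeylSymm 1 (fun a b c d => F a b c d e))
    (X : Fin 4 → Fin 4 → Fin 4 → Fin 4 → ℂ) :
    ∑ a, ∑ b, ∑ c, ∑ d, ∑ e, (if a = b then F a b c d e * X b c d e else 0) = 0 := by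
  refine Finset.sum_eq_zero fun a _ => Finset.sum_eq_zero fun b _ =>
    Finset.sum_eq_zero fun c _ => Finset.sum_eq_zero fun d _ =>
    Finset.sum_eq_zero fun e _ => ?_
  split_ifs with h
  · subst h; rw [(hF e).diag_left, zero_mul]
  · rfl

lemma sum_ite_trace_eq_zero (hF : ∀ e, WeylSymm 1 (fun a b c d => F a b c d e))
    (X : Fin 4 → Fin 4 → Fin 4 → ℂ) :
    ∑ a, ∑ b, ∑ c, ∑ d, ∑ e, (if a = c then F a b c d e * X b d e else 0) = 0 := by
  rw [sum_swap_ab, sum_swap_cd, sum_swap_bc, sum_swap_de, sum_swap_cd]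
  refine Finset.sum_eq_zero fun b _ => Finset.sum_eq_zero fun d _ =>
    Finset.sum_eq_zero fun e _ => ?_
  simp only [Finset.sum_ite_eq, Finset.mem_univ, if_true, ← Finset.sum_mul]
  rw [(hF e).trace_one, zero_mul]

/-- With first and last index exchanged the slots are no longer equivalent. The first gives
divergence minus gradient. In the others the metric term meets a diagonal or a trace of `F` and
disappears; the remaining product is a twisted pairing for the second slot and, by the cyclic
identity, half of one in absolute value for the third and fourth. -/
lemma sum_mul_confTerm_twist (hF : ∀ e, WeylSymm 1 (fun a b c d => F a b c d e))
    (hT : WeylSymm 1 T) (w : ℂ) (u : Fin 4 → ℂ) :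
    ∑ a, ∑ b, ∑ c, ∑ d, ∑ e, F a b c d e * confTerm w 1 u u T e b c d a
      = (w - 5) * twistPair u F T - gradPair u F T / 2 := by
  have e0 : ∑ a, ∑ b, ∑ c, ∑ d, ∑ e, F a b c d e * ((w - 4) * (u a * T e b c d))
      = (w - 4) * twistPair u F T := by
    simp only [twistPair, Finset.mul_sum, mul_left_comm]
  have e1 : ∑ a, ∑ b, ∑ c, ∑ d, ∑ e, F a b c d e * confSlot u T e b c d a
      = divPair u F T - gradPair u F T := by
    simp only [confSlot, mul_add, Finset.sum_add_distrib, mul_neg, Finset.sum_neg_distrib,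
      mul_one_apply_mul, divPair, gradPair, Finset.sum_ite_eq, Finset.mem_univ, if_true]
    ring
  have e2 : ∑ a, ∑ b, ∑ c, ∑ d, ∑ e, F a b c d e * confSlot u T b e c d a
      = -twistPair u F T := by
    simp only [confSlot, mul_add, Finset.sum_add_distrib, mul_neg, mul_one_apply_mul]
    rw [sum_ite_diag_eq_zero hF (fun _ c d e => ∑ f, u f * T f e c d), add_zero,
      sum_swap_ab, twistPair, sum_neg_five]
    exact sum_congr_five fun a b c d e => by
      rw [(hF e).antisymm_left, hT.antisymm_left]; ring
  have e3 : ∑ a, ∑ b, ∑ c, ∑ d, ∑ e, F a b c d e * confSlot u T c d e b a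
      = -(twistPair u F T / 2) := by
    simp only [confSlot, mul_add, Finset.sum_add_distrib, mul_neg, mul_one_apply_mul]
    rw [sum_ite_trace_eq_zero hF (fun b d e => ∑ f, u f * T f d e b), add_zero]
    simp only [Finset.sum_neg_distrib]
    have z1 : ∑ a, ∑ b, ∑ c, ∑ d, ∑ e, F a b c d e * (u c * T a d e b)
        = ∑ a, ∑ b, ∑ c, ∑ d, ∑ e, F a b c d e * (u a * T c b e d) := by
      rw [sum_swap_pairs]
      exact sum_congr_five fun a b c d e => by rw [(hF e).pair_symm]
    have z2 : ∑ a, ∑ b, ∑ c, ∑ d, ∑ e, F a b c d e * (u c * T a d e b)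
        = -∑ a, ∑ b, ∑ c, ∑ d, ∑ e, F a b c d e * (u a * T d b e c) := by
      rw [z1, sum_swap_cd, sum_neg_five]
      exact sum_congr_five fun a b c d e => by rw [(hF e).antisymm_right]; ring
    have z3 : twistPair u F T = ∑ a, ∑ b, ∑ c, ∑ d, ∑ e, F a b c d e * (u a * T c b e d)
        - ∑ a, ∑ b, ∑ c, ∑ d, ∑ e, F a b c d e * (u a * T d b e c) := by
      simp only [← Finset.sum_sub_distrib]
      exact sum_congr_five fun a b c d e => by
        rw [← hT.pair_symm c b e d, ← hT.pair_symm d b e c, hT.antisymm_right e d b c]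
        linear_combination (F a b c d e * u a) * hT.bianchi e b c d
    linear_combination (z3 - z2 - z1) / 2
  have e4 : ∑ a, ∑ b, ∑ c, ∑ d, ∑ e, F a b c d e * confSlot u T d c e b a
      = twistPair u F T / 2 := by
    rw [sum_swap_cd, ← neg_neg (twistPair u F T / 2), ← e3, sum_neg_five]
    exact sum_congr_five fun a b c d e => by rw [(hF e).antisymm_right]; ring
  simp only [confTerm_eq_slots hT, mul_add, mul_sub (F _ _ _ _ _), Finset.sum_add_distrib,
    Finset.sum_sub_distrib, e0, e1, e2, e3, e4]
  rw [divPair_eq hF hT]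
  ring

/-- This allows the change of `S` itself to play the role of `F` in the contraction lemmas, which is
how the terms quadratic in `u` are obtained. -/
lemma WeylSymm.confTerm (hT : WeylSymm 1 T) (w : ℂ) (u : Fin 4 → ℂ) (e : Fin 4) :
    WeylSymm 1 (fun a b c d => confTerm w 1 u u T a b c d e) where
  antisymm_left a b c d := by
    rw [confTerm_eq_slots hT, confTerm_eq_slots hT, hT.antisymm_left a b]
    simp only [confSlot, hT.antisymm_right _ _ a b]
    simp only [mul_neg, Finset.sum_neg_distrib]; ring
  antisymm_right a b c d := by
    rw [confTerm_eq_slots hT, confTerm_eq_slots hT, hT.antisymm_right a b]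
    simp only [confSlot, hT.antisymm_right _ _ c d]
    simp only [mul_neg, Finset.sum_neg_distrib]; ring
  pair_symm a b c d := by
    rw [confTerm_eq_slots hT, confTerm_eq_slots hT, hT.pair_symm a b]
    ring
  bianchi a b c d := by
    have key : ∀ v : Fin 4 → ℂ, ∀ b c d, ∑ f, v f * T f b c d + ∑ f, v f * T f c d b
        + ∑ f, v f * T f d b c = 0 := fun v b c d => by
      simp only [← Finset.sum_add_distrib, ← mul_add]
      simp only [add_assoc, fun f => by simpa [add_assoc] using hT.bianchi f b c d, mul_zero,
        Finset.sum_const_zero]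
    have t : ∀ e a b c d, confSlot u T a b c d e + confSlot u T a c d b e
        + confSlot u T a d b c e = 0 := fun e a b c d => by
      simp only [confSlot]
      linear_combination (-u a) * hT.bianchi e b c d
        + (1 : Matrix (Fin 4) (Fin 4) ℂ) e a * key u b c d
    have n : ∀ e a b c d, confSlot u T a b d c e = -confSlot u T a b c d e :=
      fun e a b c d => by
        simp only [confSlot, hT.antisymm_right _ _ c d]
        simp only [mul_neg, Finset.sum_neg_distrib]; ring
    rw [confTerm_eq_slots hT, confTerm_eq_slots hT, confTerm_eq_slots hT]
    -- Sorted by their first argument, the twelve slot terms form four cyclic sums, each zero by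
    -- `t`; `n` corrects the sign where the last two arguments come reversed.
    linear_combination ((w - 4) * u e) * hT.bianchi a b c d + t e a b c d
      - t e b a c d + t e c d a b - t e d c a b
      + n e b c d a - n e c a d b - n e c b a d + n e d b a c
  trace_free b d := by
    have tr := hT.trace_one
    have t1 : ∀ d, ∑ a, ∑ f, u f * T a f a d = 0 := fun d => by
      rw [Finset.sum_comm]; simp only [← Finset.mul_sum, tr, mul_zero, Finset.sum_const_zero]
    have t2 : ∀ b, ∑ a, ∑ f, u f * T a b a f = 0 := fun b => by
      rw [Finset.sum_comm]; simp only [← Finset.mul_sum, tr, mul_zero, Finset.sum_const_zero]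
    have o : ∀ X : Fin 4 → ℂ, ∑ a, (1 : Matrix (Fin 4) (Fin 4) ℂ) e a * X a = X e :=
      fun X => by simp [Matrix.one_apply]
    have o' : ∀ X : Fin 4 → Fin 4 → ℂ, ∑ a, ∑ c, (1 : Matrix (Fin 4) (Fin 4) ℂ) a c * X a c
        = ∑ a, X a a := fun X => by simp [Matrix.one_apply]
    rw [o']
    simp only [ConfCov.confTerm, Finset.sum_add_distrib, Finset.sum_sub_distrib, o,
      ← Finset.mul_sum, tr, t1, t2]
    ring

lemma WeylSymm.smul (hT : WeylSymm 1 T) (k : ℂ) :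
    WeylSymm 1 (fun a b c d => k * T a b c d) where
  antisymm_left a b c d := by rw [hT.antisymm_left]; ring
  antisymm_right a b c d := by rw [hT.antisymm_right]; ring
  pair_symm a b c d := by rw [hT.pair_symm]
  bianchi a b c d := by linear_combination k * hT.bianchi a b c d
  trace_free b d := by
    simp only [mul_left_comm _ k, ← Finset.mul_sum, hT.trace_free, mul_zero]

lemma gradPair_smul (S T : Fin 4 → Fin 4 → Fin 4 → Fin 4 → ℂ) (u : Fin 4 → ℂ) :
    gradPair u (fun a b c d e => u e * S a b c d) T
      = (∑ a, u a * u a) * ∑ a, ∑ b, ∑ c, ∑ d, S a b c d * T a b c d := by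
  simp only [gradPair, Finset.sum_mul, Finset.mul_sum]
  exact sum_congr_five fun a b c d e => by ring

/-- For `F = u ⊗ S` the twisted and the divergence pairing are the same sum, so `divPair_eq`
determines it as a quarter of the gradient pairing. -/
lemma twistPair_smul (hS : WeylSymm 1 S) (hT : WeylSymm 1 T) (u : Fin 4 → ℂ) :
    twistPair u (fun a b c d e => u e * S a b c d) T
      = (∑ a, u a * u a) * (∑ a, ∑ b, ∑ c, ∑ d, S a b c d * T a b c d) / 4 := by
  have h := divPair_eq (F := fun a b c d e => u e * S a b c d) (fun e => hS.smul (u e)) hT u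
  have h1 : divPair u (fun a b c d e => u e * S a b c d) T
      = twistPair u (fun a b c d e => u e * S a b c d) T := by
    simp only [divPair, twistPair, Finset.mul_sum]
    exact sum_congr_five fun a b c d e => by ring
  rw [h1, gradPair_smul] at h
  linear_combination h / 2

/-- The contraction `u_a P_{abcde} T_{ebcd}` for the change `P` of the covariant derivative
of `S`. -/
lemma twistPair_confTerm (hS : WeylSymm 1 S) (hT : WeylSymm 1 T) (w : ℂ) (u : Fin 4 → ℂ) :
    twistPair u (confTerm w 1 u u S) T
      = (w - 7) / 4 * ((∑ a, u a * u a) * ∑ a, ∑ b, ∑ c, ∑ d, S a b c d * T a b c d) := by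
  set N := ∑ a, u a * u a
  set I := ∑ a, ∑ b, ∑ c, ∑ d, S a b c d * T a b c d
  set V : Fin 4 → Fin 4 → Fin 4 → ℂ := fun b c d => ∑ f, u f * S f b c d with hV
  set V' : Fin 4 → Fin 4 → Fin 4 → ℂ := fun b c d => ∑ f, u f * T f b c d with hV'
  set Ψ := ∑ b, ∑ c, ∑ d, V b c d * V' b c d with hΨ
  have prod : ∑ a, ∑ b, ∑ c, ∑ d, ∑ e, u a * S a b c d * (u e * T e b c d) = Ψ := by
    simp only [hΨ, hV, hV', Finset.sum_mul_sum]
    rw [sum_swap_ab, sum_swap_bc, sum_swap_cd]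
  have e0 : ∑ a, ∑ b, ∑ c, ∑ d, ∑ e, (w - 4) * (u e * S a b c d) * (u a * T e b c d)
      = (w - 4) * Ψ := by
    simp only [← prod, Finset.mul_sum]
    exact sum_congr_five fun a b c d e => by ring
  have sq : ∑ a, ∑ b, ∑ c, ∑ d, ∑ e, u a * S e b c d * (u a * T e b c d) = N * I := by
    rw [sum_swap_ae]
    simp only [N, I, Finset.sum_mul, Finset.mul_sum]
    exact sum_congr_five fun a b c d e => by ring
  have psi : Ψ = N * I / 4 := by
    rw [← twistPair_smul hS hT, twistPair, ← prod]
    exact sum_congr_five fun a b c d e => by ring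
  have anti : ∀ b c d, V b d c = -V b c d := fun b c d => by
    simp only [hV, hS.antisymm_right _ _ c d]
    simp only [mul_neg, Finset.sum_neg_distrib]
  have anti' : ∀ b c d, V' b d c = -V' b c d := fun b c d => by
    simp only [hV', hT.antisymm_right _ _ c d]
    simp only [mul_neg, Finset.sum_neg_distrib]
  have bian : ∀ b c d, V' b c d + V' c d b + V' d b c = 0 := fun b c d => by
    simp only [hV', ← Finset.sum_add_distrib, ← mul_add]
    simp only [hT.bianchi, mul_zero, Finset.sum_const_zero]
  -- Antisymmetry of `V` makes the two crossed contractions opposite, and the cyclic identity for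
  -- `V'` relates their difference to `Ψ`; each is therefore `Ψ / 2` up to sign.
  have cyc : ∑ b, ∑ e, ∑ d, V b e d * V' d e b = Ψ / 2 := by
    have c1 : ∑ b, ∑ e, ∑ d, V b e d * V' e d b = -∑ b, ∑ e, ∑ d, V b e d * V' d e b := by
      simp only [← Finset.sum_neg_distrib]
      refine Finset.sum_congr rfl fun b _ => ?_
      rw [Finset.sum_comm]
      refine Finset.sum_congr rfl fun e _ => Finset.sum_congr rfl fun d _ => ?_
      rw [anti]; ring
    have c2 : Ψ + ∑ b, ∑ e, ∑ d, V b e d * V' e d b - ∑ b, ∑ e, ∑ d, V b e d * V' d e b = 0 := by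
      simp only [hΨ, ← Finset.sum_add_distrib, ← Finset.sum_sub_distrib]
      refine Finset.sum_eq_zero fun b _ => Finset.sum_eq_zero fun e _ =>
        Finset.sum_eq_zero fun d _ => ?_
      rw [anti' d b e]
      linear_combination V b e d * bian b e d
    linear_combination (c2 - c1) / (-2)
  have delta : ∀ (e f : Fin 4) (x y : ℂ), (1 : Matrix (Fin 4) (Fin 4) ℂ) e f * x * y
      = if e = f then x * y else 0 := fun e f x y => by
    rw [Matrix.one_apply]; split_ifs <;> simp
  have e1 : ∑ a, ∑ b, ∑ c, ∑ d, ∑ e, confSlot u S a b c d e * (u a * T e b c d)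
      = Ψ - N * I := by
    simp only [confSlot, add_mul, Finset.sum_add_distrib, neg_mul, delta,
      Finset.sum_ite_eq', Finset.mem_univ, if_true]
    simp only [Finset.sum_neg_distrib]
    rw [sq, ← prod, sum_swap_ae]
    simp only [Finset.sum_mul]
    rw [sum_swap_ae]
    ring
  have e2 : ∑ a, ∑ b, ∑ c, ∑ d, ∑ e, confSlot u S b a c d e * (u a * T e b c d)
      = -Ψ := by
    simp only [confSlot, add_mul, Finset.sum_add_distrib, delta, hT.diag_left, mul_zero,
      ite_self, Finset.sum_ite_eq', Finset.mem_univ, add_zero]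
    rw [← prod, sum_swap_be (fun a b c d e => u a * S a b c d * (u e * T e b c d)), sum_neg_five]
    exact sum_congr_five fun a b c d e => by
      rw [hS.antisymm_left a e, hT.antisymm_left b e]; ring
  have e3 : ∑ a, ∑ b, ∑ c, ∑ d, ∑ e, confSlot u S c d a b e * (u a * T e b c d)
      = -(Ψ / 2) := by
    have z : ∀ d a b, ∑ c, u a * T c b c d = 0 := fun d a b => by
      rw [← Finset.mul_sum, hT.trace_one, mul_zero]
    simp only [confSlot, add_mul, Finset.sum_add_distrib, delta, Finset.sum_ite_eq',
      Finset.mem_univ, if_true]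
    have z1 : ∑ a, ∑ b, ∑ c, ∑ d, (∑ f, u f * S f d a b) * (u a * T c b c d) = 0 := by
      refine Finset.sum_eq_zero fun a _ => Finset.sum_eq_zero fun b _ => ?_
      rw [Finset.sum_comm]
      refine Finset.sum_eq_zero fun d _ => ?_
      rw [← Finset.mul_sum, z, mul_zero]
    rw [z1, add_zero, ← cyc]
    simp only [hV, hV', Finset.sum_mul_sum]
    rw [sum_neg_five, sum_swap_ab, sum_swap_bc, sum_swap_cd, sum_swap_be]
    exact sum_congr_five fun a b c d e => by
      rw [← hS.pair_symm b c d a, ← hT.pair_symm b a e c]; ring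
  have e4 : ∑ a, ∑ b, ∑ c, ∑ d, ∑ e, confSlot u S d c a b e * (u a * T e b c d)
      = Ψ / 2 := by
    rw [sum_swap_cd, ← neg_neg (Ψ / 2), ← e3, sum_neg_five]
    exact sum_congr_five fun a b c d e => by rw [hT.antisymm_right]; ring
  -- The slots add up to `(w - 3) Ψ - N I`, and `Ψ = N I / 4` turns this into `(w - 7)/4 · N I`.
  simp only [twistPair, confTerm_eq_slots hS, add_mul, sub_mul _ _ (u _ * T _ _ _ _),
    Finset.sum_add_distrib, Finset.sum_sub_distrib, e0, e1, e2, e3, e4]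
  rw [psi]
  ring

/-- Read in the other order, this is `sum_mul_confTerm` with `u ⊗ T` in the role of `F`; the
coefficient is `(w - 2) - 8/4`. -/
lemma gradPair_confTerm (hS : WeylSymm 1 S) (hT : WeylSymm 1 T) (w : ℂ) (u : Fin 4 → ℂ) :
    gradPair u (confTerm w 1 u u S) T
      = (w - 4) * ((∑ a, u a * u a) * ∑ a, ∑ b, ∑ c, ∑ d, S a b c d * T a b c d) := by
  have h := sum_mul_confTerm (F := fun a b c d e => u e * T a b c d) (fun e => hT.smul (u e))
    hS w u
  have comm : ∑ a, ∑ b, ∑ c, ∑ d, T a b c d * S a b c d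
      = ∑ a, ∑ b, ∑ c, ∑ d, S a b c d * T a b c d := by simp only [mul_comm]
  rw [gradPair_smul, twistPair_smul hT hS, comm] at h
  rw [gradPair]
  simp only [mul_comm (confTerm _ _ _ _ _ _ _ _ _ _)]
  rw [h]
  ring

/-- The change of a full contraction of covariant derivatives under a conformal change. -/
lemma contraction_confTerm (hS : WeylSymm 1 S) (hT : WeylSymm 1 T)
    (hF : ∀ e, WeylSymm 1 (fun a b c d => F a b c d e))
    (hF' : ∀ e, WeylSymm 1 (fun a b c d => F' a b c d e)) (w : ℂ) (u : Fin 4 → ℂ) :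
    ∑ a, ∑ b, ∑ c, ∑ d, ∑ e, (F a b c d e + confTerm w 1 u u S a b c d e)
        * (F' a b c d e + confTerm w 1 u u T a b c d e)
      = ∑ a, ∑ b, ∑ c, ∑ d, ∑ e, F a b c d e * F' a b c d e
        + (w - 2) * (gradPair u F T + gradPair u F' S)
        - 8 * (twistPair u F T + twistPair u F' S)
        + ((w - 4) ^ 2 + 6)
          * ((∑ a, u a * u a) * ∑ a, ∑ b, ∑ c, ∑ d, S a b c d * T a b c d) := by
  have c1 := sum_mul_confTerm hF hT w u
  have c2 := sum_mul_confTerm hF' hS w u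
  -- The quadratic coefficient is `(w-2)(w-4) - 8 (w-7)/4`.
  have c3 := sum_mul_confTerm (F := confTerm w 1 u u S) (hS.confTerm w u) hT w u
  rw [gradPair_confTerm hS hT, twistPair_confTerm hS hT] at c3
  have c4 : ∑ a, ∑ b, ∑ c, ∑ d, ∑ e, confTerm w 1 u u S a b c d e * F' a b c d e
      = ∑ a, ∑ b, ∑ c, ∑ d, ∑ e, F' a b c d e * confTerm w 1 u u S a b c d e :=
    sum_congr_five fun a b c d e => mul_comm _ _
  simp only [add_mul, mul_add (F _ _ _ _ _), mul_add (confTerm _ _ _ _ _ _ _ _ _ _),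
    Finset.sum_add_distrib]
  rw [c1, c4, c2, c3]
  ring

/-- The twisted pairings carry `w - 5` here against `-8` in `contraction_confTerm`, which dictates
the combination that eliminates them. The quadratic coefficient is `(w-5)(w-7)/4 - (w-4)/2`. -/
lemma contraction_confTerm_twist (hS : WeylSymm 1 S) (hT : WeylSymm 1 T)
    (hF : ∀ e, WeylSymm 1 (fun a b c d => F a b c d e))
    (hF' : ∀ e, WeylSymm 1 (fun a b c d => F' a b c d e)) (w : ℂ) (u : Fin 4 → ℂ) :
    ∑ a, ∑ b, ∑ c, ∑ d, ∑ e, (F a b c d e + confTerm w 1 u u S a b c d e)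
        * (F' e b c d a + confTerm w 1 u u T e b c d a)
      = ∑ a, ∑ b, ∑ c, ∑ d, ∑ e, F a b c d e * F' e b c d a
        + (w - 5) * (twistPair u F T + twistPair u F' S)
        - (gradPair u F T + gradPair u F' S) / 2
        + (w ^ 2 - 14 * w + 43) / 4
          * ((∑ a, u a * u a) * ∑ a, ∑ b, ∑ c, ∑ d, S a b c d * T a b c d) := by
  have c1 := sum_mul_confTerm_twist hF hT w u
  have c2 := sum_mul_confTerm_twist hF' hS w u
  have c3 := sum_mul_confTerm_twist (F := confTerm w 1 u u S) (hS.confTerm w u) hT w u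
  rw [gradPair_confTerm hS hT, twistPair_confTerm hS hT] at c3
  have c4 : ∑ a, ∑ b, ∑ c, ∑ d, ∑ e, confTerm w 1 u u S a b c d e * F' e b c d a
      = ∑ a, ∑ b, ∑ c, ∑ d, ∑ e, F' a b c d e * confTerm w 1 u u S e b c d a := by
    rw [sum_swap_ae]
    exact sum_congr_five fun a b c d e => mul_comm _ _
  simp only [add_mul, mul_add (F _ _ _ _ _), mul_add (confTerm _ _ _ _ _ _ _ _ _ _),
    Finset.sum_add_distrib]
  rw [c1, c4, c2, c3]
  ring

end Contractions

end

/-! ### The permutation symbol and Hodge duality for the unit metric. -/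

section

/-- The selection matrix times the Vandermonde matrix of `0, 1, 2, 3`, whose determinant is `12`, is
the Vandermonde matrix of `a, b, c, d`. The resulting polynomial can be evaluated numerically and
shows the antisymmetry by `ring`. -/
lemma permSymbol_eq (a b c d : Fin 4) :
    permSymbol a b c d = ((b : ℝ) - a) * (c - a) * (d - a) * (c - b) * (d - b) * (d - c) / 12 := by
  have h : (1 : Matrix (Fin 4) (Fin 4) ℝ).submatrix ![a, b, c, d] id
      * Matrix.vandermonde (fun i : Fin 4 => (i : ℝ))
      = Matrix.vandermonde ![(a : ℝ), b, c, d] := by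
    ext i j
    rw [Matrix.mul_apply, Finset.sum_eq_single (![a, b, c, d] i)]
    · rw [Matrix.submatrix_apply, id, Matrix.one_apply_eq, one_mul]
      fin_cases i <;> rfl
    · intro k _ hk
      rw [Matrix.submatrix_apply, id, Matrix.one_apply_ne hk.symm, zero_mul]
    · simp
  have h' := congrArg Matrix.det h
  rw [Matrix.det_mul, Matrix.det_vandermonde, Matrix.det_vandermonde] at h'
  have p : ∀ X : Fin 4 → Fin 4 → ℝ, ∏ i : Fin 4, ∏ j ∈ Finset.Ioi i, X i j
      = X 0 1 * X 0 2 * X 0 3 * X 1 2 * X 1 3 * X 2 3 := fun X => by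
    simp only [Fin.prod_univ_four, show Finset.Ioi (0 : Fin 4) = {1, 2, 3} by decide,
      show Finset.Ioi (1 : Fin 4) = {2, 3} by decide, show Finset.Ioi (2 : Fin 4) = {3} by decide,
      show Finset.Ioi (3 : Fin 4) = ∅ by decide, Finset.prod_empty, Finset.prod_singleton]
    rw [Finset.prod_insert (by decide), Finset.prod_insert (by decide),
      Finset.prod_insert (by decide)]
    simp only [Finset.prod_singleton]
    ring
  rw [p, p] at h'
  rw [permSymbol, eq_div_iff (by norm_num)]
  generalize ((1 : Matrix (Fin 4) (Fin 4) ℝ).submatrix ![a, b, c, d] id).det = D at h' ⊢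
  simp only [Fin.isValue, Matrix.cons_val, Fin.val_zero, Fin.val_one, Fin.val_two,
    show ((3 : Fin 4) : ℕ) = 3 from rfl] at h'
  norm_num at h'
  exact h'

/-- The dual `(k/2) [abef] T_{efcd}` with respect to the unit metric. -/
def unitDual (k : ℂ) (T : Fin 4 → Fin 4 → Fin 4 → Fin 4 → ℂ) (a b c d : Fin 4) : ℂ :=
  k / 2 * ∑ e, ∑ f, (permSymbol a b e f : ℂ) * T e f c d

variable {T : Fin 4 → Fin 4 → Fin 4 → Fin 4 → ℂ}

lemma unitDual_swap (k : ℂ) (T) (a b c d : Fin 4) : unitDual k T b a c d = -unitDual k T a b c d := by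
  have : ∀ e f, (permSymbol b a e f : ℂ) = -permSymbol a b e f := fun e f => by
    rw [permSymbol_eq, permSymbol_eq]; push_cast; ring
  simp only [unitDual, this, neg_mul, Finset.sum_neg_distrib, mul_neg]

/-- Duality exchanges complementary index pairs up to sign; the two orders of the summed pair cancel
the factor `1/2`. -/
lemma unitDual_components (hT : ∀ a b c d, T b a c d = -T a b c d) (k : ℂ) (c d : Fin 4) :
    unitDual k T 0 1 c d = k * T 2 3 c d ∧ unitDual k T 0 2 c d = -(k * T 1 3 c d) ∧
    unitDual k T 0 3 c d = k * T 1 2 c d ∧ unitDual k T 1 2 c d = k * T 0 3 c d ∧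
    unitDual k T 1 3 c d = -(k * T 0 2 c d) ∧ unitDual k T 2 3 c d = k * T 0 1 c d := by
  have l10 := hT 0 1
  have l20 := hT 0 2
  have l30 := hT 0 3
  have l21 := hT 1 2
  have l31 := hT 1 3
  have l32 := hT 2 3
  refine ⟨?_, ?_, ?_, ?_, ?_, ?_⟩ <;>
  · simp only [unitDual, Fin.sum_univ_four, permSymbol_eq, l10, l20, l30, l21, l31, l32]
    norm_num
    ring

/-- A finite check in which the symmetries trade places: pair symmetry and the cyclic identity of
the dual come from trace-freeness of `T`, while its trace-freeness comes from pair symmetry and the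
cyclic identity of `T`. No normalisation of `k` is needed. -/
lemma WeylSymm.unitDual (hT : WeylSymm 1 T) (k : ℂ) : WeylSymm 1 (unitDual k T) := by
  have dl := hT.diag_left
  have dr := hT.diag_right
  have r10 := fun a b => hT.antisymm_right a b 0 1
  have r20 := fun a b => hT.antisymm_right a b 0 2
  have r30 := fun a b => hT.antisymm_right a b 0 3
  have r21 := fun a b => hT.antisymm_right a b 1 2
  have r31 := fun a b => hT.antisymm_right a b 1 3
  have r32 := fun a b => hT.antisymm_right a b 2 3
  have q := unitDual_components hT.antisymm_left k
  have q01 := fun c d => (q c d).1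
  have q02 := fun c d => (q c d).2.1
  have q03 := fun c d => (q c d).2.2.1
  have q12 := fun c d => (q c d).2.2.2.1
  have q13 := fun c d => (q c d).2.2.2.2.1
  have q23 := fun c d => (q c d).2.2.2.2.2
  have u10 := unitDual_swap k T 0 1
  have u20 := unitDual_swap k T 0 2
  have u30 := unitDual_swap k T 0 3
  have u21 := unitDual_swap k T 1 2
  have u31 := unitDual_swap k T 1 3
  have u32 := unitDual_swap k T 2 3
  have ud : ∀ a c d, ConfCov.unitDual k T a a c d = 0 := fun a c d =>
    self_eq_neg.mp (unitDual_swap k T a a c d)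
  have p1 := hT.pair_symm 0 1 0 2
  have p2 := hT.pair_symm 0 1 0 3
  have p3 := hT.pair_symm 0 1 1 2
  have p4 := hT.pair_symm 0 1 1 3
  have p5 := hT.pair_symm 0 1 2 3
  have p6 := hT.pair_symm 0 2 0 3
  have p7 := hT.pair_symm 0 2 1 2
  have p8 := hT.pair_symm 0 2 1 3
  have p9 := hT.pair_symm 0 2 2 3
  have p10 := hT.pair_symm 0 3 1 2
  have p11 := hT.pair_symm 0 3 1 3
  have p12 := hT.pair_symm 0 3 2 3
  have p13 := hT.pair_symm 1 2 1 3
  have p14 := hT.pair_symm 1 2 2 3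
  have p15 := hT.pair_symm 1 3 2 3
  obtain ⟨e1, e2, e3, e4, e5, e6, e7, e8, e9, e10, e11⟩ := hT.component_relations
  have ar : ∀ a b c d, ConfCov.unitDual k T a b d c = -ConfCov.unitDual k T a b c d :=
    fun a b c d => by
      simp only [ConfCov.unitDual, hT.antisymm_right _ _ c d]
      simp only [mul_neg, Finset.sum_neg_distrib]
  refine ⟨unitDual_swap k T, ar, ?_, ?_, ?_⟩
  · intro a b c d
    fin_cases a <;> fin_cases b <;> fin_cases c <;> fin_cases d <;>
    simp only [Fin.zero_eta, Fin.mk_one, Fin.reduceFinMk, Fin.isValue, ud, u10, u20, u30, u21, u31,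
      u32, q01, q02, q03, q12, q13, q23, dr, r10, r20, r30, r21, r31, r32, p1, p2, p3, p4, p5, p6,
      p7, p8, p9, p10, p11, p12, p13, p14, p15, e1, e2, e3, e4, e5, e6, e7, e8, e9, e10, e11] <;>
    ring
  · intro a b c d
    fin_cases a <;> fin_cases b <;> fin_cases c <;> fin_cases d <;>
    simp only [Fin.zero_eta, Fin.mk_one, Fin.reduceFinMk, Fin.isValue, ud, u10, u20, u30, u21, u31,
      u32, q01, q02, q03, q12, q13, q23, dr, r10, r20, r30, r21, r31, r32, p1, p2, p3, p4, p5, p6,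
      p7, p8, p9, p10, p11, p12, p13, p14, p15, e1, e2, e3, e4, e5, e6, e7, e8, e9, e10, e11] <;>
    ring
  · intro b d
    have o' : ∀ X : Fin 4 → Fin 4 → ℂ, ∑ a, ∑ c, (1 : Matrix (Fin 4) (Fin 4) ℂ) a c * X a c
        = ∑ a, X a a := fun X => by simp [Matrix.one_apply]
    rw [o']
    fin_cases b <;> fin_cases d <;>
    simp only [Fin.zero_eta, Fin.mk_one, Fin.reduceFinMk, Fin.isValue, ud, u10, u20, u30, u21, u31,
      u32, q01, q02, q03, q12, q13, q23, dr, r10, r20, r30, r21, r31, r32, p1, p2, p3, p4, p5, p6,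
      p7, p8, p9, p10, p11, p12, p13, p14, p15, e5,
      Fin.sum_univ_four] <;>
    ring

end

/-! ### Complex orthonormal frames. -/

section

section Frame

lemma sum_fun_succ {M : Type*} [AddCommMonoid M] {n : ℕ} (f : (Fin (n + 1) → Fin 4) → M) :
    ∑ I, f I = ∑ a, ∑ I', f (Matrix.vecCons a I') := by
  rw [← Fintype.sum_prod_type' (f := fun a (I' : Fin n → Fin 4) => f (Matrix.vecCons a I'))]
  exact Fintype.sum_equiv (Fin.consEquiv fun _ => Fin 4).symm _ _ fun I => by
    congr 1
    exact (Fin.cons_self_tail I).symm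

lemma sum_fun_four {M : Type*} [AddCommMonoid M] (f : (Fin 4 → Fin 4) → M) :
    ∑ I, f I = ∑ a, ∑ b, ∑ c, ∑ d, f ![a, b, c, d] := by
  simp only [sum_fun_succ, Fintype.sum_unique]
  rfl

lemma sum_fun_five {M : Type*} [AddCommMonoid M] (f : (Fin 5 → Fin 4) → M) :
    ∑ I, f I = ∑ a, ∑ b, ∑ c, ∑ d, ∑ e, f ![a, b, c, d, e] := by
  simp only [sum_fun_succ, Fintype.sum_unique]
  rfl

variable (B H G : Matrix (Fin 4) (Fin 4) ℂ)

/-- The components of a tensor of rank one in the frame given by the columns of `B`. -/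
def frame1 (u : Fin 4 → ℂ) (i : Fin 4) : ℂ := ∑ a, B a i * u a

/-- The components of a tensor of rank four in the frame given by the columns of `B`. -/
def frame4 (T : Fin 4 → Fin 4 → Fin 4 → Fin 4 → ℂ) (i j k l : Fin 4) : ℂ :=
  ∑ a, ∑ b, ∑ c, ∑ d, B a i * B b j * B c k * B d l * T a b c d

/-- The components of a tensor of rank five in the frame given by the columns of `B`. -/
def frame5 (T : Fin 4 → Fin 4 → Fin 4 → Fin 4 → Fin 4 → ℂ) (i j k l m : Fin 4) : ℂ :=
  ∑ a, ∑ b, ∑ c, ∑ d, ∑ e, B a i * B b j * B c k * B d l * B e m * T a b c d e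

variable {B H G}

/-- Indexing by functions `Fin n → Fin 4` treats all ranks at once: a product of entries of `B Bᵀ`
over the slots expands into a single sum over frame multi-indices. -/
lemma sum_frame_mul_frame (hB : H = B * B.transpose) {n : ℕ} (S T : (Fin n → Fin 4) → ℂ) :
    ∑ J : Fin n → Fin 4, (∑ I : Fin n → Fin 4, (∏ k, B (I k) (J k)) * S I)
        * (∑ I : Fin n → Fin 4, (∏ k, B (I k) (J k)) * T I)
      = ∑ I : Fin n → Fin 4, S I * ∑ I' : Fin n → Fin 4, (∏ k, H (I k) (I' k)) * T I' := by
  have h : ∀ I I' : Fin n → Fin 4, ∏ k, H (I k) (I' k)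
      = ∑ J : Fin n → Fin 4, (∏ k, B (I k) (J k)) * ∏ k, B (I' k) (J k) := by
    intro I I'
    simp only [hB, Matrix.mul_apply, Matrix.transpose_apply, Finset.prod_univ_sum,
      Fintype.piFinset_univ, Finset.prod_mul_distrib]
  simp only [Finset.sum_mul_sum]
  simp only [h, Finset.mul_sum, Finset.sum_mul]
  rw [Finset.sum_comm]
  refine Finset.sum_congr rfl fun I _ => ?_
  rw [Finset.sum_comm]
  refine Finset.sum_congr rfl fun I' _ => Finset.sum_congr rfl fun J _ => ?_
  ring

lemma sum_frame4_mul (hB : H = B * B.transpose) (S T : Fin 4 → Fin 4 → Fin 4 → Fin 4 → ℂ) :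
    ∑ i, ∑ j, ∑ k, ∑ l, frame4 B S i j k l * frame4 B T i j k l
      = ∑ a, ∑ b, ∑ c, ∑ d, S a b c d
        * ∑ p, ∑ q, ∑ r, ∑ s, H a p * H b q * H c r * H d s * T p q r s := by
  have h := sum_frame_mul_frame hB (n := 4) (fun I => S (I 0) (I 1) (I 2) (I 3))
    (fun I => T (I 0) (I 1) (I 2) (I 3))
  simp only [sum_fun_four, Fin.prod_univ_four] at h
  exact h

lemma sum_frame5_mul (hB : H = B * B.transpose)
    (S T : Fin 4 → Fin 4 → Fin 4 → Fin 4 → Fin 4 → ℂ) :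
    ∑ i, ∑ j, ∑ k, ∑ l, ∑ m, frame5 B S i j k l m * frame5 B T i j k l m
      = ∑ a, ∑ b, ∑ c, ∑ d, ∑ e, S a b c d e * ∑ p, ∑ q, ∑ r, ∑ s, ∑ t,
        H a p * H b q * H c r * H d s * H e t * T p q r s t := by
  have h := sum_frame_mul_frame hB (n := 5) (fun I => S (I 0) (I 1) (I 2) (I 3) (I 4))
    (fun I => T (I 0) (I 1) (I 2) (I 3) (I 4))
  simp only [sum_fun_five, Fin.prod_univ_five] at h
  exact h

variable {T : Fin 4 → Fin 4 → Fin 4 → Fin 4 → ℂ}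

lemma WeylSymm.frame4 (hT : WeylSymm H T) (hB : H = B * B.transpose) :
    WeylSymm 1 (frame4 B T) where
  antisymm_left i j k l := by
    simp only [ConfCov.frame4]
    rw [Finset.sum_comm]
    simp only [← Finset.sum_neg_distrib]
    refine Finset.sum_congr rfl fun a _ => Finset.sum_congr rfl fun b _ =>
      Finset.sum_congr rfl fun c _ => Finset.sum_congr rfl fun d _ => ?_
    rw [hT.antisymm_left]; ring
  antisymm_right i j k l := by
    simp only [ConfCov.frame4, ← Finset.sum_neg_distrib]
    refine Finset.sum_congr rfl fun a _ => Finset.sum_congr rfl fun b _ => ?_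
    rw [Finset.sum_comm]
    refine Finset.sum_congr rfl fun c _ => Finset.sum_congr rfl fun d _ => ?_
    rw [hT.antisymm_right]; ring
  pair_symm i j k l := by
    simp only [ConfCov.frame4]
    -- A dummy fifth index, pinned to `0`, lets the reordering of five sums serve for four.
    have := sum_swap_pairs
      (fun a b c d e => if e = 0 then B a k * B b l * B c i * B d j * T a b c d else 0)
    simp only [Finset.sum_ite_eq', Finset.mem_univ, if_true] at this
    rw [this]
    refine Finset.sum_congr rfl fun a _ => Finset.sum_congr rfl fun b _ =>
      Finset.sum_congr rfl fun c _ => Finset.sum_congr rfl fun d _ => ?_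
    rw [hT.pair_symm]; ring
  bianchi i j k l := by
    have h1 : ConfCov.frame4 B T i k l j
        = ∑ a, ∑ b, ∑ c, ∑ d, B a i * B b j * B c k * B d l * T a c d b := by
      refine Finset.sum_congr rfl fun a _ => ?_
      rw [Finset.sum_congr rfl fun _ _ => Finset.sum_comm, Finset.sum_comm]
      exact Finset.sum_congr rfl fun b _ => Finset.sum_congr rfl fun c _ =>
        Finset.sum_congr rfl fun d _ => by ring
    have h2 : ConfCov.frame4 B T i l j k
        = ∑ a, ∑ b, ∑ c, ∑ d, B a i * B b j * B c k * B d l * T a d b c := by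
      refine Finset.sum_congr rfl fun a _ => ?_
      rw [Finset.sum_comm, Finset.sum_congr rfl fun _ _ => Finset.sum_comm]
      exact Finset.sum_congr rfl fun b _ => Finset.sum_congr rfl fun c _ =>
        Finset.sum_congr rfl fun d _ => by ring
    rw [h1, h2, ConfCov.frame4]
    simp only [← Finset.sum_add_distrib]
    refine Finset.sum_eq_zero fun a _ => Finset.sum_eq_zero fun b _ =>
      Finset.sum_eq_zero fun c _ => Finset.sum_eq_zero fun d _ => ?_
    linear_combination (B a i * B b j * B c k * B d l) * hT.bianchi a b c d
  trace_free j l := by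
    have o' : ∀ X : Fin 4 → Fin 4 → ℂ, ∑ a, ∑ c, (1 : Matrix (Fin 4) (Fin 4) ℂ) a c * X a c
        = ∑ a, X a a := fun X => by simp [Matrix.one_apply]
    rw [o']
    simp only [ConfCov.frame4]
    rw [sum_swap_ab, sum_swap_bc, sum_swap_cd, sum_swap_de, sum_swap_ab, sum_swap_cd, sum_swap_bc]
    refine Finset.sum_eq_zero fun b _ => Finset.sum_eq_zero fun d _ => ?_
    have h := hT.trace_free b d
    have h' : B b j * B d l * ∑ a, ∑ c, H a c * T a b c d = 0 := by rw [h, mul_zero]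
    simp only [hB, Matrix.mul_apply, Matrix.transpose_apply, Finset.sum_mul, Finset.mul_sum] at h'
    rw [← h']
    refine Finset.sum_congr rfl fun _ _ => Finset.sum_congr rfl fun _ _ =>
      Finset.sum_congr rfl fun _ _ => ?_
    ring

/-- A symmetric nondegenerate matrix has an orthonormal frame over the complex numbers. -/
lemma exists_orthonormal_frame {h : Matrix (Fin 4) (Fin 4) ℝ} (hs : h.transpose = h) :
    ∃ B : Matrix (Fin 4) (Fin 4) ℂ, h.map (fun x => (x : ℂ)) = B * B.transpose := by
  have hh : h.IsHermitian := by
    rw [Matrix.IsHermitian, Matrix.conjTranspose_eq_transpose_of_trivial, hs]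
  have hsp := hh.spectral_theorem
  -- Complex square roots exist for negative eigenvalues as well, which is why the signature plays
  -- no role.
  choose r hr using fun i => IsAlgClosed.exists_pow_nat_eq (hh.eigenvalues i : ℂ) (n := 2) two_pos
  refine ⟨(hh.eigenvectorUnitary : Matrix (Fin 4) (Fin 4) ℝ).map (fun x => (x : ℂ))
    * Matrix.diagonal r, ?_⟩
  set V : Matrix (Fin 4) (Fin 4) ℝ := hh.eigenvectorUnitary.1 with hV
  rw [Unitary.conjStarAlgAut_apply, ← hV, Matrix.star_eq_conjTranspose,
    Matrix.conjTranspose_eq_transpose_of_trivial] at hsp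
  have hd : (Matrix.diagonal (RCLike.ofReal ∘ hh.eigenvalues) : Matrix (Fin 4) (Fin 4) ℝ).map
      (fun x => (x : ℂ)) = Matrix.diagonal r * Matrix.diagonal r := by
    rw [Matrix.diagonal_mul_diagonal, Matrix.diagonal_map (by simp)]
    congr 1
    funext i
    simp [← hr, sq]
  have hm := congrArg (fun X : Matrix (Fin 4) (Fin 4) ℝ => X.map Complex.ofRealHom) hsp
  simp only [Matrix.map_mul, Matrix.transpose_map] at hm
  change h.map (fun x => (x : ℂ)) = V.map (fun x => (x : ℂ)) *
    (Matrix.diagonal (RCLike.ofReal ∘ hh.eigenvalues) : Matrix (Fin 4) (Fin 4) ℝ).map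
      (fun x => (x : ℂ)) * (V.map (fun x => (x : ℂ))).transpose at hm
  rw [hm, hd, Matrix.transpose_mul, Matrix.diagonal_transpose]
  simp only [Matrix.mul_assoc]

lemma frame5_mul_first (B : Matrix (Fin 4) (Fin 4) ℂ) (u : Fin 4 → ℂ)
    (T : Fin 4 → Fin 4 → Fin 4 → Fin 4 → ℂ) (i j k l m : Fin 4) :
    frame5 B (fun a b c d e => u a * T e b c d) i j k l m = frame1 B u i * frame4 B T m j k l := by
  rw [frame5, frame1, Finset.sum_mul, sum_swap_de, sum_swap_cd, sum_swap_bc]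
  simp only [frame4, Finset.mul_sum]
  exact sum_congr_five fun a b c d e => by ring

lemma frame5_mul_last (B : Matrix (Fin 4) (Fin 4) ℂ) (u : Fin 4 → ℂ)
    (T : Fin 4 → Fin 4 → Fin 4 → Fin 4 → ℂ) (i j k l m : Fin 4) :
    frame5 B (fun a b c d e => u e * T a b c d) i j k l m = frame1 B u m * frame4 B T i j k l := by
  rw [frame5, frame1, Finset.sum_mul, sum_swap_de, sum_swap_cd, sum_swap_bc, sum_swap_ab]
  simp only [frame4, Finset.mul_sum]
  exact sum_congr_five fun a b c d e => by ring

/-- Since `G` inverts `B Bᵀ`, it becomes the unit matrix in the frame; raising the index of `u` is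
then invisible. -/
lemma frame5_metric_first (hB : H = B * B.transpose) (hG : H * G = 1) (u : Fin 4 → ℂ)
    (T : Fin 4 → Fin 4 → Fin 4 → Fin 4 → ℂ) (i j k l m : Fin 4) :
    frame5 B (fun a b c d e => G e a * ∑ f, H.mulVec u f * T f b c d) i j k l m
      = (1 : Matrix (Fin 4) (Fin 4) ℂ) m i * ∑ x, frame1 B u x * frame4 B T x j k l := by
  have h1 : B.transpose * G * B = 1 := by
    rw [← mul_eq_one_comm, ← Matrix.mul_assoc, ← hB, hG]
  have h2 : ∀ f, H.mulVec u f = ∑ x, B f x * frame1 B u x := fun f => by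
    rw [hB, ← Matrix.mulVec_mulVec]
    rfl
  have h3 : (1 : Matrix (Fin 4) (Fin 4) ℂ) m i = ∑ a, ∑ e, B e m * G e a * B a i := by
    rw [← h1]
    simp only [Matrix.mul_apply, Matrix.transpose_apply, Finset.sum_mul]
  have h4 : ∑ x, frame1 B u x * frame4 B T x j k l
      = ∑ b, ∑ c, ∑ d, B b j * B c k * B d l * ∑ f, H.mulVec u f * T f b c d := by
    simp only [h2, frame4, Finset.sum_mul, Finset.mul_sum]
    rw [sum_swap_ab, sum_swap_bc, sum_swap_cd, sum_swap_de, sum_swap_ab, sum_swap_bc, sum_swap_cd]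
    exact sum_congr_five fun a b c d e => by ring
  -- Keeping the contracted tensor opaque protects its inner sum from the distribution of sums that
  -- follows.
  obtain ⟨Z, hZ⟩ : ∃ Z : Fin 4 → Fin 4 → Fin 4 → ℂ,
      ∀ b c d, ∑ f, H.mulVec u f * T f b c d = Z b c d := ⟨_, fun _ _ _ => rfl⟩
  simp only [hZ] at h4 ⊢
  rw [h4, h3, frame5, sum_swap_ab, sum_swap_bc, sum_swap_cd]
  simp only [Finset.sum_mul, Finset.mul_sum]
  exact sum_congr_five fun a b c d e => by ring

lemma frame5_swap_ab (B : Matrix (Fin 4) (Fin 4) ℂ) (X) (i j k l m : Fin 4) :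
    frame5 B (fun a b c d e => X b a c d e) i j k l m = frame5 B X j i k l m := by
  rw [frame5, frame5, sum_swap_ab]
  exact sum_congr_five fun a b c d e => by ring

lemma frame5_swap_bc (B : Matrix (Fin 4) (Fin 4) ℂ) (X) (i j k l m : Fin 4) :
    frame5 B (fun a b c d e => X a c b d e) i j k l m = frame5 B X i k j l m := by
  rw [frame5, frame5, sum_swap_bc]
  exact sum_congr_five fun a b c d e => by ring

lemma frame5_swap_cd (B : Matrix (Fin 4) (Fin 4) ℂ) (X) (i j k l m : Fin 4) :
    frame5 B (fun a b c d e => X a b d c e) i j k l m = frame5 B X i j l k m := by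
  rw [frame5, frame5, sum_swap_cd]
  exact sum_congr_five fun a b c d e => by ring

lemma frame4_swap_ab (B : Matrix (Fin 4) (Fin 4) ℂ) (T) (i j k l : Fin 4) :
    frame4 B (fun a b c d => T b a c d) i j k l = frame4 B T j i k l := by
  rw [frame4, frame4, Finset.sum_comm]
  exact Finset.sum_congr rfl fun _ _ => Finset.sum_congr rfl fun _ _ =>
    Finset.sum_congr rfl fun _ _ => Finset.sum_congr rfl fun _ _ => by ring

lemma frame4_swap_bc (B : Matrix (Fin 4) (Fin 4) ℂ) (T) (i j k l : Fin 4) :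
    frame4 B (fun a b c d => T a c b d) i j k l = frame4 B T i k j l := by
  rw [frame4, frame4, Finset.sum_congr rfl fun _ _ => Finset.sum_comm]
  exact Finset.sum_congr rfl fun _ _ => Finset.sum_congr rfl fun _ _ =>
    Finset.sum_congr rfl fun _ _ => Finset.sum_congr rfl fun _ _ => by ring

lemma frame4_swap_cd (B : Matrix (Fin 4) (Fin 4) ℂ) (T) (i j k l : Fin 4) :
    frame4 B (fun a b c d => T a b d c) i j k l = frame4 B T i j l k := by
  rw [frame4, frame4, Finset.sum_congr rfl fun _ _ => Finset.sum_congr rfl fun _ _ =>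
    Finset.sum_comm]
  exact Finset.sum_congr rfl fun _ _ => Finset.sum_congr rfl fun _ _ =>
    Finset.sum_congr rfl fun _ _ => Finset.sum_congr rfl fun _ _ => by ring

/-- The part of `confTerm` that belongs to the first index, for an arbitrary metric. -/
def metricSlot (G H : Matrix (Fin 4) (Fin 4) ℂ) (u : Fin 4 → ℂ)
    (T : Fin 4 → Fin 4 → Fin 4 → Fin 4 → ℂ) (a b c d e : Fin 4) : ℂ :=
  -(u a * T e b c d) + G e a * ∑ f, H.mulVec u f * T f b c d

lemma frame5_add (B : Matrix (Fin 4) (Fin 4) ℂ) (X Y) (i j k l m : Fin 4) :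
    frame5 B (fun a b c d e => X a b c d e + Y a b c d e) i j k l m
      = frame5 B X i j k l m + frame5 B Y i j k l m := by
  simp only [frame5, mul_add, Finset.sum_add_distrib]

lemma frame5_neg (B : Matrix (Fin 4) (Fin 4) ℂ) (X) (i j k l m : Fin 4) :
    frame5 B (fun a b c d e => -X a b c d e) i j k l m = -frame5 B X i j k l m := by
  simp only [frame5, mul_neg, Finset.sum_neg_distrib]

lemma frame5_smul (B : Matrix (Fin 4) (Fin 4) ℂ) (r : ℂ) (X) (i j k l m : Fin 4) :
    frame5 B (fun a b c d e => r * X a b c d e) i j k l m = r * frame5 B X i j k l m := by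
  simp only [frame5, mul_left_comm _ r, Finset.mul_sum]

lemma frame5_metricSlot (hB : H = B * B.transpose) (hG : H * G = 1) (u : Fin 4 → ℂ)
    (T : Fin 4 → Fin 4 → Fin 4 → Fin 4 → ℂ) (i j k l m : Fin 4) :
    frame5 B (metricSlot G H u T) i j k l m
      = confSlot (frame1 B u) (frame4 B T) i j k l m := by
  have h : metricSlot G H u T = fun a b c d e => -(u a * T e b c d)
    + G e a * ∑ f, H.mulVec u f * T f b c d := rfl
  rw [h, frame5_add, frame5_neg, frame5_mul_first, frame5_metric_first hB hG, confSlot]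

/-- Each index term is brought to the first-slot form by permuting the arguments of `T` and of the
rank-five tensor together, so that `frame5_metricSlot` applies to all four. No symmetry of `T`
enters. -/
lemma frame5_confTerm (hB : H = B * B.transpose) (hG : H * G = 1) (w : ℂ) (u : Fin 4 → ℂ)
    (T : Fin 4 → Fin 4 → Fin 4 → Fin 4 → ℂ) (i j k l m : Fin 4) :
    frame5 B (confTerm w G u (H.mulVec u) T) i j k l m
      = confTerm w 1 (frame1 B u) (frame1 B u) (frame4 B T) i j k l m := by
  have h : confTerm w G u (H.mulVec u) T = fun a b c d e => (w - 4) * (u e * T a b c d)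
      + metricSlot G H u T a b c d e
      + metricSlot G H u (fun a b c d => T b a c d) b a c d e
      + metricSlot G H u (fun c a b d => T a b c d) c a b d e
      + metricSlot G H u (fun d a b c => T a b c d) d a b c e := by
    funext a b c d e
    simp only [confTerm, metricSlot]
    ring
  have s1 := frame4_swap_ab B T
  have s2 : ∀ c a b d, frame4 B (fun c a b d => T a b c d) c a b d = frame4 B T a b c d :=
    fun c a b d => by
      rw [frame4_swap_ab B (fun a c b d => T a b c d), frame4_swap_bc B T]
  have s3 : ∀ d a b c, frame4 B (fun d a b c => T a b c d) d a b c = frame4 B T a b c d :=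
    fun d a b c => by
      rw [frame4_swap_ab B (fun a d b c => T a b c d),
        frame4_swap_bc B (fun a b d c => T a b c d), frame4_swap_cd B T]
  rw [h, frame5_add, frame5_add, frame5_add, frame5_add, frame5_smul, frame5_mul_last,
    frame5_metricSlot hB hG,
    frame5_swap_ab B (metricSlot G H u (fun a b c d => T b a c d)),
    frame5_metricSlot hB hG,
    frame5_swap_bc B (fun a c b d e => metricSlot G H u (fun c a b d => T a b c d) c a b d e),
    frame5_swap_ab B (metricSlot G H u (fun c a b d => T a b c d)),
    frame5_metricSlot hB hG,
    frame5_swap_cd B (fun a b d c e => metricSlot G H u (fun d a b c => T a b c d) d a b c e),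
    frame5_swap_bc B (fun a d b c e => metricSlot G H u (fun d a b c => T a b c d) d a b c e),
    frame5_swap_ab B (metricSlot G H u (fun d a b c => T a b c d)),
    frame5_metricSlot hB hG]
  simp only [confSlot, s1, s2, s3, confTerm]
  ring

end Frame

end

/-! ### Hodge duality in a frame. -/

section

section Dual

lemma sum_swap_pairs_four {M : Type*} [AddCommMonoid M] (f : Fin 4 → Fin 4 → Fin 4 → Fin 4 → M) :
    ∑ a, ∑ b, ∑ c, ∑ d, f a b c d = ∑ a, ∑ b, ∑ c, ∑ d, f c d a b := by
  have h := Finset.sum_comm (s := (Finset.univ : Finset (Fin 4 × Fin 4)))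
    (t := (Finset.univ : Finset (Fin 4 × Fin 4))) (f := fun x y => f x.1 x.2 y.1 y.2)
  simpa only [Fintype.sum_prod_type] using h

/-- The symbol is the alternating form `det` on basis vectors. Expanding the rows multilinearly
gives the left side, and multiplicativity of the determinant gives the right side. -/
lemma sum_permSymbol_frame (B : Matrix (Fin 4) (Fin 4) ℂ) (i j m n : Fin 4) :
    ∑ a, ∑ b, ∑ e, ∑ f, (permSymbol a b e f : ℂ) * (B a i * B b j * B e m * B f n)
      = B.det * permSymbol i j m n := by
  have hp : ∀ J : Fin 4 → Fin 4, (permSymbol (J 0) (J 1) (J 2) (J 3) : ℂ)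
      = Matrix.detRowAlternating fun r => (Pi.single (J r) 1 : Fin 4 → ℂ) := by
    intro J
    have : (permSymbol (J 0) (J 1) (J 2) (J 3) : ℂ)
        = (((1 : Matrix (Fin 4) (Fin 4) ℝ).submatrix J id).map Complex.ofRealHom).det := by
      rw [← RingHom.mapMatrix_apply, ← RingHom.map_det]
      simp only [permSymbol, Complex.ofRealHom_eq_coe]
      congr 3
      ext r
      fin_cases r <;> rfl
    rw [this]
    change Matrix.det _ = Matrix.det (Matrix.of fun r => (Pi.single (J r) 1 : Fin 4 → ℂ))
    congr 1
    ext r s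
    simp only [Matrix.of_apply, Matrix.map_apply, Matrix.submatrix_apply, id, Matrix.one_apply, Pi.single_apply,
      eq_comm (a := s)]
    split_ifs <;> simp
  have h1 : B.det * permSymbol i j m n
      = Matrix.detRowAlternating fun r => ∑ a, (B a (![i, j, m, n] r)) • (Pi.single a 1 : Fin 4 → ℂ) := by
    have h2 := hp ![i, j, m, n]
    simp only [Matrix.cons_val] at h2
    rw [h2]
    change B.det * Matrix.det (Matrix.of fun r => (Pi.single (![i, j, m, n] r) 1 : Fin 4 → ℂ))
      = Matrix.det (Matrix.of fun r => ∑ a, B a (![i, j, m, n] r) • (Pi.single a 1 : Fin 4 → ℂ))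
    rw [mul_comm, ← Matrix.det_transpose B, ← Matrix.det_mul]
    congr 1
    ext r s
    simp [Matrix.mul_apply, Pi.single_apply, Finset.sum_apply]
  rw [h1, ← AlternatingMap.coe_multilinearMap, MultilinearMap.map_sum, sum_fun_four]
  refine Finset.sum_congr rfl fun a _ => Finset.sum_congr rfl fun b _ =>
    Finset.sum_congr rfl fun e _ => Finset.sum_congr rfl fun f _ => ?_
  rw [MultilinearMap.map_smul_univ, Fin.prod_univ_four, AlternatingMap.coe_multilinearMap, ← hp,
    smul_eq_mul, mul_comm]
  rfl

/-- Hodge duality in a frame. -/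
lemma frame4_hodge {B H : Matrix (Fin 4) (Fin 4) ℂ} (hB : H = B * B.transpose) (s : ℂ)
    (T : Fin 4 → Fin 4 → Fin 4 → Fin 4 → ℂ) (i j k l : Fin 4) :
    frame4 B (fun a b c d => (1 / 2) * ∑ e, ∑ f, ∑ p, ∑ q,
      (s * permSymbol a b e f) * H e p * H f q * T p q c d) i j k l
      = unitDual (s * B.det) (frame4 B T) i j k l := by
  set E : Matrix (Fin 4 × Fin 4) (Fin 4 × Fin 4) ℂ :=
    Matrix.of fun x y => (permSymbol x.1 x.2 y.1 y.2 : ℂ) with hE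
  set K : Matrix (Fin 4 × Fin 4) (Fin 4 × Fin 4) ℂ :=
    Matrix.of fun x y => B x.1 y.1 * B x.2 y.2 with hK
  set flat : (Fin 4 → Fin 4 → Fin 4 → Fin 4 → ℂ) → Matrix (Fin 4 × Fin 4) (Fin 4 × Fin 4) ℂ :=
    fun T => Matrix.of fun x y => T x.1 x.2 y.1 y.2 with hflat
  have hfr : ∀ T, flat (frame4 B T) = K.transpose * flat T * K := by
    intro T
    ext x y
    simp only [hflat, hK, Matrix.mul_apply, Matrix.of_apply, Matrix.transpose_apply, frame4,
      Fintype.sum_prod_type, Finset.sum_mul]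
    rw [sum_swap_pairs_four]
    exact Finset.sum_congr rfl fun _ _ => Finset.sum_congr rfl fun _ _ =>
      Finset.sum_congr rfl fun _ _ => Finset.sum_congr rfl fun _ _ => by ring
  have hKE : K.transpose * E * K = B.det • E := by
    ext x y
    rw [Matrix.smul_apply, hE, Matrix.of_apply, smul_eq_mul, ← sum_permSymbol_frame,
      sum_swap_pairs_four]
    simp only [hK, Matrix.mul_apply, Matrix.of_apply, Matrix.transpose_apply,
      Fintype.sum_prod_type, Finset.sum_mul]
    exact Finset.sum_congr rfl fun _ _ => Finset.sum_congr rfl fun _ _ =>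
      Finset.sum_congr rfl fun _ _ => Finset.sum_congr rfl fun _ _ => by ring
  have hHH : ∀ x y : Fin 4 × Fin 4, H x.1 y.1 * H x.2 y.2 = (K * K.transpose) x y := by
    intro x y
    simp only [hK, hB, Matrix.mul_apply, Matrix.of_apply, Matrix.transpose_apply,
      Fintype.sum_prod_type, Finset.sum_mul_sum]
    exact Finset.sum_congr rfl fun _ _ => Finset.sum_congr rfl fun _ _ => by ring
  have hdual : flat (fun a b c d => (1 / 2) * ∑ e, ∑ f, ∑ p, ∑ q,
      (s * permSymbol a b e f) * H e p * H f q * T p q c d)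
      = (s / 2) • (E * (K * K.transpose) * flat T) := by
    ext x y
    rw [Matrix.smul_apply, Matrix.mul_apply]
    simp only [Matrix.mul_apply (M := E), ← hHH]
    simp only [hflat, hE, Matrix.of_apply, Fintype.sum_prod_type, Finset.sum_mul, smul_eq_mul]
    rw [sum_swap_pairs_four]
    simp only [Finset.mul_sum]
    exact Finset.sum_congr rfl fun _ _ => Finset.sum_congr rfl fun _ _ =>
      Finset.sum_congr rfl fun _ _ => Finset.sum_congr rfl fun _ _ => by ring
  have hun : flat (unitDual (s * B.det) (frame4 B T))
      = (s * B.det / 2) • (E * flat (frame4 B T)) := by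
    ext x y
    simp only [hflat, hE, unitDual, Matrix.smul_apply, Matrix.mul_apply, Matrix.of_apply,
      Fintype.sum_prod_type, smul_eq_mul]
  have := congrFun (congrFun (show flat (frame4 B (fun a b c d => (1 / 2) * ∑ e, ∑ f, ∑ p, ∑ q,
      (s * permSymbol a b e f) * H e p * H f q * T p q c d))
      = flat (unitDual (s * B.det) (frame4 B T)) by
    rw [hun, hfr, hfr, hdual]
    -- As matrices on index pairs, `K` changes the frame, `K Kᵀ` raises two indices, and `Kᵀ E K` is
    -- a multiple of `E`. Regrouping the product therefore separates the duality from the frame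
    -- change.
    have e1 : K.transpose * (E * (K * K.transpose) * flat T) * K
        = (K.transpose * E * K) * (K.transpose * flat T * K) := by
      simp only [Matrix.mul_assoc]
    rw [Matrix.mul_smul, Matrix.smul_mul, e1, hKE, Matrix.smul_mul, smul_smul]
    congr 1; ring) (i, j)) (k, l)
  exact this

end Dual

end

/-! ### Partial derivatives, and the parallelism of the metric and its volume density. -/

section

section Calculus

variable {Ω : Set E4} {f f' : E4 → ℝ} {y : E4}

lemma pd_congr (hΩ : IsOpen Ω) (hy : y ∈ Ω) (h : ∀ z ∈ Ω, f z = f' z) (i : Fin 4) :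
    pd i f y = pd i f' y := by
  rw [pd, pd, (Filter.eventuallyEq_of_mem (hΩ.mem_nhds hy) h).fderiv_eq]

lemma pd_add (hf : DifferentiableAt ℝ f y) (hf' : DifferentiableAt ℝ f' y) (i : Fin 4) :
    pd i (fun z => f z + f' z) y = pd i f y + pd i f' y := by
  rw [pd, fderiv_fun_add hf hf']; rfl

lemma pd_sub (hf : DifferentiableAt ℝ f y) (hf' : DifferentiableAt ℝ f' y) (i : Fin 4) :
    pd i (fun z => f z - f' z) y = pd i f y - pd i f' y := by
  rw [pd, fderiv_fun_sub hf hf']; rfl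

lemma pd_mul (hf : DifferentiableAt ℝ f y) (hf' : DifferentiableAt ℝ f' y) (i : Fin 4) :
    pd i (fun z => f z * f' z) y = pd i f y * f' y + f y * pd i f' y := by
  rw [pd, fderiv_fun_mul hf hf']
  simp only [pd, add_apply, smul_apply, smul_eq_mul]
  ring

lemma pd_const (i : Fin 4) (r : ℝ) : pd i (fun _ => r) y = 0 := by
  simp [pd]

lemma pd_const_mul (hf : DifferentiableAt ℝ f y) (i : Fin 4) (r : ℝ) :
    pd i (fun z => r * f z) y = r * pd i f y := by
  rw [pd_mul (differentiableAt_const r) hf, pd_const, zero_mul, zero_add]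

lemma pd_sum {ι : Type*} (s : Finset ι) {F : ι → E4 → ℝ} (hF : ∀ a, DifferentiableAt ℝ (F a) y)
    (i : Fin 4) : pd i (fun z => ∑ a ∈ s, F a z) y = ∑ a ∈ s, pd i (F a) y := by
  rw [pd, fderiv_fun_sum fun a _ => hF a]
  simp [pd]

lemma pd_exp_mul (hf : DifferentiableAt ℝ f y) (i : Fin 4) (r : ℝ) :
    pd i (fun z => Real.exp (r * f z)) y = r * pd i f y * Real.exp (r * f y) := by
  rw [pd, fderiv_exp (hf.const_mul r), fderiv_const_mul hf]
  simp only [pd, smul_apply, smul_eq_mul]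
  ring

lemma contDiffOn_pd (hΩ : IsOpen Ω) (hf : ContDiffOn ℝ ∞ f Ω) (i : Fin 4) :
    ContDiffOn ℝ ∞ (pd i f) Ω :=
  (hf.fderiv_of_isOpen hΩ (m := ∞) (by simp)).clm_apply contDiffOn_const

lemma differentiableAt_of_contDiffOn (hΩ : IsOpen Ω) (hf : ContDiffOn ℝ ∞ f Ω) (hy : y ∈ Ω) :
    DifferentiableAt ℝ f y :=
  (hf.contDiffAt (hΩ.mem_nhds hy)).differentiableAt (by simp)

lemma pd_comm (hΩ : IsOpen Ω) (hf : ContDiffOn ℝ ∞ f Ω) (hy : y ∈ Ω) (i j : Fin 4) :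
    pd i (pd j f) y = pd j (pd i f) y := by
  have h : ∀ i j, pd i (pd j f) y = fderiv ℝ (fderiv ℝ f) y (EuclideanSpace.single i 1)
      (EuclideanSpace.single j 1) := fun i j => by
    have hd : DifferentiableAt ℝ (fderiv ℝ f) y :=
      ((hf.fderiv_of_isOpen hΩ (m := ∞) (by simp)).contDiffAt (hΩ.mem_nhds hy)).differentiableAt
        (by simp)
    change fderiv ℝ (fun z => fderiv ℝ f z (EuclideanSpace.single j 1)) y _ = _
    rw [fderiv_clm_apply hd (differentiableAt_const _)]
    simp
  rw [h, h]
  exact ((hf.contDiffAt (hΩ.mem_nhds hy)).isSymmSndFDerivAt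
    (by rw [minSmoothness_of_isRCLikeNormedField]; exact WithTop.coe_le_coe.mpr (le_top (a := (2 : ℕ∞))))).eq _ _

lemma contDiffOn_det {M : E4 → Matrix (Fin 4) (Fin 4) ℝ}
    (hM : ∀ a b, ContDiffOn ℝ ∞ (fun y => M y a b) Ω) : ContDiffOn ℝ ∞ (fun y => (M y).det) Ω := by
  simp only [Matrix.det_apply]
  exact ContDiffOn.sum fun σ _ => (contDiffOn_prod fun i _ => hM _ _).const_smul _

/-- Jacobi's formula. -/
lemma pd_det {M : E4 → Matrix (Fin 4) (Fin 4) ℝ}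
    (hM : ∀ a b, DifferentiableAt ℝ (fun z => M z a b) y) (i : Fin 4) :
    pd i (fun z => (M z).det) y
      = ((M y).adjugate * Matrix.of fun a b => pd i (fun z => M z a b) y).trace := by
  set D : Matrix (Fin 4) (Fin 4) ℝ := Matrix.of fun a b => pd i (fun z => M z a b) y with hD
  have h1 : ((M y).adjugate * D).trace = ∑ k, ((M y).updateCol k (D.col k)).det := by
    refine Finset.sum_congr rfl fun k _ => ?_
    rw [← Matrix.cramer_apply, Matrix.cramer_eq_adjugate_mulVec]
    rfl
  have hp : ∀ σ : Equiv.Perm (Fin 4), DifferentiableAt ℝ (fun z => ∏ k, M z (σ k) k) y :=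
    fun σ => (HasFDerivAt.finsetProd fun k _ => (hM _ _).hasFDerivAt).differentiableAt
  simp only [h1, Matrix.det_apply']
  rw [pd_sum _ fun σ => (differentiableAt_const _).fun_mul (hp σ), Finset.sum_comm]
  refine Finset.sum_congr rfl fun σ _ => ?_
  rw [pd_const_mul (hp σ), ← Finset.mul_sum]
  congr 1
  rw [pd, fderiv_finsetProd fun k _ => hM _ _]
  simp only [sum_apply, smul_apply, smul_eq_mul]
  refine Finset.sum_congr rfl fun k _ => ?_
  rw [← Finset.prod_erase_mul _ _ (Finset.mem_univ k)]
  congr 1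
  · refine Finset.prod_congr rfl fun j hj => ?_
    rw [Matrix.updateCol_ne (Finset.ne_of_mem_erase hj)]
  · rw [Matrix.updateCol_self]; rfl

lemma pd_sqrt_abs (hf : DifferentiableAt ℝ f y) (h0 : f y ≠ 0) (i : Fin 4) :
    pd i (fun z => √|f z|) y = √|f y| * (pd i f y / (2 * f y)) := by
  have key : ∀ k : E4 → ℝ, DifferentiableAt ℝ k y → 0 < k y →
      pd i (fun z => √|k z|) y = √|k y| * (pd i k y / (2 * k y)) := by
    intro k hk hpos
    have he : (fun z => √|k z|) =ᶠ[nhds y] fun z => √(k z) := by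
      filter_upwards [hk.continuousAt.eventually (lt_mem_nhds hpos)] with z hz
      rw [abs_of_pos hz]
    rw [pd, he.fderiv_eq, (hk.hasFDerivAt.sqrt hpos.ne').fderiv, abs_of_pos hpos]
    simp only [smul_apply, smul_eq_mul, pd]
    have hs : √(k y) ≠ 0 := (Real.sqrt_pos.mpr hpos).ne'
    have hss : √(k y) * √(k y) = k y := Real.mul_self_sqrt hpos.le
    field_simp
    rw [sq, hss, mul_comm]
  rcases lt_or_gt_of_ne h0 with h | h
  · have h1 := key (fun z => -f z) hf.neg (by linarith)
    simp only [abs_neg] at h1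
    rw [h1]
    have : pd i (fun z => -f z) y = -pd i f y := by
      have := pd_const_mul hf i (-1)
      simpa using this
    rw [this, mul_neg, neg_div_neg_eq]
  · exact key f hf h

end Calculus

/-- The components of a smooth metric on an open set of coordinates. -/
structure LocalMetric (Ω : Set E4) (g : MetricComp) : Prop where
  isOpen : IsOpen Ω
  smooth : ∀ a b, ContDiffOn ℝ ∞ (fun y => g y a b) Ω
  symm : ∀ y ∈ Ω, ∀ a b, g y a b = g y b a
  det_ne_zero : ∀ y ∈ Ω, (g y).det ≠ 0

namespace LocalMetric

variable {Ω : Set E4} {g : MetricComp} {y : E4}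

lemma mul_inv (hg : LocalMetric Ω g) (hy : y ∈ Ω) : g y * (g y)⁻¹ = 1 :=
  Matrix.mul_nonsing_inv _ (hg.det_ne_zero y hy).isUnit

lemma inv_mul (hg : LocalMetric Ω g) (hy : y ∈ Ω) : (g y)⁻¹ * g y = 1 :=
  Matrix.nonsing_inv_mul _ (hg.det_ne_zero y hy).isUnit

lemma transpose_eq (hg : LocalMetric Ω g) (hy : y ∈ Ω) : (g y).transpose = g y := by
  ext a b; exact hg.symm y hy b a

lemma transpose_inv (hg : LocalMetric Ω g) (hy : y ∈ Ω) : (g y)⁻¹.transpose = (g y)⁻¹ := by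
  rw [Matrix.transpose_nonsing_inv, hg.transpose_eq hy]

lemma ginv_symm (hg : LocalMetric Ω g) (hy : y ∈ Ω) (a b : Fin 4) :
    ginv g y a b = ginv g y b a := by
  conv_lhs => rw [ginv, ← hg.transpose_inv hy]
  rfl

lemma contDiffOn_ginv (hg : LocalMetric Ω g) (a b : Fin 4) :
    ContDiffOn ℝ ∞ (fun z => ginv g z a b) Ω := by
  have h : (fun z => ginv g z a b) = fun z => ((g z).det)⁻¹ * (g z).adjugate a b := by
    funext z
    simp [ginv, Matrix.inv_def]
  rw [h]
  refine (ContDiffOn.inv (contDiffOn_det hg.smooth) hg.det_ne_zero).mul ?_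
  simp only [Matrix.adjugate_apply]
  refine contDiffOn_det fun c d => ?_
  simp only [Matrix.updateRow_apply]
  split_ifs
  · exact contDiffOn_const
  · exact hg.smooth _ _

lemma contDiffOn_christoffel (hg : LocalMetric Ω g) (a b c : Fin 4) :
    ContDiffOn ℝ ∞ (christoffel g a b c) Ω := by
  have h := fun i j k => contDiffOn_pd hg.isOpen (hg.smooth j k) i
  unfold christoffel
  exact contDiffOn_const.mul (ContDiffOn.sum fun d _ => (hg.contDiffOn_ginv a d).mul
    (((h b d c).add (h c d b)).sub (h d b c)))

lemma pd_metric_symm (hg : LocalMetric Ω g) (hy : y ∈ Ω) (i a b : Fin 4) :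
    pd i (fun z => g z a b) y = pd i (fun z => g z b a) y :=
  pd_congr hg.isOpen hy (fun z hz => hg.symm z hz a b) i

/-- Lowering the first index of a Christoffel symbol. -/
lemma sum_metric_mul_christoffel (hg : LocalMetric Ω g) (hy : y ∈ Ω) (e b c : Fin 4) :
    ∑ a, g y e a * christoffel g a b c y = (1 / 2) *
      (pd b (fun z => g z e c) y + pd c (fun z => g z e b) y - pd e (fun z => g z b c) y) := by
  have h : ∀ X : Fin 4 → ℝ, ∑ a, g y e a * ((1 / 2) * ∑ d, ginv g y a d * X d)
      = (1 / 2) * X e := fun X => by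
    have h1 : (g y).mulVec ((g y)⁻¹.mulVec X) e = X e := by
      rw [Matrix.mulVec_mulVec, hg.mul_inv hy, Matrix.one_mulVec]
    rw [← h1]
    simp only [Matrix.mulVec, dotProduct, ginv, Finset.mul_sum]
    exact Finset.sum_congr rfl fun _ _ => Finset.sum_congr rfl fun _ _ => by ring
  exact h _

/-- The connection matrix `(Γ_c)^a_b = Γ^a_{cb}`. -/
def connMatrix (g : MetricComp) (c : Fin 4) (y : E4) : Matrix (Fin 4) (Fin 4) ℝ :=
  Matrix.of fun a b => christoffel g a c b y

/-- The metric is parallel. -/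
lemma pd_metric (hg : LocalMetric Ω g) (hy : y ∈ Ω) (c : Fin 4) :
    (Matrix.of fun a b => pd c (fun z => g z a b) y)
      = g y * connMatrix g c y + (connMatrix g c y).transpose * g y := by
  ext a b
  have h1 := hg.sum_metric_mul_christoffel hy a c b
  have h2 := hg.sum_metric_mul_christoffel hy b c a
  have h3 : ((connMatrix g c y).transpose * g y) a b
      = ∑ x, g y b x * christoffel g x c a y := by
    simp only [Matrix.mul_apply, Matrix.transpose_apply, connMatrix, Matrix.of_apply]
    exact Finset.sum_congr rfl fun x _ => by rw [hg.symm y hy x b, mul_comm]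
  rw [Matrix.add_apply, h3, h2]
  simp only [Matrix.mul_apply, connMatrix, Matrix.of_apply, h1]
  rw [hg.pd_metric_symm hy c b a, hg.pd_metric_symm hy a b c, hg.pd_metric_symm hy b a c]
  rw [hg.pd_metric_symm hy a c b, hg.pd_metric_symm hy b c a]
  ring

/-- The inverse metric is parallel. -/
lemma pd_ginv (hg : LocalMetric Ω g) (hy : y ∈ Ω) (c : Fin 4) :
    (Matrix.of fun a b => pd c (fun z => ginv g z a b) y)
      = -(connMatrix g c y * (g y)⁻¹ + (g y)⁻¹ * (connMatrix g c y).transpose) := by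
  set dG : Matrix (Fin 4) (Fin 4) ℝ := Matrix.of fun a b => pd c (fun z => g z a b) y with hdG
  set dH : Matrix (Fin 4) (Fin 4) ℝ := Matrix.of fun a b => pd c (fun z => ginv g z a b) y with hdH
  have hd := fun a b => differentiableAt_of_contDiffOn hg.isOpen (hg.smooth a b) hy
  have hd' := fun a b => differentiableAt_of_contDiffOn hg.isOpen (hg.contDiffOn_ginv a b) hy
  -- Obtained by differentiating `g g⁻¹ = 1`, valid on all of the open set `Ω`.
  have h : dG * (g y)⁻¹ + g y * dH = 0 := by
    ext a b
    have e1 : pd c (fun z => ∑ k, g z a k * ginv g z k b) y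
        = pd c (fun _ => (1 : Matrix (Fin 4) (Fin 4) ℝ) a b) y :=
      pd_congr hg.isOpen hy (fun z hz => by rw [← hg.mul_inv hz, Matrix.mul_apply]; rfl) c
    rw [pd_const, pd_sum _ fun k => (hd a k).fun_mul (hd' k b)] at e1
    simp only [pd_mul (hd _ _) (hd' _ _), Finset.sum_add_distrib] at e1
    exact e1
  have h2 : dH = -((g y)⁻¹ * dG * (g y)⁻¹) := by
    have := congrArg (fun X => (g y)⁻¹ * X) h
    simp only [Matrix.mul_add, ← Matrix.mul_assoc, hg.inv_mul hy, Matrix.one_mul,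
      Matrix.mul_zero] at this
    exact eq_neg_of_add_eq_zero_right this
  rw [h2, hdG, hg.pd_metric hy, Matrix.mul_add, Matrix.add_mul, ← Matrix.mul_assoc,
    hg.inv_mul hy, Matrix.one_mul, Matrix.mul_assoc ((g y)⁻¹), Matrix.mul_assoc _ (g y),
    hg.mul_inv hy, Matrix.mul_one]

/-- The volume density is parallel. -/
lemma pd_sqrt_det (hg : LocalMetric Ω g) (hy : y ∈ Ω) (c : Fin 4) :
    pd c (fun z => √|(g z).det|) y = √|(g y).det| * (connMatrix g c y).trace := by
  have hd := fun a b => differentiableAt_of_contDiffOn hg.isOpen (hg.smooth a b) hy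
  have h0 := hg.det_ne_zero y hy
  rw [pd_sqrt_abs (differentiableAt_of_contDiffOn hg.isOpen (contDiffOn_det hg.smooth) hy) h0,
    pd_det hd]
  congr 1
  have h1 : (g y).adjugate = (g y).det • (g y)⁻¹ := by
    rw [Matrix.inv_def, smul_smul, Ring.inverse_eq_inv', mul_inv_cancel₀ h0, one_smul]
  -- The two connection terms in the derivative of `g` have the same trace after multiplication by
  -- `g⁻¹`; the resulting `2` cancels the one from the square root.
  have h2 : ((g y)⁻¹ * ((connMatrix g c y).transpose * g y)).trace = (connMatrix g c y).trace := by
    rw [← Matrix.mul_assoc, Matrix.trace_mul_comm, ← Matrix.mul_assoc, hg.mul_inv hy,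
      Matrix.one_mul, Matrix.trace_transpose]
  rw [hg.pd_metric hy, h1, Matrix.smul_mul, Matrix.trace_smul, Matrix.mul_add,
    Matrix.trace_add, h2, ← Matrix.mul_assoc, hg.inv_mul hy, Matrix.one_mul, smul_eq_mul]
  field_simp
  ring

end LocalMetric

end

/-! ### Covariant differentiation as matrix algebra on index pairs. -/

section

open scoped Kronecker

section PairMatrix

/-- A tensor of rank four as a matrix whose rows and columns are indexed by pairs of indices. -/
def pairMatrix {K : Type*} (T : Fin 4 → Fin 4 → Fin 4 → Fin 4 → K) :
    Matrix (Fin 4 × Fin 4) (Fin 4 × Fin 4) K :=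
  Matrix.of fun x y => T x.1 x.2 y.1 y.2

/-- The entrywise partial derivative of a matrix-valued function. -/
def pdMatrix {n : Type*} (c : Fin 4) (M : E4 → Matrix n n ℝ) (y : E4) : Matrix n n ℝ :=
  Matrix.of fun a b => pd c (fun z => M z a b) y

variable {n : Type*} [Fintype n] {y : E4} {M N : E4 → Matrix n n ℝ}

lemma differentiableAt_matrix_mul (hM : ∀ a b, DifferentiableAt ℝ (fun z => M z a b) y)
    (hN : ∀ a b, DifferentiableAt ℝ (fun z => N z a b) y) (a b : n) :
    DifferentiableAt ℝ (fun z => (M z * N z) a b) y := by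
  simp only [Matrix.mul_apply]
  exact DifferentiableAt.fun_sum fun k _ => (hM a k).fun_mul (hN k b)

lemma pdMatrix_mul (hM : ∀ a b, DifferentiableAt ℝ (fun z => M z a b) y)
    (hN : ∀ a b, DifferentiableAt ℝ (fun z => N z a b) y) (c : Fin 4) :
    pdMatrix c (fun z => M z * N z) y = pdMatrix c M y * N y + M y * pdMatrix c N y := by
  ext a b
  simp only [pdMatrix, Matrix.of_apply, Matrix.add_apply, Matrix.mul_apply]
  rw [pd_sum _ fun k => (hM a k).fun_mul (hN k b), ← Finset.sum_add_distrib]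
  exact Finset.sum_congr rfl fun k _ => pd_mul (hM a k) (hN k b) c

lemma pd_trace (hM : ∀ a b, DifferentiableAt ℝ (fun z => M z a b) y) (c : Fin 4) :
    pd c (fun z => (M z).trace) y = (pdMatrix c M y).trace := by
  simp only [Matrix.trace, Matrix.diag]
  rw [pd_sum _ fun k => hM k k]
  rfl

/-- Replacing one row of a selection matrix by a basis row produces an entry of the adjugate, so the
left side is `tr (P N adj P) = tr N · det P`: the infinitesimal form of the determinant rule. -/
lemma sum_permSymbol_derivation (N : Matrix (Fin 4) (Fin 4) ℝ) (a b c d : Fin 4) :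
    ∑ m, N a m * permSymbol m b c d + ∑ m, N b m * permSymbol a m c d
      + ∑ m, N c m * permSymbol a b m d + ∑ m, N d m * permSymbol a b c m
      = N.trace * permSymbol a b c d := by
  have key : ∀ J : Fin 4 → Fin 4, ∑ k, ∑ m, N (J k) m
      * ((1 : Matrix (Fin 4) (Fin 4) ℝ).submatrix (Function.update J k m) id).det
      = N.trace * ((1 : Matrix (Fin 4) (Fin 4) ℝ).submatrix J id).det := by
    intro J
    set P : Matrix (Fin 4) (Fin 4) ℝ := (1 : Matrix (Fin 4) (Fin 4) ℝ).submatrix J id with hP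
    have e1 : ∀ k m, ((1 : Matrix (Fin 4) (Fin 4) ℝ).submatrix (Function.update J k m) id).det
        = P.adjugate m k := fun k m => by
      rw [Matrix.adjugate_apply]
      congr 1
      ext r s
      by_cases h : r = k
      · subst h; simp [Matrix.one_apply, Pi.single_apply, eq_comm]
      · rw [Matrix.updateRow_ne h]
        change (1 : Matrix (Fin 4) (Fin 4) ℝ) (Function.update J k m r) s = (1 : Matrix _ _ ℝ) (J r) s
        rw [Function.update_of_ne h]
    have e2 : ∀ k m, N (J k) m = (P * N) k m := fun k m => by
      simp [hP, Matrix.mul_apply, Matrix.one_apply]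
    simp only [e1, e2]
    change (P * N * P.adjugate).trace = _
    rw [Matrix.trace_mul_comm, ← Matrix.mul_assoc, Matrix.adjugate_mul, Matrix.smul_mul,
      Matrix.one_mul, Matrix.trace_smul, smul_eq_mul, mul_comm]
  have h1 := key ![a, b, c, d]
  simp only [Fin.sum_univ_four] at h1
  have u0 : ∀ m, Function.update ![a, b, c, d] 0 m = ![m, b, c, d] := fun m => by
    ext r; fin_cases r <;> rfl
  have u1 : ∀ m, Function.update ![a, b, c, d] 1 m = ![a, m, c, d] := fun m => by
    ext r; fin_cases r <;> rfl
  have u2 : ∀ m, Function.update ![a, b, c, d] 2 m = ![a, b, m, d] := fun m => by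
    ext r; fin_cases r <;> rfl
  have u3 : ∀ m, Function.update ![a, b, c, d] 3 m = ![a, b, c, m] := fun m => by
    ext r; fin_cases r <;> rfl
  simp only [u0, u1, u2, u3] at h1
  simp only [Fin.sum_univ_four, permSymbol]
  exact h1

end PairMatrix

namespace LocalMetric

variable {Ω : Set E4} {g : MetricComp} {y : E4}

/-- The connection acting on pairs of indices. -/
def pairConn (g : MetricComp) (c : Fin 4) (y : E4) :
    Matrix (Fin 4 × Fin 4) (Fin 4 × Fin 4) ℝ :=
  connMatrix g c y ⊗ₖ 1 + 1 ⊗ₖ connMatrix g c y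

/-- The inverse metric acting on pairs of indices. -/
def pairInv (g : MetricComp) (y : E4) : Matrix (Fin 4 × Fin 4) (Fin 4 × Fin 4) ℝ :=
  (g y)⁻¹ ⊗ₖ (g y)⁻¹

/-- The volume form acting on pairs of indices. -/
def pairVol (g : MetricComp) (y : E4) : Matrix (Fin 4 × Fin 4) (Fin 4 × Fin 4) ℝ :=
  pairMatrix (volForm g y)

lemma differentiableAt_ginv (hg : LocalMetric Ω g) (hy : y ∈ Ω) (a b : Fin 4) :
    DifferentiableAt ℝ (fun z => (g z)⁻¹ a b) y :=
  differentiableAt_of_contDiffOn hg.isOpen (hg.contDiffOn_ginv a b) hy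

lemma differentiableAt_pairInv (hg : LocalMetric Ω g) (hy : y ∈ Ω) (a b) :
    DifferentiableAt ℝ (fun z => pairInv g z a b) y :=
  (hg.differentiableAt_ginv hy _ _).fun_mul (hg.differentiableAt_ginv hy _ _)

lemma differentiableAt_sqrt_det (hg : LocalMetric Ω g) (hy : y ∈ Ω) :
    DifferentiableAt ℝ (fun z => √|(g z).det|) y :=
  ((differentiableAt_of_contDiffOn hg.isOpen (contDiffOn_det hg.smooth) hy).abs
    (hg.det_ne_zero y hy)).sqrt (abs_pos.mpr (hg.det_ne_zero y hy)).ne'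

lemma differentiableAt_pairVol (hg : LocalMetric Ω g) (hy : y ∈ Ω) (a b) :
    DifferentiableAt ℝ (fun z => pairVol g z a b) y :=
  (hg.differentiableAt_sqrt_det hy).mul_const _

lemma pdMatrix_pairInv (hg : LocalMetric Ω g) (hy : y ∈ Ω) (c : Fin 4) :
    pdMatrix c (pairInv g) y
      = -(pairConn g c y * pairInv g y + pairInv g y * (pairConn g c y).transpose) := by
  have h1 : pdMatrix c (pairInv g) y
      = pdMatrix c (fun z => (g z)⁻¹) y ⊗ₖ (g y)⁻¹ + (g y)⁻¹ ⊗ₖ pdMatrix c (fun z => (g z)⁻¹) y := by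
    ext a b
    exact pd_mul (hg.differentiableAt_ginv hy _ _) (hg.differentiableAt_ginv hy _ _) c
  have h2 : pdMatrix c (fun z => (g z)⁻¹) y = _ := hg.pd_ginv hy c
  rw [h1, h2, pairConn, pairInv]
  have n1 : ∀ A C : Matrix (Fin 4) (Fin 4) ℝ, (-A) ⊗ₖ C = -(A ⊗ₖ C) := fun A C => by
    ext; simp [Matrix.kroneckerMap_apply]
  have n2 : ∀ A C : Matrix (Fin 4) (Fin 4) ℝ, A ⊗ₖ (-C) = -(A ⊗ₖ C) := fun A C => by
    ext; simp [Matrix.kroneckerMap_apply]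
  simp only [Matrix.transpose_add, ← Matrix.kroneckerMap_transpose, Matrix.transpose_one,
    Matrix.add_mul, Matrix.mul_add, ← Matrix.mul_kronecker_mul, Matrix.one_mul, Matrix.mul_one,
    n1, n2, Matrix.add_kronecker, Matrix.kronecker_add]
  abel

lemma pairMatrix_mul_pairConn (T : Fin 4 → Fin 4 → Fin 4 → Fin 4 → ℝ) (e a b c d : Fin 4) :
    (pairMatrix T * pairConn g e y) (a, b) (c, d)
      = ∑ f, T a b f d * christoffel g f e c y + ∑ f, T a b c f * christoffel g f e d y := by
  simp [Matrix.mul_apply, pairMatrix, pairConn, Fintype.sum_prod_type, connMatrix,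
    Matrix.one_apply, mul_add, Finset.sum_add_distrib, Matrix.add_apply, Matrix.kroneckerMap_apply]

lemma pairConn_transpose_mul (T : Fin 4 → Fin 4 → Fin 4 → Fin 4 → ℝ) (e a b c d : Fin 4) :
    ((pairConn g e y).transpose * pairMatrix T) (a, b) (c, d)
      = ∑ f, christoffel g f e a y * T f b c d + ∑ f, christoffel g f e b y * T a f c d := by
  simp [Matrix.mul_apply, pairMatrix, pairConn, Fintype.sum_prod_type, connMatrix,
    Matrix.one_apply, add_mul, Finset.sum_add_distrib, Matrix.add_apply, Matrix.kroneckerMap_apply]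

/-- In the form `∂T - Cᵀ T - T C`, Leibniz rules and the cancellation of connection terms become
noncommutative matrix identities. -/
lemma pairMatrix_covDeriv (T : TensorComp) (e : Fin 4) :
    pairMatrix (fun a b c d => covDeriv g T y a b c d e)
      = pdMatrix e (fun z => pairMatrix (T z)) y - (pairConn g e y).transpose * pairMatrix (T y)
        - pairMatrix (T y) * pairConn g e y := by
  ext ⟨a, b⟩ ⟨c, d⟩
  rw [Matrix.sub_apply, Matrix.sub_apply, pairMatrix_mul_pairConn, pairConn_transpose_mul]
  simp only [pairMatrix, pdMatrix, Matrix.of_apply, covDeriv, Finset.sum_add_distrib]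
  simp only [mul_comm (T y _ _ _ _)]
  ring

/-- This says that the volume form is parallel: differentiating its density produces the trace of
the connection, which the derivation identity for the symbol distributes over the four indices. -/
lemma pdMatrix_pairVol (hg : LocalMetric Ω g) (hy : y ∈ Ω) (c : Fin 4) :
    pdMatrix c (pairVol g) y
      = (pairConn g c y).transpose * pairVol g y + pairVol g y * pairConn g c y := by
  ext ⟨i, j⟩ ⟨k, l⟩
  rw [pairVol, Matrix.add_apply, pairMatrix_mul_pairConn, pairConn_transpose_mul]
  have h1 : pdMatrix c (pairVol g) y (i, j) (k, l)
      = √|(g y).det| * (connMatrix g c y).trace * permSymbol i j k l := by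
    rw [← hg.pd_sqrt_det hy c]
    have := pd_mul (hg.differentiableAt_sqrt_det hy) (differentiableAt_const (permSymbol i j k l)) c
    rw [pd_const, mul_zero, add_zero] at this
    exact this
  have h2 := sum_permSymbol_derivation (connMatrix g c y).transpose i j k l
  rw [Matrix.trace_transpose] at h2
  rw [h1, mul_assoc, ← h2]
  simp only [volForm, connMatrix, Matrix.transpose_apply, Matrix.of_apply, mul_add, Finset.mul_sum,
    ← add_assoc]
  congr 1; congr 1; congr 1
  all_goals exact Finset.sum_congr rfl fun m _ => by ring

/-- The components of `T` are differentiable at `y`. -/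
def DiffAt (T : TensorComp) (y : E4) : Prop :=
  ∀ a b c d, DifferentiableAt ℝ (fun z => T z a b c d) y

lemma DiffAt.pairMatrix {T : TensorComp} (hT : DiffAt T y) (a b) :
    DifferentiableAt ℝ (fun z => pairMatrix (T z) a b) y := hT _ _ _ _

lemma pairMatrix_hodgeDual (g : MetricComp) (T : TensorComp) (z : E4) :
    pairMatrix (hodgeDual g T z)
      = (1 / 2 : ℝ) • (pairVol g z * pairInv g z * pairMatrix (T z)) := by
  ext ⟨a, b⟩ ⟨c, d⟩
  simp only [pairMatrix, hodgeDual, pairVol, pairInv, Matrix.smul_apply, Matrix.mul_apply,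
    Matrix.of_apply, Matrix.kroneckerMap_apply, Fintype.sum_prod_type, smul_eq_mul, ginv,
    Finset.sum_mul]
  congr 1
  rw [sum_swap_pairs_four]
  exact Finset.sum_congr rfl fun _ _ => Finset.sum_congr rfl fun _ _ =>
    Finset.sum_congr rfl fun _ _ => Finset.sum_congr rfl fun _ _ => by ring

/-- The Hodge dual commutes with covariant differentiation. -/
lemma covDeriv_hodgeDual (hg : LocalMetric Ω g) (hy : y ∈ Ω) {T : TensorComp} (hT : DiffAt T y)
    (a b c d e : Fin 4) :
    covDeriv g (hodgeDual g T) y a b c d e = (1 / 2) * ∑ f, ∑ k, ∑ p, ∑ q,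
      volForm g y a b f k * ginv g y f p * ginv g y k q * covDeriv g T y p q c d e := by
  have hV := hg.differentiableAt_pairVol hy
  have hI := hg.differentiableAt_pairInv hy
  have hVI := differentiableAt_matrix_mul hV hI
  have hd : pdMatrix e (fun z => pairMatrix (hodgeDual g T z)) y
      = (1 / 2 : ℝ) • pdMatrix e (fun z => pairVol g z * pairInv g z * pairMatrix (T z)) y := by
    ext i j
    simp only [pairMatrix_hodgeDual]
    exact pd_const_mul (differentiableAt_matrix_mul hVI hT.pairMatrix i j) e (1 / 2)
  have h : pairMatrix (fun a b c d => covDeriv g (hodgeDual g T) y a b c d e)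
      = (1 / 2 : ℝ) • (pairVol g y * pairInv g y
        * pairMatrix (fun a b c d => covDeriv g T y a b c d e)) := by
    rw [pairMatrix_covDeriv, pairMatrix_covDeriv, hd, pairMatrix_hodgeDual,
      pdMatrix_mul hVI hT.pairMatrix, pdMatrix_mul hV hI]
    -- With volume form and inverse metric parallel, every connection term next to them cancels and
    -- only the derivative of `T` remains.
    rw [hg.pdMatrix_pairInv hy, hg.pdMatrix_pairVol hy]
    simp only [Matrix.mul_smul, Matrix.smul_mul, ← smul_sub]
    congr 1
    simp only [Matrix.mul_add, Matrix.add_mul, Matrix.mul_sub, Matrix.mul_neg, Matrix.neg_mul,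
      Matrix.mul_assoc]
    abel
  have h' := congrFun (congrFun h (a, b)) (c, d)
  have h2 := pairMatrix_hodgeDual g (fun _ a b c d => covDeriv g T y a b c d e) y
  rw [← h2] at h'
  exact h'

/-- The full contraction of two tensors of rank four, with indices raised by `h`. -/
def contr4 {K : Type*} [CommRing K] (h : Matrix (Fin 4) (Fin 4) K)
    (S T : Fin 4 → Fin 4 → Fin 4 → Fin 4 → K) : K :=
  ∑ a, ∑ b, ∑ c, ∑ d, S a b c d
    * ∑ p, ∑ q, ∑ r, ∑ s, h a p * h b q * h c r * h d s * T p q r s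

/-- A trace makes the derivative of a contraction accessible to the matrix Leibniz rule and, through
cyclicity, to cancellation. -/
lemma contr4_eq_trace {h : Matrix (Fin 4) (Fin 4) ℝ} (hs : h.transpose = h)
    (S T : Fin 4 → Fin 4 → Fin 4 → Fin 4 → ℝ) :
    contr4 h S T = ((pairMatrix S).transpose
      * ((h ⊗ₖ h) * pairMatrix T * (h ⊗ₖ h))).trace := by
  have hs' : ∀ a b, h a b = h b a := fun a b => by conv_lhs => rw [← hs, Matrix.transpose_apply]
  rw [Matrix.trace_mul_comm, contr4]
  simp only [Matrix.trace, Matrix.diag, Matrix.mul_apply (N := (pairMatrix S).transpose),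
    Fintype.sum_prod_type, Matrix.transpose_apply]
  refine Finset.sum_congr rfl fun a _ => Finset.sum_congr rfl fun b _ =>
    Finset.sum_congr rfl fun c _ => Finset.sum_congr rfl fun d _ => ?_
  rw [mul_comm]
  congr 1
  simp only [Matrix.mul_apply, Fintype.sum_prod_type, Matrix.kroneckerMap_apply, pairMatrix,
    Matrix.of_apply, Finset.sum_mul]
  rw [sum_swap_pairs_four]
  exact Finset.sum_congr rfl fun r _ => Finset.sum_congr rfl fun s _ =>
    Finset.sum_congr rfl fun _ _ => Finset.sum_congr rfl fun _ _ => by rw [hs' c r, hs' d s]; ring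

/-- The gradient of a full contraction. -/
lemma pd_contr (hg : LocalMetric Ω g) (hy : y ∈ Ω) {S T : TensorComp} (hS : DiffAt S y)
    (hT : DiffAt T y) (e : Fin 4) :
    pd e (contr g S T) y
      = contr4 (g y)⁻¹ (fun a b c d => covDeriv g S y a b c d e) (T y)
        + contr4 (g y)⁻¹ (S y) (fun a b c d => covDeriv g T y a b c d e) := by
  have hI := hg.differentiableAt_pairInv hy
  have hIT := differentiableAt_matrix_mul hI hT.pairMatrix
  have hITI := differentiableAt_matrix_mul hIT hI
  have hSt : ∀ a b, DifferentiableAt ℝ (fun z => (pairMatrix (S z)).transpose a b) y :=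
    fun a b => hS.pairMatrix b a
  have h1 : pd e (contr g S T) y = pd e (fun z => ((pairMatrix (S z)).transpose
      * (pairInv g z * pairMatrix (T z) * pairInv g z)).trace) y :=
    pd_congr hg.isOpen hy (fun z hz => contr4_eq_trace (hg.transpose_inv hz) (S z) (T z)) e
  rw [h1, pd_trace (differentiableAt_matrix_mul hSt hITI), pdMatrix_mul hSt hITI,
    pdMatrix_mul hIT hI, pdMatrix_mul hI hT.pairMatrix,
    contr4_eq_trace (hg.transpose_inv hy), contr4_eq_trace (hg.transpose_inv hy),
    pairMatrix_covDeriv, pairMatrix_covDeriv]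
  change (_ * _ + _ * ((pdMatrix e (pairInv g) y * _ + _) * _
    + _ * pdMatrix e (pairInv g) y)).trace = _
  have h2 : pdMatrix e (fun z => (pairMatrix (S z)).transpose) y
      = (pdMatrix e (fun z => pairMatrix (S z)) y).transpose := rfl
  rw [hg.pdMatrix_pairInv hy, h2, ← pairInv]
  set H := pairInv g y
  set C := pairConn g e y
  set s := pairMatrix (S y)
  set t := pairMatrix (T y)
  have t1 : (C.transpose * (s.transpose * (H * (t * H)))).trace
      = (s.transpose * (H * (t * (H * C.transpose)))).trace := by
    rw [Matrix.trace_mul_comm]; simp only [Matrix.mul_assoc]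
  simp only [Matrix.transpose_sub, Matrix.transpose_mul, Matrix.transpose_transpose,
    Matrix.mul_add, Matrix.add_mul, Matrix.mul_sub, Matrix.sub_mul, Matrix.mul_neg, Matrix.neg_mul,
    Matrix.mul_assoc, Matrix.trace_add, Matrix.trace_sub, Matrix.trace_neg, t1, neg_add]
  ring

/-- Covariant differentiation preserves the symmetries of the Weyl tensor. -/
lemma weylSymm_covDeriv (hg : LocalMetric Ω g) (hy : y ∈ Ω) {W : TensorComp} (hW : DiffAt W y)
    (hs : ∀ z ∈ Ω, WeylSymm (g z)⁻¹ (W z)) (e : Fin 4) :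
    WeylSymm (g y)⁻¹ (fun a b c d => covDeriv g W y a b c d e) where
  antisymm_left a b c d := by
    have h1 : pd e (fun z => W z b a c d) y = -pd e (fun z => W z a b c d) y := by
      rw [← neg_one_mul, ← pd_const_mul (hW a b c d)]
      exact pd_congr hg.isOpen hy (fun z hz => by rw [(hs z hz).antisymm_left]; ring) e
    have h2 := (hs y hy).antisymm_left
    have h3 : ∀ x p q : ℝ, p = -q → -x - p = -(x - q) := fun x p q h => by rw [h]; ring
    rw [covDeriv, covDeriv, h1]
    refine h3 _ _ _ ?_
    rw [← Finset.sum_neg_distrib]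
    exact Finset.sum_congr rfl fun f _ => by
      linear_combination christoffel g f e b y * h2 a f c d + christoffel g f e a y * h2 f b c d
        + christoffel g f e c y * h2 a b f d + christoffel g f e d y * h2 a b c f
  antisymm_right a b c d := by
    have h1 : pd e (fun z => W z a b d c) y = -pd e (fun z => W z a b c d) y := by
      rw [← neg_one_mul, ← pd_const_mul (hW a b c d)]
      exact pd_congr hg.isOpen hy (fun z hz => by rw [(hs z hz).antisymm_right]; ring) e
    have h2 := (hs y hy).antisymm_right
    have h3 : ∀ x p q : ℝ, p = -q → -x - p = -(x - q) := fun x p q h => by rw [h]; ring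
    rw [covDeriv, covDeriv, h1]
    refine h3 _ _ _ ?_
    rw [← Finset.sum_neg_distrib]
    exact Finset.sum_congr rfl fun f _ => by
      linear_combination christoffel g f e a y * h2 f b c d + christoffel g f e b y * h2 a f c d
        + christoffel g f e d y * h2 a b c f + christoffel g f e c y * h2 a b f d
  pair_symm a b c d := by
    have h2 := (hs y hy).pair_symm
    rw [covDeriv, covDeriv, pd_congr hg.isOpen hy (fun z hz => (hs z hz).pair_symm a b c d) e]
    congr 1
    exact Finset.sum_congr rfl fun f _ => by
      linear_combination christoffel g f e a y * h2 f b c d + christoffel g f e b y * h2 a f c d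
        + christoffel g f e d y * h2 a b c f + christoffel g f e c y * h2 a b f d
  bianchi a b c d := by
    have h1 := pd_congr hg.isOpen hy (fun z hz => (hs z hz).bianchi a b c d) e
    rw [pd_const, pd_add ((hW _ _ _ _).fun_add (hW _ _ _ _)) (hW _ _ _ _),
      pd_add (hW _ _ _ _) (hW _ _ _ _)] at h1
    have h2 := (hs y hy).bianchi
    have h3 : ∀ f, (christoffel g f e a y * W y f b c d + christoffel g f e b y * W y a f c d
        + christoffel g f e c y * W y a b f d + christoffel g f e d y * W y a b c f)
      + (christoffel g f e a y * W y f c d b + christoffel g f e c y * W y a f d b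
        + christoffel g f e d y * W y a c f b + christoffel g f e b y * W y a c d f)
      + (christoffel g f e a y * W y f d b c + christoffel g f e d y * W y a f b c
        + christoffel g f e b y * W y a d f c + christoffel g f e c y * W y a d b f) = 0 :=
      fun f => by
        linear_combination christoffel g f e a y * h2 f b c d + christoffel g f e b y * h2 a f c d
          + christoffel g f e d y * h2 a b c f + christoffel g f e c y * h2 a b f d
    have h4 := Finset.sum_congr (rfl : (Finset.univ : Finset (Fin 4)) = _) fun f _ => h3 f
    rw [Finset.sum_add_distrib, Finset.sum_add_distrib, Finset.sum_const_zero] at h4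
    rw [covDeriv, covDeriv, covDeriv]
    linear_combination h1 - h4
  trace_free b d := by
    set M : E4 → Matrix (Fin 4) (Fin 4) ℝ := fun z => Matrix.of fun a c => W z a b c d with hM
    set C := connMatrix g e y
    have tr : ∀ X : Matrix (Fin 4) (Fin 4) ℝ, ∑ a, ∑ c, (g y)⁻¹ a c * X a c
        = ((g y)⁻¹ * X.transpose).trace := fun X => by
      simp [Matrix.trace, Matrix.mul_apply]
    have dM : ∀ a c, DifferentiableAt ℝ (fun z => (M z).transpose a c) y := fun a c => hW _ _ _ _
    have h1 : pd e (fun z => ((g z)⁻¹ * (M z).transpose).trace) y = 0 := by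
      rw [← pd_const (y := y) e 0]
      refine pd_congr hg.isOpen hy (fun z hz => ?_) e
      rw [← (hs z hz).trace_free b d]
      simp [Matrix.trace, Matrix.mul_apply, hM]
    have hI := hg.differentiableAt_ginv hy
    rw [pd_trace (differentiableAt_matrix_mul hI dM), pdMatrix_mul hI dM] at h1
    have h2 : pdMatrix e (fun z => (g z)⁻¹) y = _ := hg.pd_ginv hy e
    rw [h2, Matrix.trace_add] at h1
    have z0 := (hs y hy).trace_free
    -- Connection terms on the free indices `b` and `d` are again traces of `W` and vanish. Those on
    -- the contracted indices are absorbed by the derivative of the inverse metric.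
    have split : ∑ a, ∑ c, (g y)⁻¹ a c * covDeriv g W y a b c d e
        = ∑ a, ∑ c, (g y)⁻¹ a c * (pdMatrix e M y - C.transpose * M y - M y * C) a c
          - ∑ f, christoffel g f e b y * ∑ a, ∑ c, (g y)⁻¹ a c * W y a f c d
          - ∑ f, christoffel g f e d y * ∑ a, ∑ c, (g y)⁻¹ a c * W y a b c f := by
      have r : ∀ (k : Fin 4 → ℝ) (X : Fin 4 → Fin 4 → Fin 4 → ℝ),
          ∑ f, k f * ∑ a, ∑ c, (g y)⁻¹ a c * X f a c
            = ∑ a, ∑ c, (g y)⁻¹ a c * ∑ f, k f * X f a c := fun k X => by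
        simp only [Finset.mul_sum]
        rw [Finset.sum_comm]
        refine Finset.sum_congr rfl fun a _ => ?_
        rw [Finset.sum_comm]
        exact Finset.sum_congr rfl fun c _ => Finset.sum_congr rfl fun f _ => by ring
      rw [r _ fun f a c => W y a f c d, r _ fun f a c => W y a b c f]
      simp only [← Finset.sum_sub_distrib, ← mul_sub]
      refine Finset.sum_congr rfl fun a _ => Finset.sum_congr rfl fun c _ => ?_
      congr 1
      simp only [covDeriv, Matrix.sub_apply, Matrix.mul_apply, Matrix.transpose_apply, pdMatrix, hM,
        Matrix.of_apply, C, connMatrix, Finset.sum_add_distrib]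
      rw [Finset.sum_congr rfl fun f _ => mul_comm (W y a b f d) _]
      ring
    rw [split, tr]
    simp only [z0, mul_zero, Finset.sum_const_zero, sub_zero]
    have h3 : pdMatrix e (fun z => (M z).transpose) y = (pdMatrix e M y).transpose := rfl
    rw [h3] at h1
    have t1 : ((g y)⁻¹ * ((M y).transpose * C)).trace = (C * ((g y)⁻¹ * (M y).transpose)).trace := by
      rw [← Matrix.mul_assoc, Matrix.trace_mul_comm]
    simp only [Matrix.transpose_sub, Matrix.transpose_mul, Matrix.transpose_transpose,
      Matrix.mul_sub, Matrix.trace_sub, t1]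
    simp only [Matrix.neg_mul, Matrix.add_mul, Matrix.trace_neg, Matrix.trace_add,
      Matrix.mul_assoc] at h1
    linear_combination h1

end LocalMetric

end

/-! ### Conformal change of the connection. -/

section

/-- The conformally changed metric `e^{2u} g`. -/
def confMetric (u : E4 → ℝ) (g : MetricComp) : MetricComp := fun z => Real.exp (2 * u z) • g z

/-- The gradient of a function, as a covector. -/
def grad (u : E4 → ℝ) (y : E4) (a : Fin 4) : ℝ := pd a u y

namespace LocalMetric

variable {Ω : Set E4} {g : MetricComp} {u : E4 → ℝ} {y : E4}

lemma conf (hg : LocalMetric Ω g) (hu : ContDiffOn ℝ ∞ u Ω) : LocalMetric Ω (confMetric u g) where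
  isOpen := hg.isOpen
  smooth a b := (contDiffOn_const.mul hu).exp.mul (hg.smooth a b)
  symm y hy a b := by
    simp only [confMetric, Matrix.smul_apply]
    rw [hg.symm y hy a b]
  det_ne_zero y hy := by
    rw [confMetric, Matrix.det_smul]
    exact mul_ne_zero (pow_ne_zero _ (Real.exp_pos _).ne') (hg.det_ne_zero y hy)

lemma inv_confMetric (u : E4 → ℝ) (g : MetricComp) (y : E4) (h : (g y).det ≠ 0) :
    (confMetric u g y)⁻¹ = Real.exp (-2 * u y) • (g y)⁻¹ := by
  refine Matrix.inv_eq_right_inv ?_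
  rw [confMetric, Matrix.smul_mul, Matrix.mul_smul, smul_smul,
    Matrix.mul_nonsing_inv _ h.isUnit, ← Real.exp_add]
  ring_nf
  simp

lemma pd_confMetric (hg : LocalMetric Ω g) (hu : ContDiffOn ℝ ∞ u Ω) (hy : y ∈ Ω)
    (c a b : Fin 4) :
    pd c (fun z => confMetric u g z a b) y
      = Real.exp (2 * u y) * (pd c (fun z => g z a b) y + 2 * grad u y c * g y a b) := by
  have hd := differentiableAt_of_contDiffOn hg.isOpen hu hy
  have h := pd_mul (hd.const_mul 2).exp
    (differentiableAt_of_contDiffOn hg.isOpen (hg.smooth a b) hy) c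
  rw [pd_exp_mul hd] at h
  refine Eq.trans h ?_
  rw [grad]
  ring

lemma christoffel_conf (hg : LocalMetric Ω g) (hu : ContDiffOn ℝ ∞ u Ω) (hy : y ∈ Ω)
    (a b c : Fin 4) :
    christoffel (confMetric u g) a b c y = christoffel g a b c y
      + (1 : Matrix (Fin 4) (Fin 4) ℝ) a b * grad u y c
      + (1 : Matrix (Fin 4) (Fin 4) ℝ) a c * grad u y b
      - g y b c * (g y)⁻¹.mulVec (grad u y) a := by
  have hinv := inv_confMetric u g y (hg.det_ne_zero y hy)
  have h1 : ∀ b, ∑ d, (g y)⁻¹ a d * g y d b = (1 : Matrix (Fin 4) (Fin 4) ℝ) a b := fun b => by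
    rw [← hg.inv_mul hy, Matrix.mul_apply]
  have he : Real.exp (-2 * u y) * Real.exp (2 * u y) = 1 := by
    rw [← Real.exp_add]; ring_nf; simp
  simp only [christoffel, hg.pd_confMetric hu hy, ginv, hinv, Matrix.smul_apply, smul_eq_mul]
  rw [← h1 b, ← h1 c, Matrix.mulVec, dotProduct]
  simp only [Finset.mul_sum, Finset.sum_mul, ← Finset.sum_add_distrib, ← Finset.sum_sub_distrib]
  refine Finset.sum_congr rfl fun d _ => ?_
  linear_combination ((1 / 2) * ((g y)⁻¹ a d *
    (pd b (fun z => g z d c) y + 2 * grad u y b * g y d c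
      + (pd c (fun z => g z d b) y + 2 * grad u y c * g y d b)
      - (pd d (fun z => g z b c) y + 2 * grad u y d * g y b c)))) * he

/-- Differentiating the exponential contributes `w u_e W`. Each of the four indices takes away one
`u_e W` through the change of the Christoffel symbols, which explains the factor `w - 4`. -/
lemma covDeriv_conf (hg : LocalMetric Ω g) (hu : ContDiffOn ℝ ∞ u Ω) (hy : y ∈ Ω)
    {W : TensorComp} (hW : DiffAt W y) (w : ℝ) (a b c d e : Fin 4) :
    covDeriv (confMetric u g) (fun z a b c d => Real.exp (w * u z) * W z a b c d) y a b c d e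
      = Real.exp (w * u y) * (covDeriv g W y a b c d e
        + confTerm w (g y) (grad u y) ((g y)⁻¹.mulVec (grad u y)) (W y) a b c d e) := by
  have hd := differentiableAt_of_contDiffOn hg.isOpen hu hy
  have h := pd_mul (hd.const_mul w).exp (hW a b c d) e
  rw [pd_exp_mul hd] at h
  set v := (g y)⁻¹.mulVec (grad u y) with hv
  have hs : ∀ (x : Fin 4) (X : Fin 4 → ℝ), ∑ f, christoffel (confMetric u g) f e x y * X f
      = ∑ f, christoffel g f e x y * X f + X e * grad u y x + X x * grad u y e
        - g y e x * ∑ f, v f * X f := fun x X => by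
    have o : ∀ x (k : ℝ), X x * k = ∑ f, (1 : Matrix (Fin 4) (Fin 4) ℝ) f x * k * X f :=
      fun x k => by simp [Matrix.one_apply, mul_comm]
    rw [o, o, Finset.mul_sum, ← Finset.sum_add_distrib, ← Finset.sum_add_distrib,
      ← Finset.sum_sub_distrib]
    refine Finset.sum_congr rfl fun f _ => ?_
    rw [hg.christoffel_conf hu hy]
    ring
  have hf : ∀ (x : Fin 4) (X : Fin 4 → ℝ), ∑ f, christoffel (confMetric u g) f e x y *
      (Real.exp (w * u y) * X f) = Real.exp (w * u y) * (∑ f, christoffel g f e x y * X f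
        + X e * grad u y x + X x * grad u y e - g y e x * ∑ f, v f * X f) := fun x X => by
    rw [← hs, Finset.mul_sum]
    exact Finset.sum_congr rfl fun f _ => by ring
  rw [covDeriv, covDeriv, h]
  simp only [Finset.sum_add_distrib]
  rw [hf a fun f => W y f b c d, hf b fun f => W y a f c d, hf c fun f => W y a b f d,
    hf d fun f => W y a b c f, confTerm]
  simp only [grad]
  ring

end LocalMetric

end

/-! ### Symmetries of the curvature and of the Weyl tensor. -/

section

namespace LocalMetric

variable {Ω : Set E4} {g : MetricComp} {u : E4 → ℝ} {y : E4}

/-- The Christoffel symbols with all indices down. -/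
def lowChristoffel (g : MetricComp) (a b c : Fin 4) (y : E4) : ℝ :=
  (1 / 2) * (pd b (fun z => g z a c) y + pd c (fun z => g z a b) y - pd a (fun z => g z b c) y)

/-- `g^{ef} Γ_{e;pq} Γ_{f;rs}` -/
def connSq (g : MetricComp) (y : E4) (p q r s : Fin 4) : ℝ :=
  ∑ e, ∑ f, ginv g y e f * lowChristoffel g e p q y * lowChristoffel g f r s y

/-- `∂_i ∂_j g_{ab}` -/
def pdTwo (g : MetricComp) (y : E4) (i j a b : Fin 4) : ℝ := pd i (pd j fun z => g z a b) y

lemma contDiffOn_pd_metric (hg : LocalMetric Ω g) (i a b : Fin 4) :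
    ContDiffOn ℝ ∞ (pd i fun z => g z a b) Ω := contDiffOn_pd hg.isOpen (hg.smooth a b) i

lemma differentiableAt_pd_metric (hg : LocalMetric Ω g) (hy : y ∈ Ω) (i a b : Fin 4) :
    DifferentiableAt ℝ (pd i fun z => g z a b) y :=
  differentiableAt_of_contDiffOn hg.isOpen (hg.contDiffOn_pd_metric i a b) hy

lemma pdTwo_comm (hg : LocalMetric Ω g) (hy : y ∈ Ω) (i j a b : Fin 4) :
    pdTwo g y i j a b = pdTwo g y j i a b := pd_comm hg.isOpen (hg.smooth a b) hy i j

lemma pdTwo_symm (hg : LocalMetric Ω g) (hy : y ∈ Ω) (i j a b : Fin 4) :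
    pdTwo g y i j a b = pdTwo g y i j b a :=
  pd_congr hg.isOpen hy (fun _ hz => hg.pd_metric_symm hz j a b) i

lemma lowChristoffel_symm (hg : LocalMetric Ω g) (hy : y ∈ Ω) (a b c : Fin 4) :
    lowChristoffel g a b c y = lowChristoffel g a c b y := by
  rw [lowChristoffel, lowChristoffel, hg.pd_metric_symm hy a b c]; ring

lemma pd_metric_eq_low (hg : LocalMetric Ω g) (hy : y ∈ Ω) (c a b : Fin 4) :
    pd c (fun z => g z a b) y = lowChristoffel g a c b y + lowChristoffel g b c a y := by
  rw [lowChristoffel, lowChristoffel, hg.pd_metric_symm hy c b a, hg.pd_metric_symm hy b c a,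
    hg.pd_metric_symm hy b a c, hg.pd_metric_symm hy a b c, hg.pd_metric_symm hy a c b]
  ring

lemma christoffel_eq_low (g : MetricComp) (a b c : Fin 4) (y : E4) :
    christoffel g a b c y = ∑ d, ginv g y a d * lowChristoffel g d b c y := by
  simp only [christoffel, lowChristoffel, Finset.mul_sum]
  exact Finset.sum_congr rfl fun _ _ => by ring

lemma connSq_symm (hg : LocalMetric Ω g) (hy : y ∈ Ω) (p q r s : Fin 4) :
    connSq g y p q r s = connSq g y r s p q := by
  rw [connSq, connSq, Finset.sum_comm]
  exact Finset.sum_congr rfl fun e _ => Finset.sum_congr rfl fun f _ => by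
    rw [hg.ginv_symm hy f e]; ring

lemma connSq_swap (hg : LocalMetric Ω g) (hy : y ∈ Ω) (p q r s : Fin 4) :
    connSq g y p q r s = connSq g y q p r s := by
  rw [connSq, connSq]
  exact Finset.sum_congr rfl fun e _ => Finset.sum_congr rfl fun f _ => by
    rw [hg.lowChristoffel_symm hy e p q]

lemma connSq_swap' (hg : LocalMetric Ω g) (hy : y ∈ Ω) (p q r s : Fin 4) :
    connSq g y p q r s = connSq g y p q s r := by
  rw [hg.connSq_symm hy, hg.connSq_swap hy, hg.connSq_symm hy]

lemma pd_lowChristoffel (hg : LocalMetric Ω g) (hy : y ∈ Ω) (i a b c : Fin 4) :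
    pd i (lowChristoffel g a b c) y
      = (1 / 2) * (pdTwo g y i b a c + pdTwo g y i c a b - pdTwo g y i a b c) := by
  have d := hg.differentiableAt_pd_metric hy
  have h1 : lowChristoffel g a b c = fun y => (1 / 2) * (pd b (fun z => g z a c) y
    + pd c (fun z => g z a b) y - pd a (fun z => g z b c) y) := rfl
  rw [h1, pd_const_mul (((d _ _ _).fun_add (d _ _ _)).fun_sub (d _ _ _)),
    pd_sub ((d _ _ _).fun_add (d _ _ _)) (d _ _ _), pd_add (d _ _ _) (d _ _ _)]
  rfl

lemma sum_metric_mul_pd_christoffel (hg : LocalMetric Ω g) (hy : y ∈ Ω) (a b c d : Fin 4) :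
    ∑ e, g y a e * pd c (christoffel g e d b) y = pd c (lowChristoffel g a d b) y
      - ∑ e, pd c (fun z => g z a e) y * christoffel g e d b y := by
  have h : pd c (fun z => ∑ e, g z a e * christoffel g e d b z) y
      = pd c (lowChristoffel g a d b) y :=
    pd_congr hg.isOpen hy (fun z hz => hg.sum_metric_mul_christoffel hz a d b) c
  have d1 := fun e => differentiableAt_of_contDiffOn hg.isOpen (hg.smooth a e) hy
  have d2 := fun e => differentiableAt_of_contDiffOn hg.isOpen (hg.contDiffOn_christoffel e d b) hy
  rw [pd_sum _ fun e => (d1 e).fun_mul (d2 e)] at h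
  simp only [pd_mul (d1 _) (d2 _), Finset.sum_add_distrib] at h
  linear_combination h

/-- The Riemann tensor in terms of second derivatives of the metric. -/
lemma riemann_eq (hg : LocalMetric Ω g) (hy : y ∈ Ω) (a b c d : Fin 4) :
    riemann g y a b c d = (1 / 2) * (pdTwo g y c b a d - pdTwo g y c a d b - pdTwo g y d b a c
      + pdTwo g y d a c b) - connSq g y c a d b + connSq g y d a c b := by
  have h1 : ∀ c d, ∑ e, ∑ f, g y a e * (christoffel g e c f y * christoffel g f d b y)
      = ∑ f, lowChristoffel g a c f y * christoffel g f d b y := fun c d => by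
    rw [Finset.sum_comm]
    refine Finset.sum_congr rfl fun f _ => ?_
    rw [lowChristoffel, ← hg.sum_metric_mul_christoffel hy, Finset.sum_mul]
    exact Finset.sum_congr rfl fun e _ => by ring
  have h2 : ∀ c d, ∑ e, lowChristoffel g e c a y * christoffel g e d b y
      = connSq g y c a d b := fun c d => by
    simp only [connSq, christoffel_eq_low, Finset.mul_sum]
    exact Finset.sum_congr rfl fun e _ => Finset.sum_congr rfl fun f _ => by ring
  -- The derivative of the metric splits into two lowered Christoffel symbols: one cancels the
  -- quadratic term of the curvature, the other becomes `connSq`.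
  have h3 : ∀ c d, ∑ e, g y a e * pd c (christoffel g e d b) y
      + ∑ e, ∑ f, g y a e * (christoffel g e c f y * christoffel g f d b y)
      = pd c (lowChristoffel g a d b) y - connSq g y c a d b := fun c d => by
    rw [hg.sum_metric_mul_pd_christoffel hy, h1, ← h2]
    simp only [hg.pd_metric_eq_low hy, add_mul, Finset.sum_add_distrib]
    ring
  have h4 : riemann g y a b c d
      = (∑ e, g y a e * pd c (christoffel g e d b) y
        + ∑ e, ∑ f, g y a e * (christoffel g e c f y * christoffel g f d b y))
      - (∑ e, g y a e * pd d (christoffel g e c b) y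
        + ∑ e, ∑ f, g y a e * (christoffel g e d f y * christoffel g f c b y)) := by
    simp only [riemann, riemannUp, mul_add, mul_sub, Finset.mul_sum, Finset.sum_add_distrib,
      Finset.sum_sub_distrib]
    ring
  rw [h4, h3, h3, hg.pd_lowChristoffel hy, hg.pd_lowChristoffel hy, hg.pdTwo_comm hy d c]
  ring

lemma riemannUp_eq (hg : LocalMetric Ω g) (hy : y ∈ Ω) (a b c d : Fin 4) :
    riemannUp g y a b c d = ∑ e, ginv g y a e * riemann g y e b c d := by
  have h : ((g y)⁻¹.mulVec ((g y).mulVec fun e => riemannUp g y e b c d)) a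
      = riemannUp g y a b c d := by
    rw [Matrix.mulVec_mulVec, hg.inv_mul hy, Matrix.one_mulVec]
  exact h.symm

lemma ricci_eq (hg : LocalMetric Ω g) (hy : y ∈ Ω) (b d : Fin 4) :
    ricci g y b d = ∑ a, ∑ c, ginv g y a c * riemann g y a b c d := by
  simp only [ricci, hg.riemannUp_eq hy]
  rw [Finset.sum_comm]
  exact Finset.sum_congr rfl fun a _ => Finset.sum_congr rfl fun c _ => by
    rw [hg.ginv_symm hy c a]

/-- In the form `riemann_eq`, each symmetry of the curvature only permutes blocks `pdTwo` and
`connSq`, whose own symmetries are already known. -/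
lemma riemann_antisymm_left (hg : LocalMetric Ω g) (hy : y ∈ Ω) (a b c d : Fin 4) :
    riemann g y b a c d = -riemann g y a b c d := by
  rw [hg.riemann_eq hy, hg.riemann_eq hy, hg.connSq_symm hy c b, hg.connSq_symm hy d b,
    hg.pdTwo_symm hy c b d a, hg.pdTwo_symm hy d b c a, hg.pdTwo_symm hy c a d b,
    hg.pdTwo_symm hy d a c b]
  ring

lemma riemann_antisymm_right (hg : LocalMetric Ω g) (hy : y ∈ Ω) (a b c d : Fin 4) :
    riemann g y a b d c = -riemann g y a b c d := by
  rw [hg.riemann_eq hy, hg.riemann_eq hy]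
  ring

lemma riemann_pair_symm (hg : LocalMetric Ω g) (hy : y ∈ Ω) (a b c d : Fin 4) :
    riemann g y c d a b = riemann g y a b c d := by
  rw [hg.riemann_eq hy, hg.riemann_eq hy, hg.connSq_swap hy a c, hg.connSq_swap' hy c a b,
    hg.connSq_symm hy b c, hg.connSq_swap hy a d, hg.connSq_swap' hy d a b,
    hg.pdTwo_comm hy a d, hg.pdTwo_comm hy a c, hg.pdTwo_comm hy b d, hg.pdTwo_comm hy b c,
    hg.pdTwo_symm hy c a b d, hg.pdTwo_symm hy d b c a]
  ring

lemma riemann_bianchi (hg : LocalMetric Ω g) (hy : y ∈ Ω) (a b c d : Fin 4) :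
    riemann g y a b c d + riemann g y a c d b + riemann g y a d b c = 0 := by
  rw [hg.riemann_eq hy, hg.riemann_eq hy, hg.riemann_eq hy, hg.connSq_swap' hy c a d b,
    hg.connSq_swap' hy d a c b, hg.connSq_swap' hy b a d c, hg.pdTwo_comm hy c b,
    hg.pdTwo_comm hy d b, hg.pdTwo_comm hy d c, hg.pdTwo_symm hy c a d b,
    hg.pdTwo_symm hy d a c b, hg.pdTwo_symm hy b a d c]
  ring

lemma ricci_symm (hg : LocalMetric Ω g) (hy : y ∈ Ω) (b d : Fin 4) :
    ricci g y b d = ricci g y d b := by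
  rw [hg.ricci_eq hy, hg.ricci_eq hy, Finset.sum_comm]
  exact Finset.sum_congr rfl fun a _ => Finset.sum_congr rfl fun c _ => by
    rw [hg.ginv_symm hy c a, hg.riemann_pair_symm hy]

lemma sum_ginv_metric (hg : LocalMetric Ω g) (hy : y ∈ Ω) : 
    ∑ a, ∑ c, ginv g y a c * g y a c = 4 := by
  have h : ((g y)⁻¹ * (g y).transpose).trace = 4 := by
    rw [hg.transpose_eq hy, hg.inv_mul hy, Matrix.trace_one]; simp
  rw [← h]
  simp [Matrix.trace, Matrix.mul_apply, ginv]

lemma sum_ginv_metric_mul (hg : LocalMetric Ω g) (hy : y ∈ Ω) (d : Fin 4) (X : Fin 4 → ℝ) :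
    ∑ a, ∑ c, ginv g y a c * (g y a d * X c) = X d := by
  have h : ((g y).mulVec ((g y)⁻¹.mulVec X)) d = X d := by
    rw [Matrix.mulVec_mulVec, hg.mul_inv hy, Matrix.one_mulVec]
  rw [← h]
  simp only [Matrix.mulVec, dotProduct, Finset.mul_sum, ginv]
  exact Finset.sum_congr rfl fun a _ => Finset.sum_congr rfl fun c _ => by
    rw [hg.symm y hy a d]; ring

/-- The trace of the product of the metric and a symmetric tensor with the symmetries of the
Riemann tensor. -/
lemma trace_metric_product (hg : LocalMetric Ω g) (hy : y ∈ Ω) {X : Fin 4 → Fin 4 → ℝ}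
    (hX : ∀ a b, X a b = X b a) (b d : Fin 4) :
    ∑ a, ∑ c, ginv g y a c * (g y a c * X b d - g y a d * X b c - g y b c * X a d + g y b d * X a c)
      = 2 * X b d + g y b d * ∑ a, ∑ c, ginv g y a c * X a c := by
  have h1 := hg.sum_ginv_metric_mul hy d (X b)
  have h2 : ∑ a, ∑ c, ginv g y a c * (g y b c * X a d) = X b d := by
    rw [Finset.sum_comm, hX b d, ← hg.sum_ginv_metric_mul hy b (X d)]
    exact Finset.sum_congr rfl fun a _ => Finset.sum_congr rfl fun c _ => by
      rw [hg.ginv_symm hy c a, hg.symm y hy b a, hX c d]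
  have h3 : ∑ a, ∑ c, ginv g y a c * (g y a c * X b d) = 4 * X b d := by
    rw [← hg.sum_ginv_metric hy]
    simp only [Finset.sum_mul, mul_assoc]
  have h4 : ∑ a, ∑ c, ginv g y a c * (g y b d * X a c)
      = g y b d * ∑ a, ∑ c, ginv g y a c * X a c := by
    simp only [Finset.mul_sum]
    exact Finset.sum_congr rfl fun a _ => Finset.sum_congr rfl fun c _ => by ring
  simp only [mul_add, mul_sub, Finset.sum_add_distrib, Finset.sum_sub_distrib, h1, h2, h3, h4]
  ring

/-- The Weyl tensor has the symmetries of the Weyl tensor. -/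
lemma weylSymm_weyl (hg : LocalMetric Ω g) (hy : y ∈ Ω) : WeylSymm (g y)⁻¹ (weyl g y) where
  antisymm_left a b c d := by
    rw [weyl, weyl, hg.riemann_antisymm_left hy]; ring
  antisymm_right a b c d := by
    rw [weyl, weyl, hg.riemann_antisymm_right hy]; ring
  pair_symm a b c d := by
    rw [weyl, weyl, hg.riemann_pair_symm hy, hg.symm y hy c a, hg.symm y hy c b, hg.symm y hy d a,
      hg.symm y hy d b, hg.ricci_symm hy d b, hg.ricci_symm hy d a, hg.ricci_symm hy c b,
      hg.ricci_symm hy c a]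
    ring
  bianchi a b c d := by
    simp only [weyl]
    rw [hg.symm y hy d c, hg.symm y hy c b, hg.symm y hy d b, hg.ricci_symm hy d c,
      hg.ricci_symm hy c b, hg.ricci_symm hy d b]
    linear_combination hg.riemann_bianchi hy a b c d
  trace_free b d := by
    have h1 := hg.trace_metric_product hy (hg.ricci_symm hy) b d
    have h2 := hg.trace_metric_product hy (hg.symm y hy) b d
    have h3 := hg.ricci_eq hy b d
    have h4 := hg.sum_ginv_metric hy
    rw [h4] at h2
    -- The four-term product of the metric with itself counts each term of the scalar part twice,
    -- hence `12` in place of `6`.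
    have e : ∀ a c, (g y)⁻¹ a c * weyl g y a b c d = ginv g y a c * riemann g y a b c d
        - (1 / 2) * (ginv g y a c * (g y a c * ricci g y b d - g y a d * ricci g y b c
          - g y b c * ricci g y a d + g y b d * ricci g y a c))
        + (scalarCurv g y / 12) * (ginv g y a c * (g y a c * g y b d - g y a d * g y b c
          - g y b c * g y a d + g y b d * g y a c)) := fun a c => by
      rw [weyl, ginv]; ring
    simp only [e, Finset.sum_add_distrib, Finset.sum_sub_distrib, ← Finset.mul_sum]
    rw [h1, h2, ← h3, scalarCurv]
    ring

end LocalMetric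

end

/-! ### Conformal change of the Riemann tensor. -/

section

namespace LocalMetric

variable {Ω : Set E4} {g : MetricComp} {u : E4 → ℝ} {y : E4}

/-- The squared length of the gradient of `u`. -/
def gradLen (g : MetricComp) (u : E4 → ℝ) (y : E4) : ℝ :=
  ∑ e, ∑ f, ginv g y e f * grad u y e * grad u y f

/-- `Γ^e_{bd} u_e` -/
def connGrad (g : MetricComp) (u : E4 → ℝ) (y : E4) (p q : Fin 4) : ℝ :=
  ∑ e, ∑ f, ginv g y e f * grad u y e * lowChristoffel g f p q y

/-- The tensor by which the trace part of the curvature changes. -/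
def confSchouten (g : MetricComp) (u : E4 → ℝ) (y : E4) (b d : Fin 4) : ℝ :=
  pd b (pd d u) y - connGrad g u y b d - grad u y b * grad u y d
    + (1 / 2) * gradLen g u y * g y b d

lemma confSchouten_symm (hg : LocalMetric Ω g) (hu : ContDiffOn ℝ ∞ u Ω) (hy : y ∈ Ω)
    (b d : Fin 4) : confSchouten g u y b d = confSchouten g u y d b := by
  have h : connGrad g u y b d = connGrad g u y d b :=
    Finset.sum_congr rfl fun e _ => Finset.sum_congr rfl fun f _ => by
      rw [hg.lowChristoffel_symm hy f b d]
  rw [confSchouten, confSchouten, h, pd_comm hg.isOpen hu hy, hg.symm y hy b d]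
  ring

lemma pdTwo_conf (hg : LocalMetric Ω g) (hu : ContDiffOn ℝ ∞ u Ω) (hy : y ∈ Ω)
    (i j a b : Fin 4) :
    pdTwo (confMetric u g) y i j a b = Real.exp (2 * u y) * (pdTwo g y i j a b
      + 2 * grad u y i * pd j (fun z => g z a b) y + 2 * grad u y j * pd i (fun z => g z a b) y
      + (2 * pd i (pd j u) y + 4 * grad u y i * grad u y j) * g y a b) := by
  have hd := differentiableAt_of_contDiffOn hg.isOpen hu hy
  have hdu := differentiableAt_of_contDiffOn hg.isOpen (contDiffOn_pd hg.isOpen hu j) hy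
  have hdg := differentiableAt_of_contDiffOn hg.isOpen (hg.smooth a b) hy
  have hdp := hg.differentiableAt_pd_metric hy j a b
  have h := pd_congr hg.isOpen hy (fun z hz => hg.pd_confMetric hu hz j a b) i
  simp only [grad] at h ⊢
  rw [pd_mul (hd.const_mul 2).exp (hdp.fun_add ((hdu.const_mul 2).fun_mul hdg)),
    pd_exp_mul hd, pd_add hdp ((hdu.const_mul 2).fun_mul hdg), pd_mul (hdu.const_mul 2) hdg,
    pd_const_mul hdu] at h
  refine Eq.trans h ?_
  rw [pdTwo]
  ring

lemma lowChristoffel_conf (hg : LocalMetric Ω g) (hu : ContDiffOn ℝ ∞ u Ω) (hy : y ∈ Ω)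
    (a b c : Fin 4) :
    lowChristoffel (confMetric u g) a b c y = Real.exp (2 * u y) * (lowChristoffel g a b c y
      + g y a c * grad u y b + g y a b * grad u y c - g y b c * grad u y a) := by
  rw [lowChristoffel, hg.pd_confMetric hu hy, hg.pd_confMetric hu hy, hg.pd_confMetric hu hy,
    lowChristoffel]
  ring

/-- Each lowered symbol acquires three terms, so the square has sixteen products. Where a metric
factor meets the inverse metric it is contracted away; the others are `connSq`, `connGrad` and
`gradLen`. -/
lemma connSq_conf (hg : LocalMetric Ω g) (hu : ContDiffOn ℝ ∞ u Ω) (hy : y ∈ Ω)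
    (p q r s : Fin 4) :
    connSq (confMetric u g) y p q r s = Real.exp (2 * u y) * (connSq g y p q r s
      + lowChristoffel g s p q y * grad u y r + lowChristoffel g r p q y * grad u y s
      - g y r s * connGrad g u y p q
      + lowChristoffel g q r s y * grad u y p + lowChristoffel g p r s y * grad u y q
      - g y p q * connGrad g u y r s
      + g y q s * grad u y p * grad u y r + g y q r * grad u y p * grad u y s
      + g y p s * grad u y q * grad u y r + g y p r * grad u y q * grad u y s
      - 2 * g y r s * grad u y p * grad u y q - 2 * g y p q * grad u y r * grad u y s
      + g y p q * g y r s * gradLen g u y) := by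
  have hinv := inv_confMetric u g y (hg.det_ne_zero y hy)
  have he : Real.exp (-2 * u y) * Real.exp (2 * u y) = 1 := by
    rw [← Real.exp_add]; ring_nf; simp
  set ν := grad u y
  have C1 : ∀ (X : Fin 4 → ℝ) x, ∑ e, ∑ f, ginv g y e f * (X e * g y f x) = X x := fun X x => by
    rw [← hg.sum_ginv_metric_mul hy x X, Finset.sum_comm]
    exact Finset.sum_congr rfl fun a _ => Finset.sum_congr rfl fun c _ => by
      rw [hg.ginv_symm hy c a]; ring
  have C2 : ∀ (X : Fin 4 → ℝ) x, ∑ e, ∑ f, ginv g y e f * (g y e x * X f) = X x :=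
    fun X x => hg.sum_ginv_metric_mul hy x X
  have G1 : ∀ p q, ∑ e, ∑ f, ginv g y e f * (lowChristoffel g e p q y * ν f)
      = connGrad g u y p q := fun p q => by
    rw [Finset.sum_comm, connGrad]
    exact Finset.sum_congr rfl fun a _ => Finset.sum_congr rfl fun c _ => by
      rw [hg.ginv_symm hy c a]; ring
  have G2 : ∀ p q, ∑ e, ∑ f, ginv g y e f * (ν e * lowChristoffel g f p q y)
      = connGrad g u y p q := fun p q =>
    Finset.sum_congr rfl fun a _ => Finset.sum_congr rfl fun c _ => by ring
  have G3 : ∑ e, ∑ f, ginv g y e f * (ν e * ν f) = gradLen g u y :=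
    Finset.sum_congr rfl fun a _ => Finset.sum_congr rfl fun c _ => by ring
  have G0 : ∑ e, ∑ f, ginv g y e f * (lowChristoffel g e p q y * lowChristoffel g f r s y)
      = connSq g y p q r s :=
    Finset.sum_congr rfl fun a _ => Finset.sum_congr rfl fun c _ => by ring
  have key : ∀ e f, ginv (confMetric u g) y e f * lowChristoffel (confMetric u g) e p q y
      * lowChristoffel (confMetric u g) f r s y = Real.exp (2 * u y) *
      (ginv g y e f * (lowChristoffel g e p q y * lowChristoffel g f r s y)
      + ν r * (ginv g y e f * (lowChristoffel g e p q y * g y f s))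
      + ν s * (ginv g y e f * (lowChristoffel g e p q y * g y f r))
      - g y r s * (ginv g y e f * (lowChristoffel g e p q y * ν f))
      + ν p * (ginv g y e f * (g y e q * lowChristoffel g f r s y))
      + ν q * (ginv g y e f * (g y e p * lowChristoffel g f r s y))
      - g y p q * (ginv g y e f * (ν e * lowChristoffel g f r s y))
      + ν p * ν r * (ginv g y e f * (g y e q * g y f s))
      + ν p * ν s * (ginv g y e f * (g y e q * g y f r))
      - g y r s * ν p * (ginv g y e f * (g y e q * ν f))
      + ν q * ν r * (ginv g y e f * (g y e p * g y f s))
      + ν q * ν s * (ginv g y e f * (g y e p * g y f r))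
      - g y r s * ν q * (ginv g y e f * (g y e p * ν f))
      - g y p q * ν r * (ginv g y e f * (ν e * g y f s))
      - g y p q * ν s * (ginv g y e f * (ν e * g y f r))
      + g y p q * g y r s * (ginv g y e f * (ν e * ν f))) := fun e f => by
    rw [hg.lowChristoffel_conf hu hy, hg.lowChristoffel_conf hu hy, ginv, hinv,
      Matrix.smul_apply, smul_eq_mul, ginv]
    linear_combination (Real.exp (2 * u y) * (g y)⁻¹ e f * (lowChristoffel g e p q y
      + g y e q * ν p + g y e p * ν q - g y p q * ν e) * (lowChristoffel g f r s y
      + g y f s * ν r + g y f r * ν s - g y r s * ν f)) * he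
  rw [connSq]
  simp only [key, ← Finset.mul_sum, Finset.sum_add_distrib, Finset.sum_sub_distrib, G0, G1, G2, G3]
  rw [C1 (fun e => lowChristoffel g e p q y), C1 (fun e => lowChristoffel g e p q y),
    C2 (fun e => lowChristoffel g e r s y), C2 (fun e => lowChristoffel g e r s y),
    C2 (fun f => g y f s), C2 (fun f => g y f r), C2 (fun f => g y f s), C2 (fun f => g y f r),
    C2 ν, C2 ν, C1 ν, C1 ν, hg.symm y hy q s, hg.symm y hy q r, hg.symm y hy p s, hg.symm y hy p r,
    hg.symm y hy s q, hg.symm y hy r q, hg.symm y hy s p, hg.symm y hy r p]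
  ring

/-- The second derivatives of `u` and the products of `du` with Christoffel symbols combine into the
covariant Hessian inside `confSchouten`. The correction is a product of `g` with a symmetric tensor,
exactly what the Weyl projection removes. -/
lemma riemann_conf (hg : LocalMetric Ω g) (hu : ContDiffOn ℝ ∞ u Ω) (hy : y ∈ Ω)
    (a b c d : Fin 4) :
    riemann (confMetric u g) y a b c d = Real.exp (2 * u y) * (riemann g y a b c d
      - (g y a c * confSchouten g u y b d - g y a d * confSchouten g u y b c
        - g y b c * confSchouten g u y a d + g y b d * confSchouten g u y a c)) := by
  have k1 : ∀ p q, connGrad g u y p q = connGrad g u y q p := fun p q =>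
    Finset.sum_congr rfl fun e _ => Finset.sum_congr rfl fun f _ => by
      rw [hg.lowChristoffel_symm hy f p q]
  rw [(hg.conf hu).riemann_eq hy, hg.riemann_eq hy]
  simp only [hg.pdTwo_conf hu hy, hg.connSq_conf hu hy, confSchouten, hg.pd_metric_eq_low hy]
  rw [hg.lowChristoffel_symm hy a d c, hg.lowChristoffel_symm hy b d c,
    hg.lowChristoffel_symm hy a c b, hg.lowChristoffel_symm hy d c b,
    hg.lowChristoffel_symm hy b c a, hg.lowChristoffel_symm hy d c a,
    hg.lowChristoffel_symm hy a d b, hg.lowChristoffel_symm hy c d b,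
    hg.lowChristoffel_symm hy b d a, hg.lowChristoffel_symm hy c d a,
    hg.lowChristoffel_symm hy c b a, hg.lowChristoffel_symm hy d b a,
    pd_comm hg.isOpen hu hy c b, pd_comm hg.isOpen hu hy d b, pd_comm hg.isOpen hu hy c a,
    pd_comm hg.isOpen hu hy d a, k1 c b, k1 c a, k1 d b, k1 d a, hg.symm y hy c a, hg.symm y hy c b,
    hg.symm y hy d a, hg.symm y hy d b, hg.symm y hy d c]
  ring

end LocalMetric

end

/-! ### Conformal weights of the Weyl tensor and its dual, and regularity. -/

section

namespace LocalMetric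

variable {Ω : Set E4} {g : MetricComp} {u : E4 → ℝ} {y : E4}

lemma ginv_confMetric (hg : LocalMetric Ω g) (u : E4 → ℝ) (hy : y ∈ Ω) (a b : Fin 4) :
    ginv (confMetric u g) y a b = Real.exp (-2 * u y) * ginv g y a b := by
  rw [ginv, inv_confMetric u g y (hg.det_ne_zero y hy)]
  rfl

lemma ricci_conf (hg : LocalMetric Ω g) (hu : ContDiffOn ℝ ∞ u Ω) (hy : y ∈ Ω) (b d : Fin 4) :
    ricci (confMetric u g) y b d = ricci g y b d - (2 * confSchouten g u y b d
      + g y b d * ∑ a, ∑ c, ginv g y a c * confSchouten g u y a c) := by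
  have he : Real.exp (-2 * u y) * Real.exp (2 * u y) = 1 := by
    rw [← Real.exp_add]; ring_nf; simp
  rw [(hg.conf hu).ricci_eq hy, hg.ricci_eq hy,
    ← hg.trace_metric_product hy (hg.confSchouten_symm hu hy)]
  simp only [← Finset.sum_sub_distrib]
  refine Finset.sum_congr rfl fun a _ => Finset.sum_congr rfl fun c _ => ?_
  rw [hg.ginv_confMetric u hy, hg.riemann_conf hu hy]
  linear_combination (ginv g y a c * (riemann g y a b c d
      - (g y a c * confSchouten g u y b d - g y a d * confSchouten g u y b c
        - g y b c * confSchouten g u y a d + g y b d * confSchouten g u y a c))) * he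

lemma scalarCurv_conf (hg : LocalMetric Ω g) (hu : ContDiffOn ℝ ∞ u Ω) (hy : y ∈ Ω) :
    scalarCurv (confMetric u g) y = Real.exp (-2 * u y) * (scalarCurv g y
      - 6 * ∑ a, ∑ c, ginv g y a c * confSchouten g u y a c) := by
  set t := ∑ a, ∑ c, ginv g y a c * confSchouten g u y a c with ht
  have key : ∀ a c, ginv (confMetric u g) y a c * ricci (confMetric u g) y a c
      = Real.exp (-2 * u y) * (ginv g y a c * ricci g y a c
        - (2 * (ginv g y a c * confSchouten g u y a c) + t * (ginv g y a c * g y a c))) :=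
    fun a c => by
      rw [hg.ginv_confMetric u hy, hg.ricci_conf hu hy, ← ht]
      ring
  rw [scalarCurv, scalarCurv]
  simp only [key, ← Finset.mul_sum, Finset.sum_add_distrib, Finset.sum_sub_distrib, ← ht,
    hg.sum_ginv_metric hy]
  ring

/-- The Weyl tensor is conformally covariant. -/
lemma weyl_conf (hg : LocalMetric Ω g) (hu : ContDiffOn ℝ ∞ u Ω) (hy : y ∈ Ω) (a b c d : Fin 4) :
    weyl (confMetric u g) y a b c d = Real.exp (2 * u y) * weyl g y a b c d := by
  have he : Real.exp (-2 * u y) * Real.exp (2 * u y) = 1 := by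
    rw [← Real.exp_add]; ring_nf; simp
  rw [weyl, weyl, hg.riemann_conf hu hy, hg.scalarCurv_conf hu hy]
  simp only [hg.ricci_conf hu hy, confMetric, Matrix.smul_apply, smul_eq_mul]
  linear_combination (Real.exp (2 * u y) * ((scalarCurv g y
      - 6 * ∑ a, ∑ c, ginv g y a c * confSchouten g u y a c) / 6)
      * (g y a c * g y b d - g y a d * g y b c)) * he

lemma volForm_conf (u : E4 → ℝ) (g : MetricComp) (y : E4) (a b c d : Fin 4) :
    volForm (confMetric u g) y a b c d
      = Real.exp (2 * u y) * Real.exp (2 * u y) * volForm g y a b c d := by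
  have h : √|(confMetric u g y).det| = Real.exp (2 * u y) * Real.exp (2 * u y) * √|(g y).det| := by
    have h1 : (confMetric u g y).det
        = (Real.exp (2 * u y) * Real.exp (2 * u y)) ^ 2 * (g y).det := by
      rw [confMetric, Matrix.det_smul]; simp; left; ring
    rw [h1, abs_mul, abs_of_nonneg (by positivity), Real.sqrt_mul (by positivity),
      Real.sqrt_sq (by positivity)]
  rw [volForm, volForm, h]
  ring

/-- The Hodge dual has the conformal weight of the tensor. -/
lemma hodgeDual_conf (hg : LocalMetric Ω g) (u : E4 → ℝ) (hy : y ∈ Ω) {S T : TensorComp} {k : ℝ}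
    (h : ∀ a b c d, S y a b c d = k * T y a b c d) (a b c d : Fin 4) :
    hodgeDual (confMetric u g) S y a b c d = k * hodgeDual g T y a b c d := by
  have he : Real.exp (-2 * u y) * Real.exp (2 * u y) = 1 := by
    rw [← Real.exp_add]; ring_nf; simp
  rw [hodgeDual, hodgeDual]
  simp only [Finset.mul_sum]
  refine Finset.sum_congr rfl fun e _ => Finset.sum_congr rfl fun f _ =>
    Finset.sum_congr rfl fun p _ => Finset.sum_congr rfl fun q _ => ?_
  rw [volForm_conf, hg.ginv_confMetric u hy, hg.ginv_confMetric u hy, h]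
  -- The factor `e^{4u}` of the volume form meets two inverse metrics. The sum in the multiplier
  -- comes from `x² - 1 = (x + 1)(x - 1)`.
  linear_combination (1 / 2 * (volForm g y a b e f * ginv g y e p * ginv g y f q * k
    * T y p q c d)) * (Real.exp (-2 * u y) * Real.exp (2 * u y) + 1) * he

lemma weylDual_conf (hg : LocalMetric Ω g) (hu : ContDiffOn ℝ ∞ u Ω) (hy : y ∈ Ω)
    (a b c d : Fin 4) :
    weylDual (confMetric u g) y a b c d = Real.exp (2 * u y) * weylDual g y a b c d :=
  hg.hodgeDual_conf u hy (hg.weyl_conf hu hy) a b c d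

/-! ### Smoothness -/

lemma contDiffOn_riemannUp (hg : LocalMetric Ω g) (a b c d : Fin 4) :
    ContDiffOn ℝ ∞ (fun z => riemannUp g z a b c d) Ω := by
  have h := hg.contDiffOn_christoffel
  have h' := fun i a b c => contDiffOn_pd hg.isOpen (h a b c) i
  unfold riemannUp
  exact ((h' c a d b).sub (h' d a c b)).add (ContDiffOn.sum fun e _ =>
    ((h a c e).mul (h e d b)).sub ((h a d e).mul (h e c b)))

lemma contDiffOn_ricci (hg : LocalMetric Ω g) (b d : Fin 4) :
    ContDiffOn ℝ ∞ (fun z => ricci g z b d) Ω :=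
  ContDiffOn.sum fun a _ => hg.contDiffOn_riemannUp a b a d

lemma contDiffOn_weyl (hg : LocalMetric Ω g) (a b c d : Fin 4) :
    ContDiffOn ℝ ∞ (fun z => weyl g z a b c d) Ω := by
  have h1 : ContDiffOn ℝ ∞ (fun z => riemann g z a b c d) Ω :=
    ContDiffOn.sum fun e _ => (hg.smooth a e).mul (hg.contDiffOn_riemannUp e b c d)
  have h2 : ContDiffOn ℝ ∞ (scalarCurv g) Ω :=
    ContDiffOn.sum fun a _ => ContDiffOn.sum fun b _ =>
      (hg.contDiffOn_ginv a b).mul (hg.contDiffOn_ricci a b)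
  have m := fun a b c d => (hg.smooth a b).mul (hg.contDiffOn_ricci c d)
  have k := fun a b c d => (hg.smooth a b).mul (hg.smooth c d)
  exact (h1.sub (contDiffOn_const.mul ((((m a c b d).sub (m a d b c)).sub (m b c a d)).add
    (m b d a c)))).add ((h2.div_const 6).mul ((k a c b d).sub (k a d b c)))

lemma diffAt_of_contDiffOn (hg : LocalMetric Ω g) (hy : y ∈ Ω) {T : TensorComp}
    (hT : ∀ a b c d, ContDiffOn ℝ ∞ (fun z => T z a b c d) Ω) : DiffAt T y :=
  fun a b c d => differentiableAt_of_contDiffOn hg.isOpen (hT a b c d) hy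

lemma diffAt_hodgeDual (hg : LocalMetric Ω g) (hy : y ∈ Ω) {T : TensorComp} (hT : DiffAt T y) :
    DiffAt (hodgeDual g T) y := fun a b c d => by
  have h1 := hg.differentiableAt_sqrt_det hy
  have h2 := fun a b => differentiableAt_of_contDiffOn hg.isOpen (hg.contDiffOn_ginv a b) hy
  exact (DifferentiableAt.fun_sum fun e _ => DifferentiableAt.fun_sum fun f _ =>
    DifferentiableAt.fun_sum fun p _ => DifferentiableAt.fun_sum fun q _ =>
      (((h1.mul_const (permSymbol a b e f)).fun_mul (h2 e p)).fun_mul (h2 f q)).fun_mul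
        (hT p q c d)).const_mul (1 / 2)

lemma covDeriv_congr (hg : LocalMetric Ω g) (hy : y ∈ Ω) {S T : TensorComp}
    (h : ∀ z ∈ Ω, S z = T z) : covDeriv g S y = covDeriv g T y := by
  funext a b c d e
  rw [covDeriv, covDeriv, pd_congr hg.isOpen hy (fun z hz => by rw [h z hz]) e, h y hy]

end LocalMetric

end

/-! ### Frame pairings in terms of raised indices, and the identity for the vector. -/

section

variable {B H G : Matrix (Fin 4) (Fin 4) ℂ} {u : Fin 4 → ℂ}
  {S T : Fin 4 → Fin 4 → Fin 4 → Fin 4 → ℂ} {F F' : Fin 4 → Fin 4 → Fin 4 → Fin 4 → Fin 4 → ℂ}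

/-- Raising the indices of a tensor of rank four with `H`. -/
def raiseFour (H : Matrix (Fin 4) (Fin 4) ℂ) (T : Fin 4 → Fin 4 → Fin 4 → Fin 4 → ℂ)
    (a b c d : Fin 4) : ℂ :=
  ∑ p, ∑ q, ∑ r, ∑ s, H a p * H b q * H c r * H d s * T p q r s

/-- Raising the indices of a tensor of rank five with `H`. -/
def raiseFive (H : Matrix (Fin 4) (Fin 4) ℂ) (F : Fin 4 → Fin 4 → Fin 4 → Fin 4 → Fin 4 → ℂ)
    (a b c d e : Fin 4) : ℂ :=
  ∑ p, ∑ q, ∑ r, ∑ s, ∑ t, H a p * H b q * H c r * H d s * H e t * F p q r s t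

/-- `∑ u_c F_{abcde} T_{ebad}` -/
def crossPair (u : Fin 4 → ℂ) (F : Fin 4 → Fin 4 → Fin 4 → Fin 4 → Fin 4 → ℂ)
    (T : Fin 4 → Fin 4 → Fin 4 → Fin 4 → ℂ) : ℂ :=
  ∑ a, ∑ b, ∑ c, ∑ d, ∑ e, F a b c d e * (u c * T e b a d)

lemma raiseFive_mul_last (H : Matrix (Fin 4) (Fin 4) ℂ) (u T) (a b c d e : Fin 4) :
    raiseFive H (fun a b c d e => u e * T a b c d) a b c d e
      = H.mulVec u e * raiseFour H T a b c d := by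
  rw [mul_comm, raiseFive, raiseFour]
  simp only [Finset.sum_mul]
  simp only [Matrix.mulVec, dotProduct, Finset.mul_sum]
  exact sum_congr_five fun p q r s t => by ring

lemma raiseFive_swap_ab (H : Matrix (Fin 4) (Fin 4) ℂ) (F) (a b c d e : Fin 4) :
    raiseFive H (fun a b c d e => F b a c d e) a b c d e = raiseFive H F b a c d e := by
  rw [raiseFive, raiseFive, sum_swap_ab]
  exact sum_congr_five fun p q r s t => by ring

lemma raiseFive_swap_bc (H : Matrix (Fin 4) (Fin 4) ℂ) (F) (a b c d e : Fin 4) :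
    raiseFive H (fun a b c d e => F a c b d e) a b c d e = raiseFive H F a c b d e := by
  rw [raiseFive, raiseFive, sum_swap_bc]
  exact sum_congr_five fun p q r s t => by ring

lemma raiseFive_swap_ae (H : Matrix (Fin 4) (Fin 4) ℂ) (F) (a b c d e : Fin 4) :
    raiseFive H (fun a b c d e => F e b c d a) a b c d e = raiseFive H F e b c d a := by
  rw [raiseFive, raiseFive, sum_swap_ae]
  exact sum_congr_five fun p q r s t => by ring

lemma raiseFive_mul_first (H : Matrix (Fin 4) (Fin 4) ℂ) (u T) (a b c d e : Fin 4) :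
    raiseFive H (fun a b c d e => u a * T e b c d) a b c d e
      = H.mulVec u a * raiseFour H T e b c d := by
  rw [raiseFive_swap_ae H fun a b c d e => u e * T a b c d, raiseFive_mul_last]

lemma raiseFive_mul_third (H : Matrix (Fin 4) (Fin 4) ℂ) (u T) (a b c d e : Fin 4) :
    raiseFive H (fun a b c d e => u c * T e b a d) a b c d e
      = H.mulVec u c * raiseFour H T e b a d := by
  rw [raiseFive_swap_ab H fun a b c d e => u c * T e a b d,
    raiseFive_swap_bc H fun a b c d e => u b * T e a c d,
    raiseFive_swap_ab H fun a b c d e => u a * T e b c d, raiseFive_mul_first]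

lemma raiseFive_metric (hs : H.transpose = H) (hG : H * G = 1) (u T) (a b c d e : Fin 4) :
    raiseFive H (fun a b c d e => G e a * ∑ f, H.mulVec u f * T f b c d) a b c d e
      = H e a * ∑ p, u p * raiseFour H T p b c d := by
  have hs' : ∀ i j, H i j = H j i := fun i j => by conv_lhs => rw [← hs, Matrix.transpose_apply]
  have h1 : ∀ x : ℂ, ∑ p, ∑ t, H a p * H e t * (G t p * x) = H e a * x := fun x => by
    have h : ∑ p, ∑ t, H a p * H e t * G t p = H e a := by
      have : (H * G * H.transpose) e a = H e a := by rw [hG, hs, Matrix.one_mul]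
      rw [← this]
      simp only [Matrix.mul_apply, Matrix.transpose_apply, Finset.sum_mul]
      exact Finset.sum_congr rfl fun _ _ => Finset.sum_congr rfl fun _ _ => by ring
    rw [← h]
    simp only [Finset.sum_mul, mul_assoc]
  have h2 : ∑ p, u p * raiseFour H T p b c d = ∑ q, ∑ r, ∑ s, H b q * H c r * H d s *
      ∑ f, H.mulVec u f * T f q r s := by
    have : ∀ q r s, ∑ f, H.mulVec u f * T f q r s = ∑ p, u p * ∑ f, H p f * T f q r s := by
      intro q r s
      simp only [Matrix.mulVec, dotProduct, Finset.sum_mul, Finset.mul_sum]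
      rw [Finset.sum_comm]
      exact Finset.sum_congr rfl fun p _ => Finset.sum_congr rfl fun f _ => by
        rw [hs' f p]; ring
    simp only [this, raiseFour, Finset.mul_sum]
    rw [sum_swap_bc, sum_swap_cd, sum_swap_de, sum_swap_ab, sum_swap_bc, sum_swap_cd]
    exact sum_congr_five fun _ _ _ _ _ => by ring
  rw [h2, ← h1, raiseFive, sum_swap_de, sum_swap_cd, sum_swap_bc]
  refine Finset.sum_congr rfl fun p _ => Finset.sum_congr rfl fun t _ => ?_
  simp only [Finset.mul_sum]
  refine Finset.sum_congr rfl fun q _ => Finset.sum_congr rfl fun r _ =>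
    Finset.sum_congr rfl fun s _ => Finset.sum_congr rfl fun f _ => by ring

lemma frame5_mul_third (B : Matrix (Fin 4) (Fin 4) ℂ) (u T) (i j k l m : Fin 4) :
    frame5 B (fun a b c d e => u c * T e b a d) i j k l m
      = frame1 B u k * frame4 B T m j i l := by
  rw [frame5_swap_ab B fun a b c d e => u c * T e a b d,
    frame5_swap_bc B fun a b c d e => u b * T e a c d,
    frame5_swap_ab B fun a b c d e => u a * T e b c d, frame5_mul_first]

lemma frame5_swap_ae (B : Matrix (Fin 4) (Fin 4) ℂ) (X) (i j k l m : Fin 4) :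
    frame5 B (fun a b c d e => X e b c d a) i j k l m = frame5 B X m j k l i := by
  rw [frame5, frame5, sum_swap_ae]
  exact sum_congr_five fun a b c d e => by ring

lemma sum_frame5_mul_raise (hB : H = B * B.transpose) (F F') :
    ∑ i, ∑ j, ∑ k, ∑ l, ∑ m, frame5 B F i j k l m * frame5 B F' i j k l m
      = ∑ a, ∑ b, ∑ c, ∑ d, ∑ e, F a b c d e * raiseFive H F' a b c d e :=
  sum_frame5_mul hB F F'

lemma sum_frame5_mul_twist (hB : H = B * B.transpose) (F F') :
    ∑ i, ∑ j, ∑ k, ∑ l, ∑ m, frame5 B F i j k l m * frame5 B F' m j k l i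
      = ∑ a, ∑ b, ∑ c, ∑ d, ∑ e, F a b c d e * raiseFive H F' e b c d a := by
  have h := sum_frame5_mul_raise hB F fun a b c d e => F' e b c d a
  simpa only [frame5_swap_ae, raiseFive_swap_ae] using h

lemma gradPair_frame (hB : H = B * B.transpose) (u F T) :
    gradPair (frame1 B u) (frame5 B F) (frame4 B T)
      = ∑ a, ∑ b, ∑ c, ∑ d, ∑ e, F a b c d e * (H.mulVec u e * raiseFour H T a b c d) := by
  have h := sum_frame5_mul_raise hB F fun a b c d e => u e * T a b c d
  simp only [frame5_mul_last, raiseFive_mul_last] at h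
  exact h

lemma twistPair_frame (hB : H = B * B.transpose) (u F T) :
    twistPair (frame1 B u) (frame5 B F) (frame4 B T)
      = ∑ a, ∑ b, ∑ c, ∑ d, ∑ e, F a b c d e * (H.mulVec u a * raiseFour H T e b c d) := by
  have h := sum_frame5_mul_raise hB F fun a b c d e => u a * T e b c d
  simp only [frame5_mul_first, raiseFive_mul_first] at h
  exact h

lemma crossPair_frame (hB : H = B * B.transpose) (u F T) :
    crossPair (frame1 B u) (frame5 B F) (frame4 B T)
      = ∑ a, ∑ b, ∑ c, ∑ d, ∑ e, F a b c d e * (H.mulVec u c * raiseFour H T e b a d) := by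
  have h := sum_frame5_mul_raise hB F fun a b c d e => u c * T e b a d
  simp only [frame5_mul_third, raiseFive_mul_third] at h
  exact h

/-- The tensor `g_{ea} v^f T_{fbcd}` becomes a Kronecker delta times a contraction in the frame, so
pairing with it takes a divergence; raised, it carries the inverse metric. -/
lemma divPair_frame (hB : H = B * B.transpose) (hG : H * G = 1) (u F T) :
    divPair (frame1 B u) (frame5 B F) (frame4 B T) = ∑ a, ∑ b, ∑ c, ∑ d, ∑ e,
      F a b c d e * (H e a * ∑ p, u p * raiseFour H T p b c d) := by
  have hs : H.transpose = H := by rw [hB, Matrix.transpose_mul, Matrix.transpose_transpose]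
  have h := sum_frame5_mul_raise hB F fun a b c d e => G e a * ∑ f, H.mulVec u f * T f b c d
  simp only [frame5_metric_first hB hG, raiseFive_metric hs hG] at h
  rw [← h]
  simp only [divPair, Matrix.one_apply, ite_mul, one_mul, zero_mul, mul_ite, mul_zero,
    Finset.sum_ite_eq', Finset.mem_univ, if_true]

/-- The first Bianchi identity halves a contraction with interchanged indices. -/
lemma twistPair_eq_crossPair (hF : ∀ e, WeylSymm 1 (fun a b c d => F a b c d e))
    (hT : WeylSymm 1 T) (u : Fin 4 → ℂ) : twistPair u F T = 2 * crossPair u F T := by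
  have h1 : crossPair u F T = ∑ a, ∑ b, ∑ c, ∑ d, ∑ e, F a b c d e * (u a * T e d c b) := by
    rw [crossPair, sum_swap_pairs]
    exact sum_congr_five fun a b c d e => by rw [(hF e).pair_symm]
  have h2 : crossPair u F T = -∑ a, ∑ b, ∑ c, ∑ d, ∑ e, F a b c d e * (u a * T e c d b) := by
    rw [h1, sum_neg_five, sum_swap_cd]
    exact sum_congr_five fun a b c d e => by
      rw [(hF e).antisymm_right]; ring
  have h3 : twistPair u F T + ∑ a, ∑ b, ∑ c, ∑ d, ∑ e, F a b c d e * (u a * T e c d b)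
      - ∑ a, ∑ b, ∑ c, ∑ d, ∑ e, F a b c d e * (u a * T e d c b) = 0 := by
    simp only [twistPair, ← Finset.sum_add_distrib, ← Finset.sum_sub_distrib]
    refine Finset.sum_eq_zero fun a _ => Finset.sum_eq_zero fun b _ =>
      Finset.sum_eq_zero fun c _ => Finset.sum_eq_zero fun d _ => Finset.sum_eq_zero fun e _ => ?_
    rw [hT.antisymm_right e d b c]
    linear_combination F a b c d e * u a * hT.bianchi e b c d
  linear_combination h3 - h1 - h2

/-- The divergence identity behind the vanishing of a vector quadratic in a Weyl-like tensor. -/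
lemma pair_identity (hF : ∀ e, WeylSymm 1 (fun a b c d => F a b c d e))
    (hT : WeylSymm 1 T) (u : Fin 4 → ℂ) :
    -8 * gradPair u F T - 16 * twistPair u F T + 16 * divPair u F T + 64 * crossPair u F T = 0 := by
  linear_combination 16 * divPair_eq hF hT u - 32 * twistPair_eq_crossPair hF hT u

end

/-! ### Passage from real contractions to complex frames. -/

section

open LocalMetric

/-- The complexification of a tensor of rank four. -/
def castFour (T : Fin 4 → Fin 4 → Fin 4 → Fin 4 → ℝ) (a b c d : Fin 4) : ℂ := (T a b c d : ℂ)

/-- The complexification of a tensor of rank five. -/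
def castFive (F : Fin 4 → Fin 4 → Fin 4 → Fin 4 → Fin 4 → ℝ) (a b c d e : Fin 4) : ℂ :=
  (F a b c d e : ℂ)

/-- The complexification of a matrix. -/
def castMatrix (h : Matrix (Fin 4) (Fin 4) ℝ) : Matrix (Fin 4) (Fin 4) ℂ := h.map fun x => (x : ℂ)

/-- The contraction of two tensors of rank five. -/
def contrFive (h : Matrix (Fin 4) (Fin 4) ℝ) (F F' : Fin 4 → Fin 4 → Fin 4 → Fin 4 → Fin 4 → ℝ) :
    ℝ :=
  ∑ a, ∑ b, ∑ c, ∑ d, ∑ e, F a b c d e * ∑ p, ∑ q, ∑ r, ∑ s, ∑ t,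
    h a p * h b q * h c r * h d s * h e t * F' p q r s t

/-- The contraction of two tensors of rank five with the first and last index interchanged. -/
def contrTwist (h : Matrix (Fin 4) (Fin 4) ℝ) (F F' : Fin 4 → Fin 4 → Fin 4 → Fin 4 → Fin 4 → ℝ) :
    ℝ :=
  ∑ a, ∑ b, ∑ c, ∑ d, ∑ e, F a b c d e * ∑ p, ∑ q, ∑ r, ∑ s, ∑ t,
    h e p * h b q * h c r * h d s * h a t * F' p q r s t

section Algebra

variable {B : Matrix (Fin 4) (Fin 4) ℂ} {h G : Matrix (Fin 4) (Fin 4) ℝ} {u : Fin 4 → ℝ}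
  {S T : Fin 4 → Fin 4 → Fin 4 → Fin 4 → ℝ} {F F' : Fin 4 → Fin 4 → Fin 4 → Fin 4 → Fin 4 → ℝ}

lemma contr4_cast_raise (h : Matrix (Fin 4) (Fin 4) ℝ) (S T) : ((contr4 h S T : ℝ) : ℂ) = ∑ a, ∑ b, ∑ c, ∑ d,
    castFour S a b c d * raiseFour (castMatrix h) (castFour T) a b c d := by
  simp only [contr4, Complex.ofReal_sum, Complex.ofReal_mul]
  rfl

lemma contr4_cast (hB : castMatrix h = B * B.transpose) (S T) :
    ((contr4 h S T : ℝ) : ℂ) = ∑ i, ∑ j, ∑ k, ∑ l,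
      frame4 B (castFour S) i j k l * frame4 B (castFour T) i j k l := by
  rw [sum_frame4_mul hB, contr4_cast_raise]
  rfl

lemma contrFive_cast (hB : castMatrix h = B * B.transpose) (F F') :
    (contrFive h F F' : ℂ) = ∑ i, ∑ j, ∑ k, ∑ l, ∑ m,
      frame5 B (castFive F) i j k l m * frame5 B (castFive F') i j k l m := by
  rw [sum_frame5_mul hB]
  simp only [contrFive, Complex.ofReal_sum, Complex.ofReal_mul]
  rfl

lemma contrTwist_cast (hB : castMatrix h = B * B.transpose) (F F') :
    (contrTwist h F F' : ℂ) = ∑ i, ∑ j, ∑ k, ∑ l, ∑ m,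
      frame5 B (castFive F) i j k l m * frame5 B (castFive F') m j k l i := by
  rw [sum_frame5_mul_twist hB]
  simp only [contrTwist, Complex.ofReal_sum, Complex.ofReal_mul]
  rfl

lemma contr4_smul (k l : ℝ) (h S T) :
    contr4 (k • h) (fun a b c d => l * S a b c d) (fun a b c d => l * T a b c d)
      = k ^ 4 * l ^ 2 * contr4 h S T := by
  simp only [contr4, Finset.mul_sum, Matrix.smul_apply, smul_eq_mul]
  refine Finset.sum_congr rfl fun _ _ => Finset.sum_congr rfl fun _ _ =>
    Finset.sum_congr rfl fun _ _ => Finset.sum_congr rfl fun _ _ =>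
    Finset.sum_congr rfl fun _ _ => Finset.sum_congr rfl fun _ _ =>
    Finset.sum_congr rfl fun _ _ => Finset.sum_congr rfl fun _ _ => by ring

lemma contrFive_smul (k l : ℝ) (h F F') :
    contrFive (k • h) (fun a b c d e => l * F a b c d e) (fun a b c d e => l * F' a b c d e)
      = k ^ 5 * l ^ 2 * contrFive h F F' := by
  simp only [contrFive, Finset.mul_sum, Matrix.smul_apply, smul_eq_mul]
  refine Finset.sum_congr rfl fun _ _ => Finset.sum_congr rfl fun _ _ =>
    Finset.sum_congr rfl fun _ _ => Finset.sum_congr rfl fun _ _ =>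
    Finset.sum_congr rfl fun _ _ => Finset.sum_congr rfl fun _ _ =>
    Finset.sum_congr rfl fun _ _ => Finset.sum_congr rfl fun _ _ =>
    Finset.sum_congr rfl fun _ _ => Finset.sum_congr rfl fun _ _ => by ring

lemma contrTwist_smul (k l : ℝ) (h F F') :
    contrTwist (k • h) (fun a b c d e => l * F a b c d e) (fun a b c d e => l * F' a b c d e)
      = k ^ 5 * l ^ 2 * contrTwist h F F' := by
  simp only [contrTwist, Finset.mul_sum, Matrix.smul_apply, smul_eq_mul]
  refine Finset.sum_congr rfl fun _ _ => Finset.sum_congr rfl fun _ _ =>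
    Finset.sum_congr rfl fun _ _ => Finset.sum_congr rfl fun _ _ =>
    Finset.sum_congr rfl fun _ _ => Finset.sum_congr rfl fun _ _ =>
    Finset.sum_congr rfl fun _ _ => Finset.sum_congr rfl fun _ _ =>
    Finset.sum_congr rfl fun _ _ => Finset.sum_congr rfl fun _ _ => by ring

lemma castMatrix_mulVec (h : Matrix (Fin 4) (Fin 4) ℝ) (u : Fin 4 → ℝ) :
    (castMatrix h).mulVec (fun a => (u a : ℂ)) = fun a => ((h.mulVec u a : ℝ) : ℂ) := by
  funext a
  simp [Matrix.mulVec, dotProduct, castMatrix]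

lemma castFive_add_confTerm (w : ℝ) (h G u S F) :
    castFive (fun a b c d e => F a b c d e + confTerm w G u (h.mulVec u) S a b c d e)
      = fun a b c d e => castFive F a b c d e
        + confTerm (w : ℂ) (castMatrix G) (fun a => (u a : ℂ))
          ((castMatrix h).mulVec fun a => (u a : ℂ)) (castFour S) a b c d e := by
  funext a b c d e
  rw [castMatrix_mulVec]
  simp only [castFive, confTerm, castFour, castMatrix, Matrix.map_apply]
  push_cast
  rfl

lemma castMatrix_mul (hG : h * G = 1) : castMatrix h * castMatrix G = 1 := by
  have := congrArg (fun X : Matrix (Fin 4) (Fin 4) ℝ => X.map (Complex.ofRealHom)) hG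
  simp only [Matrix.map_mul] at this
  rw [castMatrix, castMatrix]
  refine Eq.trans this ?_
  ext i j
  simp [Matrix.one_apply]

lemma frame5_cast_confTerm (hB : castMatrix h = B * B.transpose) (hG : h * G = 1) (w : ℝ) (u S F)
    (i j k l m : Fin 4) :
    frame5 B (castFive fun a b c d e =>
        F a b c d e + confTerm w G u (h.mulVec u) S a b c d e) i j k l m
      = frame5 B (castFive F) i j k l m
        + confTerm (w : ℂ) 1 (frame1 B fun a => (u a : ℂ)) (frame1 B fun a => (u a : ℂ))
          (frame4 B (castFour S)) i j k l m := by
  rw [castFive_add_confTerm, frame5_add, frame5_confTerm hB (castMatrix_mul hG)]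

lemma sum_frame1_mul (hB : castMatrix h = B * B.transpose) (u : Fin 4 → ℝ) :
    ∑ i, frame1 B (fun a => (u a : ℂ)) i * frame1 B (fun a => (u a : ℂ)) i
      = ((∑ e, ∑ f, h e f * u e * u f : ℝ) : ℂ) := by
  have h1 : ∀ e f, (h e f : ℂ) = ∑ i, B e i * B f i := fun e f => by
    have := congrFun (congrFun hB e) f
    simpa [castMatrix, Matrix.mul_apply] using this
  push_cast
  simp only [frame1, Finset.sum_mul_sum]
  rw [Finset.sum_comm]
  refine Finset.sum_congr rfl fun e _ => ?_
  rw [Finset.sum_comm]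
  refine Finset.sum_congr rfl fun f _ => ?_
  rw [h1, Finset.sum_mul, Finset.sum_mul]
  exact Finset.sum_congr rfl fun i _ => by ring

/-- The contraction of a tensor of rank five with a vector and a tensor of rank four. -/
lemma gradPair_cast (hB : castMatrix h = B * B.transpose) (u F T) :
    gradPair (frame1 B fun a => (u a : ℂ)) (frame5 B (castFive F)) (frame4 B (castFour T))
      = ((∑ e, h.mulVec u e * contr4 h (fun a b c d => F a b c d e) T : ℝ) : ℂ) := by
  rw [gradPair_frame hB, castMatrix_mulVec]
  push_cast
  simp only [contr4_cast_raise, Finset.mul_sum]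
  rw [sum_swap_de, sum_swap_cd, sum_swap_bc, sum_swap_ab]
  exact sum_congr_five fun _ _ _ _ _ => by simp only [castFive, castFour]; ring

/-- The algebraic identity behind conformal covariance. -/
lemma contraction_identity (hB : castMatrix h = B * B.transpose) (hG : h * G = 1) (w : ℝ) (u)
    (hS : WeylSymm 1 (frame4 B (castFour S))) (hT : WeylSymm 1 (frame4 B (castFour T)))
    (hF : ∀ m, WeylSymm 1 (fun i j k l => frame5 B (castFive F) i j k l m))
    (hF' : ∀ m, WeylSymm 1 (fun i j k l => frame5 B (castFive F') i j k l m))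
    {I L N : ℝ} (hI : contr4 h S T = I) (hN : ∑ e, ∑ f, h e f * u e * u f = N)
    (hL : ∑ e, h.mulVec u e * (contr4 h (fun a b c d => F a b c d e) T
      + contr4 h S fun a b c d => F' a b c d e) = L) :
    (w - 5) * contrFive h
        (fun a b c d e => F a b c d e + confTerm w G u (h.mulVec u) S a b c d e)
        (fun a b c d e => F' a b c d e + confTerm w G u (h.mulVec u) T a b c d e)
      + 8 * contrTwist h
        (fun a b c d e => F a b c d e + confTerm w G u (h.mulVec u) S a b c d e)
        (fun a b c d e => F' a b c d e + confTerm w G u (h.mulVec u) T a b c d e)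
      = (w - 5) * contrFive h F F' + 8 * contrTwist h F F'
        + ((w - 5) * (w - 2) - 4) * L
        + ((w - 5) * ((w - 4) ^ 2 + 6) + 2 * (w ^ 2 - 14 * w + 43)) * (N * I) := by
  have comm : ∀ e, contr4 h S (fun a b c d => F' a b c d e)
      = contr4 h (fun a b c d => F' a b c d e) S := fun e => by
    have : ((contr4 h S (fun a b c d => F' a b c d e) : ℝ) : ℂ)
        = ((contr4 h (fun a b c d => F' a b c d e) S : ℝ) : ℂ) := by
      rw [contr4_cast hB, contr4_cast hB]; simp only [mul_comm]
    exact_mod_cast this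
  simp only [comm, mul_add, Finset.sum_add_distrib] at hL
  have c1 := contraction_confTerm hS hT hF hF' (w : ℂ) (frame1 B fun a => (u a : ℂ))
  have c2 := contraction_confTerm_twist hS hT hF hF' (w : ℂ) (frame1 B fun a => (u a : ℂ))
  simp only [← frame5_cast_confTerm hB hG] at c1 c2
  rw [← contrFive_cast hB, ← contrFive_cast hB] at c1
  rw [← contrTwist_cast hB, ← contrTwist_cast hB] at c2
  rw [sum_frame1_mul hB, hN, ← contr4_cast hB, hI, gradPair_cast hB, gradPair_cast hB,
    ← Complex.ofReal_add, hL] at c1 c2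
  have : ∀ x y : ℝ, (x : ℂ) = y → x = y := fun x y h => Complex.ofReal_injective h
  apply this
  push_cast
  -- The multipliers `w - 5` and `8` cancel the twisted pairings, which have coefficients `-8` and
  -- `w - 5` respectively.
  linear_combination ((w : ℂ) - 5) * c1 + 8 * c2

end Algebra

end

/-! ### Conformal covariance of the polarised invariant. -/

section

open LocalMetric

variable {Ω : Set E4} {g : MetricComp} {u : E4 → ℝ} {y : E4}

/-- A tensor field and its covariant derivative have, in every complex orthonormal frame at `y`,
the index symmetries of the Weyl tensor. -/
def WeylJet (g : MetricComp) (S : TensorComp) (y : E4) : Prop :=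
  ∀ B : Matrix (Fin 4) (Fin 4) ℂ, castMatrix (g y)⁻¹ = B * B.transpose →
    WeylSymm 1 (frame4 B (castFour (S y))) ∧
    ∀ m, WeylSymm 1 (fun i j k l => frame5 B (castFive (covDeriv g S y)) i j k l m)

lemma WeylSymm.castFour {h : Matrix (Fin 4) (Fin 4) ℝ} {T : Fin 4 → Fin 4 → Fin 4 → Fin 4 → ℝ}
    (hT : WeylSymm h T) : WeylSymm (castMatrix h) (castFour T) where
  antisymm_left a b c d := by simp only [ConfCov.castFour]; exact_mod_cast hT.antisymm_left a b c d
  antisymm_right a b c d := by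
    simp only [ConfCov.castFour]; exact_mod_cast hT.antisymm_right a b c d
  pair_symm a b c d := by simp only [ConfCov.castFour]; exact_mod_cast hT.pair_symm a b c d
  bianchi a b c d := by simp only [ConfCov.castFour]; exact_mod_cast hT.bianchi a b c d
  trace_free b d := by
    simp only [ConfCov.castFour, castMatrix, Matrix.map_apply]
    exact_mod_cast hT.trace_free b d

/-- Changing the frame in the derivative index mixes the slices of a covariant derivative linearly,
and the symmetries are linear conditions. -/
lemma WeylSymm.linear_combination {h : Matrix (Fin 4) (Fin 4) ℂ}
    {F : Fin 4 → Fin 4 → Fin 4 → Fin 4 → Fin 4 → ℂ}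
    (hF : ∀ e, WeylSymm h (fun a b c d => F a b c d e)) (k : Fin 4 → ℂ) :
    WeylSymm h (fun a b c d => ∑ e, k e * F a b c d e) where
  antisymm_left a b c d := by
    simp only [fun e => (hF e).antisymm_left a b c d, mul_neg, Finset.sum_neg_distrib]
  antisymm_right a b c d := by
    simp only [fun e => (hF e).antisymm_right a b c d, mul_neg, Finset.sum_neg_distrib]
  pair_symm a b c d := by simp only [fun e => (hF e).pair_symm a b c d]
  bianchi a b c d := by
    simp only [← Finset.sum_add_distrib, ← mul_add, fun e => (hF e).bianchi a b c d, mul_zero,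
      Finset.sum_const_zero]
  trace_free b d := by
    have h1 : ∀ e, k e * ∑ a, ∑ c, h a c * F a b c d e = 0 := fun e => by
      rw [(hF e).trace_free b d, mul_zero]
    rw [← Finset.sum_eq_zero fun e (_ : e ∈ Finset.univ) => h1 e]
    simp only [Finset.mul_sum]
    rw [Finset.sum_congr rfl fun _ _ => Finset.sum_comm, Finset.sum_comm]
    exact Finset.sum_congr rfl fun _ _ => Finset.sum_congr rfl fun _ _ =>
      Finset.sum_congr rfl fun _ _ => by ring

lemma frame5_eq_sum (B : Matrix (Fin 4) (Fin 4) ℂ) (F) (i j k l m : Fin 4) :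
    frame5 B F i j k l m = ∑ e, B e m * frame4 B (fun a b c d => F a b c d e) i j k l := by
  simp only [frame5, frame4, Finset.mul_sum]
  rw [sum_swap_de, sum_swap_cd, sum_swap_bc, sum_swap_ab]
  exact sum_congr_five fun _ _ _ _ _ => by ring

lemma LocalMetric.weylJet (hg : LocalMetric Ω g) (hy : y ∈ Ω) {W : TensorComp} (hW : DiffAt W y)
    (hs : ∀ z ∈ Ω, WeylSymm (g z)⁻¹ (W z)) : WeylJet g W y := fun B hB => by
  refine ⟨(hs y hy).castFour.frame4 hB, fun m => ?_⟩
  simp only [frame5_eq_sum]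
  exact WeylSymm.linear_combination (F := fun i j k l e =>
    frame4 B (fun a b c d => castFive (covDeriv g W y) a b c d e) i j k l)
    (fun e => (hg.weylSymm_covDeriv hy hW hs e).castFour.frame4 hB) (fun e => B e m)

lemma castFour_hodge (G : MetricComp) (y : E4) (T : Fin 4 → Fin 4 → Fin 4 → Fin 4 → ℝ) :
    castFour (fun a b c d => (1 / 2) * ∑ e, ∑ f, ∑ p, ∑ q,
        volForm G y a b e f * ginv G y e p * ginv G y f q * T p q c d)
      = fun a b c d => (1 / 2) * ∑ e, ∑ f, ∑ p, ∑ q,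
        (((√|(G y).det| : ℝ) : ℂ) * ((permSymbol a b e f : ℝ) : ℂ)) * castMatrix (G y)⁻¹ e p
          * castMatrix (G y)⁻¹ f q * castFour T p q c d := by
  funext a b c d
  simp only [castFour, volForm, castMatrix, Matrix.map_apply, ginv]
  push_cast
  rfl

/-- The Hodge dual of a Weyl-like tensor is Weyl-like. -/
lemma LocalMetric.weylJet_hodgeDual (hg : LocalMetric Ω g) (hy : y ∈ Ω) {W : TensorComp}
    (hW : DiffAt W y) (hs : ∀ z ∈ Ω, WeylSymm (g z)⁻¹ (W z)) : WeylJet g (hodgeDual g W) y :=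
  fun B hB => by
    -- Stated for a general `T`, because it is needed both for `W` and for every slice of its
    -- covariant derivative, with which duality commutes.
    have key : ∀ T : Fin 4 → Fin 4 → Fin 4 → Fin 4 → ℝ, WeylSymm (g y)⁻¹ T →
        WeylSymm 1 (frame4 B (castFour fun a b c d => (1 / 2) * ∑ e, ∑ f, ∑ p, ∑ q,
          volForm g y a b e f * ginv g y e p * ginv g y f q * T p q c d)) := fun T hT => by
      have h := (hT.castFour.frame4 hB).unitDual (((√|(g y).det| : ℝ) : ℂ) * B.det)
      rw [castFour_hodge]
      convert h using 1
      funext i j k l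
      exact frame4_hodge hB _ _ i j k l
    refine ⟨key (W y) (hs y hy), fun m => ?_⟩
    simp only [frame5_eq_sum]
    refine WeylSymm.linear_combination (F := fun i j k l e =>
      frame4 B (fun a b c d => castFive (covDeriv g (hodgeDual g W) y) a b c d e) i j k l)
      (fun e => ?_) (fun e => B e m)
    have h := key _ (hg.weylSymm_covDeriv hy hW hs e)
    convert h using 3
    simp only [castFive, hg.covDeriv_hodgeDual hy hW]
    rfl

/-- The weighted invariant, polarized. -/
def pairInvariant (w : ℝ) (g : MetricComp) (S T : TensorComp) (y : E4) : ℝ :=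
  4 * (w - 4) * (w - 5) * (contr g S T y * gradContr g S T y)
    + 32 * (w - 4) * (contr g S T y * gradContrTwist g S T y)
    + (w - 1) * (6 - w) * gradSq g (contr g S T) y

lemma contr_conf (hg : LocalMetric Ω g) (u : E4 → ℝ) (w : ℝ) (hy : y ∈ Ω) (S T : TensorComp) :
    contr (confMetric u g) (fun z a b c d => Real.exp (w * u z) * S z a b c d)
      (fun z a b c d => Real.exp (w * u z) * T z a b c d) y
      = Real.exp ((2 * w - 8) * u y) * contr g S T y := by
  have he : Real.exp ((2 * w - 8) * u y) = Real.exp (-2 * u y) ^ 4 * Real.exp (w * u y) ^ 2 := by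
    rw [← Real.exp_nat_mul, ← Real.exp_nat_mul, ← Real.exp_add]; congr 1; push_cast; ring
  have h := contr4_smul (Real.exp (-2 * u y)) (Real.exp (w * u y)) (g y)⁻¹ (S y) (T y)
  rw [← inv_confMetric u g y (hg.det_ne_zero y hy), ← he] at h
  exact h

lemma differentiableAt_contr (hg : LocalMetric Ω g) (hy : y ∈ Ω) {S T : TensorComp}
    (hS : DiffAt S y) (hT : DiffAt T y) : DifferentiableAt ℝ (contr g S T) y := by
  have h := fun a b => differentiableAt_of_contDiffOn hg.isOpen (hg.contDiffOn_ginv a b) hy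
  exact DifferentiableAt.fun_sum fun a _ => DifferentiableAt.fun_sum fun b _ =>
    DifferentiableAt.fun_sum fun c _ => DifferentiableAt.fun_sum fun d _ =>
    (hS a b c d).fun_mul <| DifferentiableAt.fun_sum fun p _ => DifferentiableAt.fun_sum fun q _ =>
    DifferentiableAt.fun_sum fun r _ => DifferentiableAt.fun_sum fun s _ =>
    ((((h a p).fun_mul (h b q)).fun_mul (h c r)).fun_mul (h d s)).fun_mul (hT p q r s)

lemma pd_contr_conf (hg : LocalMetric Ω g) (hu : ContDiffOn ℝ ∞ u Ω) (w : ℝ) (hy : y ∈ Ω)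
    {S T : TensorComp} (hS : DiffAt S y) (hT : DiffAt T y) (e : Fin 4) :
    pd e (contr (confMetric u g) (fun z a b c d => Real.exp (w * u z) * S z a b c d)
      (fun z a b c d => Real.exp (w * u z) * T z a b c d)) y
      = Real.exp ((2 * w - 8) * u y)
        * (pd e (contr g S T) y + (2 * w - 8) * (contr g S T y * grad u y e)) := by
  have hd := differentiableAt_of_contDiffOn hg.isOpen hu hy
  rw [pd_congr hg.isOpen hy (fun z hz => contr_conf hg u w hz S T) e,
    pd_mul (hd.const_mul _).exp (differentiableAt_contr hg hy hS hT), pd_exp_mul hd, grad]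
  ring

lemma gradSq_conf (hg : LocalMetric Ω g) (hu : ContDiffOn ℝ ∞ u Ω) (w : ℝ) (hy : y ∈ Ω)
    {S T : TensorComp} (hS : DiffAt S y) (hT : DiffAt T y) :
    gradSq (confMetric u g) (contr (confMetric u g)
      (fun z a b c d => Real.exp (w * u z) * S z a b c d)
      (fun z a b c d => Real.exp (w * u z) * T z a b c d)) y
      = Real.exp (-2 * u y) * Real.exp ((2 * w - 8) * u y) ^ 2 * (gradSq g (contr g S T) y
        + 2 * (2 * w - 8) * (contr g S T y
          * ∑ e, (g y)⁻¹.mulVec (grad u y) e * pd e (contr g S T) y)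
        + (2 * w - 8) ^ 2 * (contr g S T y ^ 2
          * ∑ e, ∑ f, (g y)⁻¹ e f * grad u y e * grad u y f)) := by
  have h1 : ∑ e, (g y)⁻¹.mulVec (grad u y) e * pd e (contr g S T) y
      = ∑ e, ∑ f, ginv g y e f * pd e (contr g S T) y * grad u y f := by
    simp only [Matrix.mulVec, dotProduct, Finset.sum_mul, ginv]
    exact Finset.sum_congr rfl fun e _ => Finset.sum_congr rfl fun f _ => by ring
  have h2 : ∑ e, (g y)⁻¹.mulVec (grad u y) e * pd e (contr g S T) y
      = ∑ e, ∑ f, ginv g y e f * grad u y e * pd f (contr g S T) y := by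
    rw [h1, Finset.sum_comm]
    exact Finset.sum_congr rfl fun e _ => Finset.sum_congr rfl fun f _ => by
      rw [hg.ginv_symm hy f e]; ring
  have h3 : 2 * (2 * w - 8) * (contr g S T y * ∑ e, (g y)⁻¹.mulVec (grad u y) e * pd e (contr g S T) y)
      = (2 * w - 8) * contr g S T y * (∑ e, ∑ f, ginv g y e f * pd e (contr g S T) y * grad u y f)
        + (2 * w - 8) * contr g S T y * (∑ e, ∑ f, ginv g y e f * grad u y e * pd f (contr g S T) y) := by
    rw [← h1, ← h2]; ring
  rw [h3, gradSq, gradSq]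
  simp only [Finset.mul_sum, ← Finset.sum_add_distrib, pd_contr_conf hg hu w hy hS hT,
    hg.ginv_confMetric u hy]
  simp only [ginv]
  exact Finset.sum_congr rfl fun e _ => Finset.sum_congr rfl fun f _ => by ring

/-- Conformal covariance of the weighted invariant. -/
theorem pairInvariant_conf (hg : LocalMetric Ω g) (hu : ContDiffOn ℝ ∞ u Ω) (w : ℝ) (hy : y ∈ Ω)
    {S T : TensorComp} (hS : DiffAt S y) (hT : DiffAt T y) (jS : WeylJet g S y)
    (jT : WeylJet g T y) :
    pairInvariant w (confMetric u g) (fun z a b c d => Real.exp (w * u z) * S z a b c d)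
      (fun z a b c d => Real.exp (w * u z) * T z a b c d) y
      = Real.exp ((4 * w - 18) * u y) * pairInvariant w g S T y := by
  obtain ⟨B, hB⟩ := exists_orthonormal_frame (hg.transpose_inv hy)
  have key := contraction_identity hB (hg.inv_mul hy) w (grad u y) (jS B hB).1 (jT B hB).1
    (jS B hB).2 (jT B hB).2 (I := contr g S T y) rfl rfl rfl
  have h1 : ∀ (X : TensorComp), DiffAt X y →
      covDeriv (confMetric u g) (fun z a b c d => Real.exp (w * u z) * X z a b c d) y
      = fun a b c d e => Real.exp (w * u y) * (covDeriv g X y a b c d e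
        + confTerm w (g y) (grad u y) ((g y)⁻¹.mulVec (grad u y)) (X y) a b c d e) := fun X hX => by
    funext a b c d e
    exact hg.covDeriv_conf hu hy hX w a b c d e
  have h2 : gradContr (confMetric u g) (fun z a b c d => Real.exp (w * u z) * S z a b c d)
      (fun z a b c d => Real.exp (w * u z) * T z a b c d) y = contrFive (confMetric u g y)⁻¹
      (covDeriv (confMetric u g) (fun z a b c d => Real.exp (w * u z) * S z a b c d) y)
      (covDeriv (confMetric u g) (fun z a b c d => Real.exp (w * u z) * T z a b c d) y) := rfl
  have h3 : gradContrTwist (confMetric u g) (fun z a b c d => Real.exp (w * u z) * S z a b c d)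
      (fun z a b c d => Real.exp (w * u z) * T z a b c d) y = contrTwist (confMetric u g y)⁻¹
      (covDeriv (confMetric u g) (fun z a b c d => Real.exp (w * u z) * S z a b c d) y)
      (covDeriv (confMetric u g) (fun z a b c d => Real.exp (w * u z) * T z a b c d) y) := rfl
  rw [h1 S hS, h1 T hT, inv_confMetric u g y (hg.det_ne_zero y hy)] at h2 h3
  rw [contrFive_smul] at h2
  rw [contrTwist_smul] at h3
  have h4 : gradContr g S T y = contrFive (g y)⁻¹ (covDeriv g S y) (covDeriv g T y) := rfl
  have h5 : gradContrTwist g S T y = contrTwist (g y)⁻¹ (covDeriv g S y) (covDeriv g T y) := rfl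
  simp only [← hg.pd_contr hy hS hT] at key
  rw [← h4, ← h5] at key
  have e1 : Real.exp ((2 * w - 8) * u y) = Real.exp (-2 * u y) ^ 4 * Real.exp (w * u y) ^ 2 := by
    rw [← Real.exp_nat_mul, ← Real.exp_nat_mul, ← Real.exp_add]; congr 1; push_cast; ring
  have e2 : Real.exp ((4 * w - 18) * u y) = Real.exp (-2 * u y) ^ 9 * Real.exp (w * u y) ^ 4 := by
    rw [← Real.exp_nat_mul, ← Real.exp_nat_mul, ← Real.exp_add]; congr 1; push_cast; ring
  rw [pairInvariant, pairInvariant, contr_conf hg u w hy, gradSq_conf hg hu w hy hS hT, h2, h3, e1,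
    e2]
  -- The multiplier is `4(w-4)` times the scalar contraction. The coefficients in `key` factor as
  -- `(w-1)(w-6)` and `(w-1)(w-4)(w-6)`, matching the change of the squared gradient. Nine inverse
  -- metrics and four tensors occur in each product.
  linear_combination (Real.exp (-2 * u y) ^ 9 * Real.exp (w * u y) ^ 4 * contr g S T y
    * (4 * (w - 4))) * key

end

/-! ### The invariants of the theorem in coordinates. -/

section

open LocalMetric

variable {Ω : Set E4} {g : MetricComp} {u : E4 → ℝ} {y : E4}

/-- Agreement of the fields on the open set, not merely at the point, is what lets their derivatives
be exchanged. -/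
lemma pairInvariant_congr (hg : LocalMetric Ω g) (hy : y ∈ Ω) {S S' T T' : TensorComp}
    (hS : ∀ z ∈ Ω, S z = S' z) (hT : ∀ z ∈ Ω, T z = T' z) (w : ℝ) :
    pairInvariant w g S T y = pairInvariant w g S' T' y := by
  have h1 : ∀ z ∈ Ω, contr g S T z = contr g S' T' z := fun z hz => by
    simp only [contr, raise4, hS z hz, hT z hz]
  have h2 : gradSq g (contr g S T) y = gradSq g (contr g S' T') y := by
    simp only [gradSq, pd_congr hg.isOpen hy h1]
  have h3 : gradContr g S T y = gradContr g S' T' y := by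
    change contrFive (g y)⁻¹ (covDeriv g S y) (covDeriv g T y) = _
    rw [hg.covDeriv_congr hy hS, hg.covDeriv_congr hy hT]
    rfl
  have h4 : gradContrTwist g S T y = gradContrTwist g S' T' y := by
    change contrTwist (g y)⁻¹ (covDeriv g S y) (covDeriv g T y) = _
    rw [hg.covDeriv_congr hy hS, hg.covDeriv_congr hy hT]
    rfl
  rw [pairInvariant, pairInvariant, h1 y hy, h2, h3, h4]

lemma K4_eq_pairInvariant (g : MetricComp) (y : E4) :
    K4 g y = pairInvariant 2 g (weylDual g) (weyl g) y / 4 := by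
  simp only [K4, I2, I4, I4a, I6, pairInvariant]
  ring

lemma J4_eq_J4Weight (g : MetricComp) (W : TensorComp) (y : E4) :
    J4 g W y = J4Weight 2 g W y / 4 := by
  simp only [J4, J4Weight]
  ring

/-- Both the Weyl tensor and its dual have weight two, so the polarised covariance applies with `w =
2`, once the curvature tensors of the new metric are replaced by the rescaled old ones throughout
`Ω`. -/
theorem K4_conf (hg : LocalMetric Ω g) (hu : ContDiffOn ℝ ∞ u Ω) (hy : y ∈ Ω) :
    K4 (confMetric u g) y = Real.exp (-10 * u y) * K4 g y := by
  have hW : DiffAt (weyl g) y := hg.diffAt_of_contDiffOn hy hg.contDiffOn_weyl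
  have hs : ∀ z ∈ Ω, WeylSymm (g z)⁻¹ (weyl g z) := fun z hz => hg.weylSymm_weyl hz
  have h := pairInvariant_conf hg hu 2 hy (hg.diffAt_hodgeDual hy hW) hW
    (hg.weylJet_hodgeDual hy hW hs) (hg.weylJet hy hW hs)
  rw [K4_eq_pairInvariant, K4_eq_pairInvariant, pairInvariant_congr (hg.conf hu) hy
    (S' := fun z a b c d => Real.exp (2 * u z) * weylDual g z a b c d)
    (T' := fun z a b c d => Real.exp (2 * u z) * weyl g z a b c d)
    (fun z hz => funext fun a => funext fun b => funext fun c => funext fun d =>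
      hg.weylDual_conf hu hz a b c d)
    (fun z hz => funext fun a => funext fun b => funext fun c => funext fun d =>
      hg.weyl_conf hu hz a b c d), mul_div_assoc', show (-10 : ℝ) = 4 * 2 - 18 by norm_num]
  exact congrArg (· / 4) h

theorem J4Weight_conf (hg : LocalMetric Ω g) (hu : ContDiffOn ℝ ∞ u Ω) (hy : y ∈ Ω)
    {W : TensorComp} (hW : DiffAt W y) (hs : ∀ z ∈ Ω, WeylSymm (g z)⁻¹ (W z)) (w : ℝ) :
    J4Weight w (confMetric u g) (fun z a b c d => Real.exp (w * u z) * W z a b c d) y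
      = Real.exp ((4 * w - 18) * u y) * J4Weight w g W y :=
  pairInvariant_conf hg hu w hy hW hW (hg.weylJet hy hW hs) (hg.weylJet hy hW hs)

theorem J4_conf (hg : LocalMetric Ω g) (hu : ContDiffOn ℝ ∞ u Ω) (hy : y ∈ Ω)
    {W : TensorComp} (hW : DiffAt W y) (hs : ∀ z ∈ Ω, WeylSymm (g z)⁻¹ (W z)) :
    J4 (confMetric u g) (fun z a b c d => Real.exp (2 * u z) * W z a b c d) y
      = Real.exp (-10 * u y) * J4 g W y := by
  rw [J4_eq_J4Weight, J4_eq_J4Weight, J4Weight_conf hg hu hy hW hs]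
  norm_num
  ring

/-! ### The vector which vanishes identically -/

section Vector

variable {W : TensorComp}

/-- The factor `2` is the Leibniz rule for a square. -/
lemma sum_mulVec_mul_pd_I1 (hg : LocalMetric Ω g) (hy : y ∈ Ω) (hW : DiffAt W y)
    {B : Matrix (Fin 4) (Fin 4) ℂ} (hB : castMatrix (g y)⁻¹ = B * B.transpose) (v : Fin 4 → ℝ) :
    ((∑ a, (g y)⁻¹.mulVec v a * pd a (I1 g W) y : ℝ) : ℂ)
      = 2 * gradPair (frame1 B fun a => (v a : ℂ)) (frame5 B (castFive (covDeriv g W y)))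
        (frame4 B (castFour (W y))) := by
  have comm : ∀ S T, contr4 (g y)⁻¹ S T = contr4 (g y)⁻¹ T S := fun S T => by
    have : ((contr4 (g y)⁻¹ S T : ℝ) : ℂ) = ((contr4 (g y)⁻¹ T S : ℝ) : ℂ) := by
      rw [contr4_cast hB, contr4_cast hB]; simp only [mul_comm]
    exact_mod_cast this
  rw [gradPair_cast hB, ← Complex.ofReal_ofNat, ← Complex.ofReal_mul, Finset.mul_sum]
  congr 1
  refine Finset.sum_congr rfl fun a _ => ?_
  rw [I1, hg.pd_contr hy hW hW, comm (W y)]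
  ring

lemma castFour_raise4 (g : MetricComp) (W : TensorComp) (y : E4) (a b c d : Fin 4) :
    ((raise4 g W y a b c d : ℝ) : ℂ)
      = raiseFour (castMatrix (g y)⁻¹) (castFour (W y)) a b c d := by
  simp only [raise4, Complex.ofReal_sum, Complex.ofReal_mul]
  rfl

lemma sum_mul_auxM {B : Matrix (Fin 4) (Fin 4) ℂ} (hB : castMatrix (g y)⁻¹ = B * B.transpose)
    (v : Fin 4 → ℝ) :
    ((∑ a, (g y)⁻¹.mulVec v a * ∑ e, auxM g W y e a e : ℝ) : ℂ)
      = twistPair (frame1 B fun a => (v a : ℂ)) (frame5 B (castFive (covDeriv g W y)))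
        (frame4 B (castFour (W y))) := by
  rw [twistPair_frame hB, castMatrix_mulVec]
  simp only [auxM, ← castFour_raise4, castFive, ← Complex.ofReal_mul, ← Complex.ofReal_sum,
    Finset.mul_sum]
  rw [sum_swap_bc, sum_swap_cd, sum_swap_de]
  congr 1
  exact sum_congr_five fun _ _ _ _ _ => by ring

lemma sum_mul_auxN {B : Matrix (Fin 4) (Fin 4) ℂ} (hB : castMatrix (g y)⁻¹ = B * B.transpose)
    (v : Fin 4 → ℝ) :
    ((∑ a, (g y)⁻¹.mulVec v a * ∑ e, auxN g W y e e a : ℝ) : ℂ)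
      = crossPair (frame1 B fun a => (v a : ℂ)) (frame5 B (castFive (covDeriv g W y)))
        (frame4 B (castFour (W y))) := by
  rw [crossPair_frame hB, castMatrix_mulVec]
  simp only [auxN, ← castFour_raise4, castFive, ← Complex.ofReal_mul, ← Complex.ofReal_sum,
    Finset.mul_sum]
  rw [sum_swap_ab, sum_swap_bc]
  congr 1
  exact sum_congr_five fun _ _ _ _ _ => by ring

lemma sum_mul_lower_auxM (hg : LocalMetric Ω g) (hy : y ∈ Ω) {B : Matrix (Fin 4) (Fin 4) ℂ}
    (hB : castMatrix (g y)⁻¹ = B * B.transpose) (v : Fin 4 → ℝ) :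
    ((∑ a, (g y)⁻¹.mulVec v a * ∑ p, ∑ q, ∑ e, g y a p * ginv g y e q * auxM g W y p q e : ℝ) : ℂ)
      = divPair (frame1 B fun a => (v a : ℂ)) (frame5 B (castFive (covDeriv g W y)))
        (frame4 B (castFour (W y))) := by
  have h1 : ∀ X : Fin 4 → ℝ, ∑ a, (g y)⁻¹.mulVec v a * ∑ p, g y a p * X p = ∑ p, v p * X p := by
    intro X
    have : ∀ p, ∑ a, g y p a * (g y)⁻¹.mulVec v a = v p := fun p => by
      change (g y).mulVec ((g y)⁻¹.mulVec v) p = v p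
      rw [Matrix.mulVec_mulVec, hg.mul_inv hy, Matrix.one_mulVec]
    simp only [← this, Finset.mul_sum, Finset.sum_mul]
    rw [Finset.sum_comm]
    exact Finset.sum_congr rfl fun p _ => Finset.sum_congr rfl fun a _ => by
      rw [hg.symm y hy a p]; ring
  have h2 : ∑ a, (g y)⁻¹.mulVec v a * ∑ p, ∑ q, ∑ e, g y a p * ginv g y e q * auxM g W y p q e
      = ∑ p, v p * ∑ q, ∑ e, ginv g y e q * auxM g W y p q e := by
    refine Eq.trans ?_ (h1 fun p => ∑ q, ∑ e, ginv g y e q * auxM g W y p q e)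
    simp only [Finset.mul_sum, mul_assoc]
  rw [h2]
  rw [divPair_frame hB (castMatrix_mul (hg.inv_mul hy))]
  have h4 : ∀ e a, castMatrix (g y)⁻¹ e a = ((ginv g y e a : ℝ) : ℂ) := fun e a => rfl
  simp only [h4, auxM, ← castFour_raise4, castFive, ← Complex.ofReal_mul, ← Complex.ofReal_sum,
    Finset.mul_sum]
  rw [Complex.ofReal_inj]
  have h5 : ∀ f : Fin 4 → Fin 4 → Fin 4 → Fin 4 → Fin 4 → Fin 4 → ℝ,
      ∑ p, ∑ q, ∑ e, ∑ b, ∑ c, ∑ d, f p q e b c d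
        = ∑ q, ∑ b, ∑ c, ∑ d, ∑ e, ∑ p, f p q e b c d := fun f => by
    rw [Finset.sum_comm]
    refine Finset.sum_congr rfl fun q _ => ?_
    rw [sum_swap_ab, sum_swap_bc, sum_swap_cd, sum_swap_de, sum_swap_ab, sum_swap_bc, sum_swap_cd]
  rw [h5]
  exact sum_congr_five fun _ _ _ _ _ => Finset.sum_congr rfl fun _ _ => by ring

theorem vecA_eq_zero (hg : LocalMetric Ω g) (hy : y ∈ Ω) (hW : DiffAt W y)
    (hs : ∀ z ∈ Ω, WeylSymm (g z)⁻¹ (W z)) (a : Fin 4) : vecA g W y a = 0 := by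
  obtain ⟨B, hB⟩ := exists_orthonormal_frame (hg.transpose_inv hy)
  have key : ∀ v : Fin 4 → ℝ, ∑ a, (g y)⁻¹.mulVec v a * vecA g W y a = 0 := fun v => by
    have h := pair_identity (hg.weylJet hy hW hs B hB).2 (hg.weylJet hy hW hs B hB).1
      (frame1 B fun a => (v a : ℂ))
    have h1 := sum_mulVec_mul_pd_I1 hg hy hW hB v
    rw [← sum_mul_auxM hB, ← sum_mul_auxN hB, ← sum_mul_lower_auxM hg hy hB] at h
    have h' : ∀ G M1 M2 N : ℂ, ∀ d : ℂ, d = 2 * G →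
        -8 * G - 16 * M1 + 16 * M2 + 64 * N = 0 → -4 * d - 16 * M1 + 16 * M2 + 64 * N = 0 :=
      fun G M1 M2 N d hd hh => by rw [hd]; linear_combination hh
    have h2 := h' _ _ _ _ _ h1 h
    have h3 : ∑ a, (g y)⁻¹.mulVec v a * vecA g W y a
        = -4 * (∑ a, (g y)⁻¹.mulVec v a * pd a (I1 g W) y)
          - 16 * (∑ a, (g y)⁻¹.mulVec v a * ∑ e, auxM g W y e a e)
          + 16 * (∑ a, (g y)⁻¹.mulVec v a
            * ∑ p, ∑ q, ∑ e, g y a p * ginv g y e q * auxM g W y p q e)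
          + 64 * (∑ a, (g y)⁻¹.mulVec v a * ∑ e, auxN g W y e e a) := by
      rw [Finset.mul_sum, Finset.mul_sum, Finset.mul_sum (a := (16 : ℝ)),
        Finset.mul_sum (a := (64 : ℝ)), ← Finset.sum_sub_distrib, ← Finset.sum_add_distrib,
        ← Finset.sum_add_distrib]
      exact Finset.sum_congr rfl fun a _ => by rw [vecA]; ring
    rw [h3]
    exact_mod_cast h2
  -- Lowering a basis vector undoes the raising in `key` and isolates one component.
  have h := key ((g y).mulVec (Pi.single a 1))
  rw [Matrix.mulVec_mulVec, hg.inv_mul hy, Matrix.one_mulVec] at h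
  simpa [Pi.single_apply] using h

end Vector

end

/-! ### From charts on a manifold to coordinate components. -/

section

section Manifold

variable {M : Type*} [TopologicalSpace M] [ChartedSpace E4 M]

lemma metricComp_conf (e : OpenPartialHomeomorph M E4) {g gHat : BilinField M} {U : M → ℝ}
    (h : ∀ x, gHat x = Real.exp (2 * U x) • g x) :
    metricComp e gHat = confMetric (fun z => U (e.symm z)) (metricComp e g) := by
  funext y
  ext a b
  simp only [metricComp, confMetric, Matrix.of_apply, Matrix.smul_apply, h]
  rfl

lemma tensorComp_conf (e : OpenPartialHomeomorph M E4) {W WHat : TensorField M} {U : M → ℝ}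
    {w : ℝ} (h : ∀ x, WHat x = Real.exp (w * U x) • W x) :
    tensorComp e WHat = fun z a b c d => Real.exp (w * U (e.symm z)) * tensorComp e W z a b c d := by
  funext z a b c d
  simp only [tensorComp, h]
  rfl

variable {e : OpenPartialHomeomorph M E4}

lemma contDiffOn_comp_symm (he : e ∈ IsManifold.maximalAtlas (𝓡 4) ∞ M) {U : M → ℝ}
    (hU : ContMDiff (𝓡 4) 𝓘(ℝ, ℝ) ∞ U) : ContDiffOn ℝ ∞ (fun z => U (e.symm z)) e.target :=
  contMDiffOn_iff_contDiffOn.1 (hU.comp_contMDiffOn (contMDiffOn_symm_of_mem_maximalAtlas he))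

lemma mdifferentiable_symm (he : e ∈ IsManifold.maximalAtlas (𝓡 4) ∞ M) :
    e.symm.MDifferentiable (𝓡 4) (𝓡 4) :=
  ⟨(contMDiffOn_symm_of_mem_maximalAtlas he).mdifferentiableOn (by simp),
    (contMDiffOn_of_mem_maximalAtlas he).mdifferentiableOn (by simp)⟩

/-- The coordinate vectors form a basis of the tangent space. -/
lemma exists_coordBasis [IsManifold (𝓡 4) ∞ M]
    (he : e ∈ IsManifold.maximalAtlas (𝓡 4) ∞ M) {y : E4}
    (hy : y ∈ e.target) :
    ∃ b : Module.Basis (Fin 4) ℝ (TangentSpace (𝓡 4) (e.symm y)), ∀ i, b i = coordVec e y i := by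
  let L := (mdifferentiable_symm he).mfderiv (x := y) hy
  let b0 : Module.Basis (Fin 4) ℝ (TangentSpace (𝓡 4) y) :=
    (EuclideanSpace.basisFun (Fin 4) ℝ).toBasis
  have h0 : ∀ i, b0 i = (EuclideanSpace.single i (1 : ℝ) : E4) := fun i => by
    change (EuclideanSpace.basisFun (Fin 4) ℝ).toBasis i = _
    rw [OrthonormalBasis.coe_toBasis, EuclideanSpace.basisFun_apply]
  refine ⟨b0.map L.toLinearEquiv, fun i => ?_⟩
  rw [Module.Basis.map_apply, h0]
  rfl

lemma IsPseudoRiemannianMetric.localMetric [IsManifold (𝓡 4) ∞ M] {g : BilinField M} (hg : IsPseudoRiemannianMetric g)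
    (he : e ∈ IsManifold.maximalAtlas (𝓡 4) ∞ M) : LocalMetric e.target (metricComp e g) where
  isOpen := e.open_target
  smooth a b := hg.smooth e he a b
  symm y _ a b := hg.symm _ _ _
  det_ne_zero y hy := by
    obtain ⟨b, hb⟩ := exists_coordBasis he hy
    -- The component matrix represents the bilinear form in the coordinate basis, so nondegeneracy
    -- of the form becomes nonvanishing of the determinant.
    have h : metricComp e g y = LinearMap.BilinForm.toMatrix b (g (e.symm y)) := by
      ext i j
      simp only [metricComp, Matrix.of_apply, LinearMap.BilinForm.toMatrix_apply, hb]
    rw [h]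
    rw [← Matrix.nondegenerate_iff_det_ne_zero, LinearMap.BilinForm.nondegenerate_toMatrix_iff]
    exact ⟨hg.nondegenerate _, fun v hv => hg.nondegenerate _ v fun w => by
      rw [hg.symm]; exact hv w⟩

lemma IsWeylLike.weylSymm [IsManifold (𝓡 4) ∞ M] {g : BilinField M} {W : TensorField M} (hW : IsWeylLike g W)
    (he : e ∈ IsManifold.maximalAtlas (𝓡 4) ∞ M) {y : E4} (hy : y ∈ e.target) :
    WeylSymm (metricComp e g y)⁻¹ (tensorComp e W y) where
  antisymm_left a b c d := hW.antisymm_left _ _ _ _ _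
  antisymm_right a b c d := hW.antisymm_right _ _ _ _ _
  pair_symm a b c d := hW.pair_symm _ _ _ _ _
  bianchi a b c d := hW.bianchi _ _ _ _ _
  trace_free b d := by
    obtain ⟨β, hβ⟩ := exists_coordBasis he hy
    have h := hW.trace_free (e.symm y) β (coordVec e y b) (coordVec e y d)
    simp only [hβ] at h
    exact h

end Manifold

end

end ConfCov

end

theorem mainTheorem1 {M : Type*} [TopologicalSpace M] [ChartedSpace ConfCov.E4 M]
    [IsManifold (𝓡 4) ∞ M]
    (g : ConfCov.BilinField M) (hg : ConfCov.IsPseudoRiemannianMetric g)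
    (U : M → ℝ) (hU : ContMDiff (𝓡 4) 𝓘(ℝ, ℝ) ∞ U)
    (gHat : ConfCov.BilinField M) (hgHat : ∀ x, gHat x = Real.exp (2 * U x) • g x)
    (e : OpenPartialHomeomorph M ConfCov.E4)
    (he : e ∈ IsManifold.maximalAtlas (𝓡 4) ∞ M) :
    (∀ x ∈ e.source,
      ConfCov.K4 (ConfCov.metricComp e gHat) (e x) =
        Real.exp (-10 * U x) * ConfCov.K4 (ConfCov.metricComp e g) (e x)) ∧
    ∀ W : ConfCov.TensorField M, ConfCov.IsSmoothTensor W → ConfCov.IsWeylLike g W →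
      (∀ WHat : ConfCov.TensorField M, (∀ x, WHat x = Real.exp (2 * U x) • W x) →
        ∀ x ∈ e.source,
          ConfCov.J4 (ConfCov.metricComp e gHat) (ConfCov.tensorComp e WHat) (e x) =
            Real.exp (-10 * U x) *
              ConfCov.J4 (ConfCov.metricComp e g) (ConfCov.tensorComp e W) (e x)) ∧
      (∀ (w : ℝ) (WHat : ConfCov.TensorField M), (∀ x, WHat x = Real.exp (w * U x) • W x) →
        ∀ x ∈ e.source,
          ConfCov.J4Weight w (ConfCov.metricComp e gHat) (ConfCov.tensorComp e WHat) (e x) =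
            Real.exp ((4 * w - 18) * U x) *
              ConfCov.J4Weight w (ConfCov.metricComp e g) (ConfCov.tensorComp e W) (e x)) ∧
      ∀ x ∈ e.source, ∀ a : Fin 4,
        ConfCov.vecA (ConfCov.metricComp e g) (ConfCov.tensorComp e W) (e x) a = 0 := by
  have hl := hg.localMetric he
  have hu := ConfCov.contDiffOn_comp_symm he hU
  -- In the chart, the hatted metric is literally the coordinate conformal change with factor `U ∘
  -- e.symm`; the coordinate theorems then apply at `e x`.
  rw [ConfCov.metricComp_conf e hgHat]
  refine ⟨fun x hx => ?_, fun W hW hs => ?_⟩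
  · have h := ConfCov.K4_conf hl hu (e.map_source hx)
    simpa only [e.left_inv hx] using h
  · have hd : ∀ x ∈ e.source, ConfCov.LocalMetric.DiffAt (ConfCov.tensorComp e W) (e x) :=
      fun x hx => hl.diffAt_of_contDiffOn (e.map_source hx) (hW e he)
    have hs' := fun z hz => hs.weylSymm he (y := z) hz
    refine ⟨fun WHat h x hx => ?_, fun w WHat h x hx => ?_, fun x hx a => ?_⟩
    · have h1 := ConfCov.J4_conf hl hu (e.map_source hx) (hd x hx) hs'
      rw [ConfCov.tensorComp_conf e h]
      simpa only [e.left_inv hx] using h1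
    · have h1 := ConfCov.J4Weight_conf hl hu (e.map_source hx) (hd x hx) hs' w
      rw [ConfCov.tensorComp_conf e h]
      simpa only [e.left_inv hx] using h1
    · exact ConfCov.vecA_eq_zero hl (e.map_source hx) (hd x hx) hs' a
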